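/- Fix a countably infinite set $\mathrm{Vars}$ of variables and a strict total order $\prec$ on the set of variable operations $\{\vdash_x,\dashv_x : x\in \mathrm{Vars}\}$ with $\vdash_x\prec\dashv_x$ for every $x$ (here $\vdash_x$ opens and $\dashv_x$ closes $x$). For a commutative semiring $\mathbb K$, a *$\mathbb K$-weighted vset-automaton* $A=(\Sigma,V,Q,I,F,\delta)$ has a finite alphabet $\Sigma$, a finite set $V\subseteq\mathrm{Vars}$, a finite set $Q$ of states, and weight functions $I,F:Q\to\mathbb K$ and $\delta:Q\times(\Sigma\cup\{\varepsilon\}\cup\Gamma_V)\times Q\to\mathbb K$, where $\Gamma_V=\{\vdash_x,\dashv_x: x\in V\}$. A *run* is a sequence $q_0\xrightarrow{a_1}q_1\cdots\xrightarrow{a_m}q_m$ with $I(q_0)$, $F(q_m)$ and all $\delta(q_{i-1},a_i,q_i)$ nonzero; its weight is the product of these values, and its *ref-word* is $a_1\cdots a_m$ (as a word, with $\varepsilon$ erased). $\mathcal R(A)$ is the set of ref-words of runs of $A$. A ref-word $r$ yields a document $\mathrm{doc}(r)\in\Sigma^*$ by erasing the variable operations. If each $x\in V$, and no other variable, is opened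 exactly once and closed exactly once, in this order, it also yields the $V$-tuple $\mathrm{tup}(r)$ that maps $x$ to the span $[i,j\rangle$ of positions of $\mathrm{doc}(r)$ at which $x$ is opened and closed. $A$ is *functional* if every $r\in\mathcal R(A)$ is of this kind. $A$ is *unambiguous* if adjacent variable operations in every $r\in\mathcal R(A)$ are increasing with respect to $\prec$, and there is exactly one run of $A$ on every $r\in\mathcal R(A)$. All automata are assumed to be free of cycles of $\varepsilon$-transitions. Put $$A(d)=\{\mathrm{tup}(r): r\in\mathcal R(A),\ \mathrm{doc}(r)=d\},\qquad [\![A]\!]_{\mathbb K}(d,t)=\bigoplus_{\rho}\ \mathrm{weight}(\rho),$$ where $\rho$ ranges over the runs whose ref-word $r$ has $\mathrm{doc}(r)=d$ and $\mathrm{tup}(r)=t$. Let uVSA be the class of unambiguous functional vset-automata over the Boolean semiring, and let $\mathrm{UReg}_{\mathbb T}$ be the class of unambiguous functional vset-automata over the tropical semiring $\mathbb T=(\mathbb Q\cup\{\infty\},\min,+,\infty,0)$. **Theorem.** The problem $\mathrm{Sum}[\mathrm{uVSA},\mathrm{UReg}_{\mathbb T}]$ is in FP: the function that maps an automaton $A\in\mathrm{uVSA}$,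 a document $d$ and an automaton $W\in\mathrm{UReg}_{\mathbb T}$ (all over the same alphabet, which is part of the input, and with $\mathrm{Vars}(W)\subseteq\mathrm{Vars}(A)$) to $$\sum_{t\in A(d)} w(d,t)\in\mathbb Q\cup\{\infty\},\qquad w(d,t)=[\![W]\!]_{\mathbb T}\bigl(d,\pi_{\mathrm{Vars}(W)}t\bigr),$$ can be computed by a Turing machine in time polynomial in the length of the input. Here an automaton is given by its set of variables and the complete tables of $I$, $F$ and $\delta$, and numbers are written in binary, rational numbers as reduced fractions. The sum is the ordinary sum of numbers, with $x+\infty=\infty$; so it is $\infty$ if $w(d,t)=\infty$ for some $t\in A(d)$, and it is $0$ if $A(d)=\emptyset$. -/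

import Mathlib

namespace Spanner

/-! ### Semirings -/

/-- The Boolean semiring `({false, true}, ∨, ∧, false, true)`. A separate type, because the ring
structure that Mathlib puts on `Bool` has exclusive or as its addition. -/
inductive BoolSemiring
  | ff
  | tt
  deriving DecidableEq

namespace BoolSemiring

/-- Disjunction. -/
def or : BoolSemiring → BoolSemiring → BoolSemiring
  | ff, b => b
  | tt, _ => tt

/-- Conjunction. -/
def and : BoolSemiring → BoolSemiring → BoolSemiring
  | ff, _ => ff
  | tt, b => b

instance : Zero BoolSemiring := ⟨ff⟩
instance : One BoolSemiring := ⟨tt⟩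
instance : Add BoolSemiring := ⟨or⟩
instance : Mul BoolSemiring := ⟨and⟩

instance : CommSemiring BoolSemiring where
  add_assoc := by intro a b c; cases a <;> cases b <;> cases c <;> rfl
  zero_add := by intro a; cases a <;> rfl
  add_zero := by intro a; cases a <;> rfl
  add_comm := by intro a b; cases a <;> cases b <;> rfl
  mul_assoc := by intro a b c; cases a <;> cases b <;> cases c <;> rfl
  one_mul := by intro a; cases a <;> rfl
  mul_one := by intro a; cases a <;> rfl
  mul_comm := by intro a b; cases a <;> cases b <;> rfl
  zero_mul := by intro a; cases a <;> rfl
  mul_zero := by intro a; cases a <;> rfl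
  left_distrib := by intro a b c; cases a <;> cases b <;> cases c <;> rfl
  right_distrib := by intro a b c; cases a <;> cases b <;> cases c <;> rfl
  nsmul := nsmulRec
  npow := npowRec

end BoolSemiring

/-- The tropical semiring `(ℚ ∪ {∞}, min, +, ∞, 0)`. -/
abbrev TropicalQ : Type := Tropical (WithTop ℚ)

/-! ### Documents, spans and ref-words -/

/-- Variable operations over the countably infinite set `ℕ` of variables:
`opn x` opens and `cls x` closes the variable `x`. -/
inductive VarOp
  | opn (x : ℕ)
  | cls (x : ℕ)
  deriving DecidableEq

/-- The variable of a variable operation. -/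
def VarOp.var : VarOp → ℕ
  | opn x => x
  | cls x => x

/-- The extended alphabet `Σ ∪ Γ_Vars`, where `Σ = Fin k`. -/
inductive Sym (k : ℕ)
  | letter (a : Fin k)
  | op (o : VarOp)
  deriving DecidableEq

/-- A document over the alphabet `Fin k`. -/
abbrev Doc (k : ℕ) : Type := List (Fin k)

/-- A ref-word over the alphabet `Fin k`. -/
abbrev RefWord (k : ℕ) : Type := List (Sym k)

/-- The pair `(i, j)` stands for the span `[i, j⟩`; positions are counted from `1`. -/
abbrev Span : Type := ℕ × ℕ

/-- A tuple over the finite set `V` of variables. -/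
abbrev Tup (V : Finset ℕ) : Type := V → Span

namespace RefWord

variable {k : ℕ}

/-- The letter that a symbol contributes to the document, if any. -/
def letter? : Sym k → Option (Fin k)
  | .letter a => some a
  | .op _ => none

/-- The document of a ref-word: the variable operations are erased. -/
def doc (r : RefWord k) : Doc k := r.filterMap letter?

/-- `r = pre · ⊢x · mid · x⊣ · post` for some `pre`, `mid` and `post`. -/
def Factors (r : RefWord k) (x : ℕ) : Prop :=
  ∃ pre mid post : RefWord k,
    r = pre ++ [Sym.op (.opn x)] ++ mid ++ [Sym.op (.cls x)] ++ post

/-- A ref-word is valid if every variable that occurs in it is opened exactly once and closed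
exactly once, the latter after the former. -/
def Valid (r : RefWord k) : Prop :=
  ∀ x : ℕ, (Sym.op (.opn x) ∈ r ∨ Sym.op (.cls x) ∈ r) →
    r.count (Sym.op (.opn x)) = 1 ∧ r.count (Sym.op (.cls x)) = 1 ∧ Factors r x

/-- The set of variables that occur in a (valid) ref-word. -/
def vars (r : RefWord k) : Set ℕ := {x | Factors r x}

/-- The position in the document at which the operation `o` occurs (for the first time). -/
def pos (r : RefWord k) (o : VarOp) : ℕ :=
  (doc (r.takeWhile fun a => a ≠ Sym.op o)).length + 1

/-- The tuple over `V` encoded by a valid ref-word `r` with `vars r = V`. -/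
def tup (V : Finset ℕ) (r : RefWord k) : Tup V := fun x => (pos r (.opn x), pos r (.cls x))

/-- The relation between neighbouring symbols that the variable order condition asks for. -/
def Ordered (lt : VarOp → VarOp → Prop) : Sym k → Sym k → Prop
  | .op o, .op o' => lt o o'
  | _, _ => True

/-- The variable order condition: adjacent variable operations are increasing. -/
def OrderCondition (lt : VarOp → VarOp → Prop) (r : RefWord k) : Prop :=
  r.IsChain (Ordered lt)

end RefWord

/-! ### Weighted variable-set automata -/

/-- A `K`-weighted vset-automaton over the alphabet `Fin k`, with set of states `Fin n`.
The label `none` of a transition stands for `ε`. Transitions on operations of variables outside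
`vars` do not exist (they have weight zero). -/
structure VsetAutomaton (K : Type) [CommSemiring K] (k : ℕ) where
  vars : Finset ℕ
  n : ℕ
  init : Fin n → K
  final : Fin n → K
  trans : Fin n → Option (Sym k) → Fin n → K
  trans_eq_zero : ∀ p o q, o.var ∉ vars → trans p (some (Sym.op o)) q = 0

namespace VsetAutomaton

variable {K : Type} [CommSemiring K] {k : ℕ}

/-- A sequence `q₀ →(a₁) q₁ →(a₂) ⋯ →(aₘ) qₘ` of states and labels: the state `q₀` and the list
`(a₁, q₁), …, (aₘ, qₘ)`. -/
structure StateSeq (A : VsetAutomaton K k) where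
  start : Fin A.n
  steps : List (Option (Sym k) × Fin A.n)

/-- The last state of a sequence that starts in the given state. -/
def lastState (A : VsetAutomaton K k) : Fin A.n → List (Option (Sym k) × Fin A.n) → Fin A.n
  | p, [] => p
  | _, (_, q) :: l => A.lastState q l

/-- All steps of the sequence are transitions, that is, have nonzero weight. -/
def IsPath (A : VsetAutomaton K k) : Fin A.n → List (Option (Sym k) × Fin A.n) → Prop
  | _, [] => True
  | p, (a, q) :: l => A.trans p a q ≠ 0 ∧ A.IsPath q l

/-- The product of the weights of the steps of the sequence. -/
def pathWeight (A : VsetAutomaton K k) : Fin A.n → List (Option (Sym k) × Fin A.n) → K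
  | _, [] => 1
  | p, (a, q) :: l => A.trans p a q * A.pathWeight q l

/-- A run: it starts in an initial state, follows transitions, and ends in an accepting state. -/
def IsRun (A : VsetAutomaton K k) (ρ : A.StateSeq) : Prop :=
  A.init ρ.start ≠ 0 ∧ A.IsPath ρ.start ρ.steps ∧ A.final (A.lastState ρ.start ρ.steps) ≠ 0

/-- The ref-word of a run: the concatenation of its labels. -/
def refWord (A : VsetAutomaton K k) (ρ : A.StateSeq) : RefWord k := ρ.steps.filterMap Prod.fst

/-- The weight of a run. -/
def weight (A : VsetAutomaton K k) (ρ : A.StateSeq) : K :=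
  A.init ρ.start * A.pathWeight ρ.start ρ.steps * A.final (A.lastState ρ.start ρ.steps)

/-- The ref-word language of an automaton. -/
def refLang (A : VsetAutomaton K k) : Set (RefWord k) :=
  {r | ∃ ρ : A.StateSeq, A.IsRun ρ ∧ A.refWord ρ = r}

/-- All ref-words of the language are valid and have exactly the variables of the automaton. -/
def Functional (A : VsetAutomaton K k) : Prop :=
  ∀ r ∈ A.refLang, RefWord.Valid r ∧ RefWord.vars r = (A.vars : Set ℕ)

/-- There is no cycle of `ε`-transitions. -/
def NoEpsCycle (A : VsetAutomaton K k) : Prop :=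
  ∀ q, ¬ Relation.TransGen (fun p p' => A.trans p none p' ≠ 0) q q

/-- Unambiguity: the variable order condition holds, and there is exactly one run on every
ref-word of the language. -/
def Unambiguous (lt : VarOp → VarOp → Prop) (A : VsetAutomaton K k) : Prop :=
  (∀ r ∈ A.refLang, RefWord.OrderCondition lt r) ∧
    ∀ r ∈ A.refLang, ∃! ρ : A.StateSeq, A.IsRun ρ ∧ A.refWord ρ = r

/-- The class of unambiguous functional `K`-weighted vset-automata (without `ε`-cycles):
for the Boolean semiring this is `uVSA`, for the tropical semiring it is `UReg_T`. -/
structure IsUReg (lt : VarOp → VarOp → Prop) (A : VsetAutomaton K k) : Prop where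
  functional : A.Functional
  noEpsCycle : A.NoEpsCycle
  unambiguous : A.Unambiguous lt

/-- The document spanner of an automaton: the set of tuples that it extracts from a document. -/
def spanner (A : VsetAutomaton K k) (d : Doc k) : Set (Tup A.vars) :=
  {t | ∃ r ∈ A.refLang, RefWord.doc r = d ∧ RefWord.tup A.vars r = t}

/-- The `K`-annotator of an automaton: the weight of a tuple on a document is the sum (in `K`)
of the weights of the valid runs for it. If there are no `ε`-cycles, there are finitely many. -/
noncomputable def annotate (A : VsetAutomaton K k) (d : Doc k) (t : Tup A.vars) : K :=
  ∑ᶠ ρ ∈ {ρ : A.StateSeq | A.IsRun ρ ∧ RefWord.Valid (A.refWord ρ) ∧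
      RefWord.vars (A.refWord ρ) = (A.vars : Set ℕ) ∧
      RefWord.doc (A.refWord ρ) = d ∧ RefWord.tup A.vars (A.refWord ρ) = t}, A.weight ρ

end VsetAutomaton

/-! ### The problem Sum[uVSA, UReg_T] -/

/-- An input: an alphabet `Fin k`, a spanner in `uVSA`, a document, and an automaton in `UReg_T`
that represents the weight function and uses only variables of the spanner. -/
structure SumInstance (lt : VarOp → VarOp → Prop) where
  k : ℕ
  A : VsetAutomaton BoolSemiring k
  d : Doc k
  W : VsetAutomaton TropicalQ k
  A_mem : A.IsUReg lt
  W_mem : W.IsUReg lt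
  vars_subset : W.vars ⊆ A.vars

/-- The weight of a tuple `t` over the variables of the spanner: the weight that `W` assigns to
the restriction of `t` to the variables of `W`. -/
noncomputable def SumInstance.weight {lt : VarOp → VarOp → Prop} (I : SumInstance lt)
    (t : Tup I.A.vars) : WithTop ℚ :=
  Tropical.untrop (I.W.annotate I.d (Finset.restrict₂ (π := fun _ => Span) I.vars_subset t))

/-- The sum (the ordinary one, with `x + ∞ = ∞`) of the weights of all extracted tuples. -/
noncomputable def SumInstance.sum {lt : VarOp → VarOp → Prop} (I : SumInstance lt) : WithTop ℚ :=
  ∑ᶠ t ∈ I.A.spanner I.d, I.weight t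

/-! ### Encodings -/

/-- A list of numbers, each in binary (least significant bit first) and followed by a comma. -/
def encodeNats (l : List ℕ) : List Computability.Γ' :=
  l.flatMap fun n =>
    (Computability.encodeNat n).map Computability.Γ'.bit ++ [Computability.Γ'.comma]

/-- Truth values as numbers. -/
def boolCode : BoolSemiring → List ℕ
  | .ff => [0]
  | .tt => [1]

/-- A rational number as sign, absolute value of the numerator, and denominator, in lowest terms;
`∞` is written as `1 / 0`. -/
def ratCode : WithTop ℚ → List ℕ
  | none => [0, 1, 0]
  | some q => [if q < 0 then 1 else 0, q.num.natAbs, q.den]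

namespace VsetAutomaton

variable {K : Type} [CommSemiring K] {k : ℕ}

/-- The list of all labels `Σ ∪ {ε} ∪ Γ_V` of an automaton. -/
def labels (A : VsetAutomaton K k) : List (Option (Sym k)) :=
  [none] ++ (List.finRange k).map (fun a => some (Sym.letter a)) ++
    (A.vars.sort (· ≤ ·)).flatMap fun x => [some (Sym.op (.opn x)), some (Sym.op (.cls x))]

/-- An automaton is written down as the number of states, the variables, and the complete tables
of its initial, final and transition weights. -/
def code (enc : K → List ℕ) (A : VsetAutomaton K k) : List ℕ :=
  [A.n, A.vars.card] ++ A.vars.sort (· ≤ ·) ++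
    (List.finRange A.n).flatMap (fun q => enc (A.init q)) ++
    (List.finRange A.n).flatMap (fun q => enc (A.final q)) ++
    (List.finRange A.n).flatMap (fun p => A.labels.flatMap fun a =>
      (List.finRange A.n).flatMap fun q => enc (A.trans p a q))

end VsetAutomaton

/-- The input word for an instance: alphabet size, spanner, document, weight automaton. -/
def SumInstance.encode {lt : VarOp → VarOp → Prop} (I : SumInstance lt) :
    List Computability.Γ' :=
  encodeNats ([I.k] ++ I.A.code boolCode ++ [I.d.length] ++ I.d.map Fin.val ++
    I.W.code fun w => ratCode (Tropical.untrop w))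

/-- The output word for a value. -/
def encodeValue (v : WithTop ℚ) : List Computability.Γ' := encodeNats (ratCode v)

/-- `f` is in `FP` with respect to the given encodings of inputs and outputs: it is computed by
a (multi-stack) Turing machine in polynomial time. -/
def InFP {α β Γ₀ Γ₁ : Type} (encIn : α → List Γ₀) (encOut : β → List Γ₁) (f : α → β) : Prop :=
  Nonempty (Turing.TM2ComputableInPolyTime encIn encOut f)

end Spanner

/-! A ref-word that satisfies the order condition is determined by its document and its tuple
(`RefWord.ext_of_tup`), and unambiguity allows only one run on it. So the tuples in $A(d)$
correspond one to one to the runs of $A$ on $d$. Projecting a tuple to $\mathrm{Vars}(W)$ amounts to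
erasing the operations of all other variables from the ref-word (`RefWord.tup_restrict_iff`), and
since $W$ is unambiguous, the tropical sum that defines $w(d,t)$ has at most one term. Hence the
required number is a sum over the runs of $A$ on $d$, in which each run contributes the weight of
the only run of $W$ on its restricted ref-word, and $\infty$ if there is none.

There can be exponentially many runs, and the weight adds up along a path while products along paths
are what a transfer matrix computes. Dual numbers reconcile the two. A weight $q$ is replaced by
$1+q\varepsilon$ and $\infty$ by $0$. The product along a path becomes $1+(\sum q)\varepsilon$, and
the ordinary sum over all paths has as coefficients the number of tuples of finite weight and the
sum of their weights. The answer is finite exactly if this number equals the number of all runs of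
$A$. To stay within the natural numbers, all weights are brought to a common denominator $D$, and
the nonnegative and the negative ones are treated in two separate computations (`sum_untrop_eq`,
`SumInstance.sum_eq`).

The sum over the paths is a truncated matrix series over the configurations (position, state of $A$,
state of $W$). Functionality and the absence of $\varepsilon$-cycles bound the length of the runs of
$A$, so the truncation loses nothing (`mem_runsOn`, `dynSum_eq`). The $\varepsilon$-transitions of
$W$ are eliminated beforehand by solving $x=b+T_\varepsilon x$ with a nilpotent $T_\varepsilon$
(`epsSolve_eq`). A submultiplicative norm shows that all coefficients have polynomially many digits
(`dualNorm_horner_le`).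

To obtain an actual Turing machine, structured programs on four stacks are compiled to machines
(`Cmd.Exec.steps`). The class `PolyTime` of functions on tree-encoded data that such programs
compute is closed under composition, pairing, case distinction, suitably bounded folds and
iterations, and binary arithmetic. The dynamic program is then written with these operations only.
-/

namespace StackProgram

open Computability (Γ')
open Turing

/-! ### Structured stack programs and their compilation to Turing machines -/

/-- The stacks of the machines used below. -/
inductive Stk
  | main
  | save
  | aux
  | cnt
  deriving DecidableEq

instance : Fintype Stk := ⟨{.main, .save, .aux, .cnt}, by rintro ⟨⟩ <;> decide⟩

/-- The contents of the four stacks. -/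
abbrev Store : Type := Stk → List Γ'

/-- Structured programs on four stacks. A `loop` pops a symbol from the stack `k`, runs the body
for this symbol, and repeats if `again` says so. -/
inductive Cmd
  | skip
  | push (k : Stk) (a : Γ')
  | seq (c d : Cmd)
  | loop (k : Stk) (again : Option Γ' → Bool) (body : Option Γ' → Cmd)

namespace Cmd

/-- `Exec c s t s'`: the command `c` transforms the store `s` into `s'` in time at most `t`. -/
inductive Exec : Cmd → Store → ℕ → Store → Prop
  | skip {s t} (h : 1 ≤ t) : Exec skip s t s
  | push {k a s t} (h : 1 ≤ t) : Exec (push k a) s t (Function.update s k (a :: s k))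
  | seq {c d s t₁ s' t₂ s'' t} (h₁ : Exec c s t₁ s') (h₂ : Exec d s' t₂ s'')
      (h : t₁ + t₂ ≤ t) : Exec (seq c d) s t s''
  | last {k again body s t₁ s' t} (ha : again (s k).head? = false)
      (h₁ : Exec (body (s k).head?) (Function.update s k (s k).tail) t₁ s') (h : t₁ + 1 ≤ t) :
      Exec (loop k again body) s t s'
  | again {k again body s t₁ s' t₂ s'' t} (ha : again (s k).head? = true)
      (h₁ : Exec (body (s k).head?) (Function.update s k (s k).tail) t₁ s')
      (h₂ : Exec (loop k again body) s' t₂ s'') (h : t₁ + t₂ + 1 ≤ t) :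
      Exec (loop k again body) s t s''

theorem Exec.mono {c : Cmd} {s s' : Store} {t t' : ℕ} (h : Exec c s t s') (ht : t ≤ t') :
    Exec c s t' s' := by
  cases h with
  | skip h => exact .skip (h.trans ht)
  | push h => exact .push (h.trans ht)
  | seq h₁ h₂ h => exact .seq h₁ h₂ (h.trans ht)
  | last ha h₁ h => exact .last ha h₁ (h.trans ht)
  | again ha h₁ h₂ h => exact .again ha h₁ h₂ (h.trans ht)

/-- The number of symbols in a store. -/
def storeSize (s : Store) : ℕ :=
  (s .main).length + (s .save).length + (s .aux).length + (s .cnt).length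

theorem storeSize_push (s : Store) (k : Stk) (a : Γ') :
    storeSize (Function.update s k (a :: s k)) = storeSize s + 1 := by
  cases k <;> simp [storeSize] <;> omega

theorem storeSize_pop (s : Store) (k : Stk) :
    storeSize (Function.update s k (s k).tail) ≤ storeSize s := by
  cases k <;> simp [storeSize]

/-- Only `push` enlarges the store, by one symbol per unit of time. This bounds the size of an
output by the running time, which makes polynomial time stable under composition. -/
theorem Exec.storeSize_le {c : Cmd} {s s' : Store} {t : ℕ} (h : Exec c s t s') :
    storeSize s' ≤ storeSize s + t := by
  induction h with
  | skip h => omega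
  | push h => rw [storeSize_push]; omega
  | seq _ _ h h₁ h₂ => omega
  | @last k _ _ s _ _ _ _ _ h h₁ => have := storeSize_pop s k; omega
  | @again k _ _ s _ _ _ _ _ _ _ _ h h₁ h₂ => have := storeSize_pop s k; omega

/-- The labels of the machine for a command. -/
def Label : Cmd → Type
  | skip => Unit
  | push _ _ => Unit
  | seq c d => c.Label ⊕ d.Label
  | loop _ _ body => Option (Σ o, (body o).Label)

instance finite_label : ∀ c : Cmd, Finite c.Label
  | skip => inferInstanceAs (Finite Unit)
  | push _ _ => inferInstanceAs (Finite Unit)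
  | seq c d =>
    have := finite_label c
    have := finite_label d
    inferInstanceAs (Finite (c.Label ⊕ d.Label))
  | loop _ _ body =>
    have := fun o => finite_label (body o)
    inferInstanceAs (Finite (Option (Σ o, (body o).Label)))

/-- The label at which the machine for a command starts. -/
def entry : ∀ c : Cmd, c.Label
  | skip => ()
  | push _ _ => ()
  | seq c _ => Sum.inl c.entry
  | loop _ _ _ => none

/-- The statements of the machine for a command, which goes to `exit` when it is done. -/
def prog {Λ : Type} : ∀ c : Cmd, (c.Label → Λ) → Λ → c.Label →
    TM2.Stmt (fun _ : Stk => Γ') Λ (Option Γ')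
  | skip, _, exit, _ => .goto fun _ => exit
  | push k a, _, exit, _ => .push k (fun _ => a) (.goto fun _ => exit)
  | seq c d, emb, _, .inl l => c.prog (emb ∘ .inl) (emb (.inr d.entry)) l
  | seq _ d, emb, exit, .inr l => d.prog (emb ∘ .inr) exit l
  | loop k _ body, emb, _, none =>
    -- From here on the popped symbol is remembered by the label: there is one copy of the body for
    -- each symbol, and its exit already encodes the decision whether to repeat.
    .pop k (fun _ o => o) (.goto fun o => emb (some ⟨o, (body o).entry⟩))
  | loop _ again body, emb, exit, some ⟨o, l⟩ =>
    (body o).prog (fun l => emb (some ⟨o, l⟩)) (bif again o then emb none else exit) l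

/-- `n` steps of the machine `M` lead from one configuration to another. -/
def Steps {Λ : Type} (M : Λ → TM2.Stmt (fun _ : Stk => Γ') Λ (Option Γ')) (n : ℕ)
    (a b : TM2.Cfg (fun _ : Stk => Γ') Λ (Option Γ')) : Prop :=
  (flip bind (TM2.step M))^[n] (some a) = some b

theorem Steps.trans {Λ : Type} {M : Λ → TM2.Stmt (fun _ : Stk => Γ') Λ (Option Γ')} {m n : ℕ}
    {a b c : TM2.Cfg (fun _ : Stk => Γ') Λ (Option Γ')} (h₁ : Steps M m a b)
    (h₂ : Steps M n b c) : Steps M (m + n) a c := by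
  unfold Steps at *
  rw [add_comm, Function.iterate_add_apply, h₁, h₂]

/-- The machine is only required to contain a copy of the program of `c`, embedded by `emb`, so the
hypothesis passes to the parts of `c`. The register may start with any value, since a loop
overwrites it before using it. -/
theorem Exec.steps {Λ : Type} {M : Λ → TM2.Stmt (fun _ : Stk => Γ') Λ (Option Γ')} {c : Cmd}
    {s s' : Store} {t : ℕ} (h : Exec c s t s') :
    ∀ (emb : c.Label → Λ) (exit : Λ), (∀ l, M (emb l) = c.prog emb exit l) → ∀ v,
      ∃ n ≤ t, ∃ v', Steps M n ⟨some (emb c.entry), v, s⟩ ⟨some exit, v', s'⟩ := by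
  induction h with
  | skip h =>
    intro emb exit hM v
    refine ⟨1, h, v, ?_⟩
    simp [Steps, flip, TM2.step, hM, prog]
  | push h =>
    intro emb exit hM v
    refine ⟨1, h, v, ?_⟩
    simp [Steps, flip, TM2.step, hM, prog]
  | @seq c d _ _ _ _ _ _ _ _ h h₁ h₂ =>
    intro emb exit hM v
    obtain ⟨n₁, hn₁, v₁, H₁⟩ := h₁ (emb ∘ .inl) (emb (.inr d.entry)) (fun l => hM (.inl l)) v
    obtain ⟨n₂, hn₂, v₂, H₂⟩ := h₂ (emb ∘ .inr) exit (fun l => hM (.inr l)) v₁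
    exact ⟨n₁ + n₂, by omega, v₂, H₁.trans H₂⟩
  | @last k again body s t₁ s' t ha _ h h₁ =>
    intro emb exit hM v
    obtain ⟨n₁, hn₁, v₁, H₁⟩ := h₁ (fun l => emb (some ⟨_, l⟩)) exit
      (fun l => (hM (some ⟨_, l⟩)).trans (by simp only [prog, ha, cond_false])) (s k).head?
    refine ⟨1 + n₁, by omega, v₁, Steps.trans ?_ H₁⟩
    have hM' : M (emb none) = _ := hM none
    simp [Steps, flip, TM2.step, hM', prog, entry]
  | @again k again body s t₁ s' t₂ s'' t ha _ _ h h₁ h₂ =>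
    intro emb exit hM v
    obtain ⟨n₁, hn₁, v₁, H₁⟩ := h₁ (fun l => emb (some ⟨_, l⟩)) (emb none)
      (fun l => (hM (some ⟨_, l⟩)).trans (by simp only [prog, ha, cond_true])) (s k).head?
    obtain ⟨n₂, hn₂, v₂, H₂⟩ := h₂ emb exit hM v₁
    refine ⟨1 + n₁ + n₂, by omega, v₂, (Steps.trans ?_ H₁).trans H₂⟩
    have hM' : M (emb none) = _ := hM none
    simp [Steps, flip, TM2.step, hM', prog, entry]

/-- The store with the given stack contents. -/
def store (m s a c : List Γ') : Store
  | .main => m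
  | .save => s
  | .aux => a
  | .cnt => c

/-- The machine for a command; input and output are on the main stack. -/
noncomputable def machine (c : Cmd) : FinTM2 where
  K := Stk
  k₀ := .main
  k₁ := .main
  Γ _ := Γ'
  Λ := Option c.Label
  main := some c.entry
  ΛFin := Fintype.ofFinite _
  σ := Option Γ'
  initialState := none
  Γk₀Fin := inferInstanceAs (Fintype Γ')
  m
    | none => .load (fun _ => none) .halt
    | some l => c.prog some none l

theorem nonempty_polyTime {α β : Type} {encIn : α → List Γ'} {encOut : β → List Γ'} {f : α → β}
    (c : Cmd) (p : Polynomial ℕ)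
    (h : ∀ a, Exec c (store (encIn a) [] [] []) (p.eval (encIn a).length)
      (store (encOut (f a)) [] [] [])) :
    Nonempty (TM2ComputableInPolyTime encIn encOut f) := by
  -- The additional step is the one at the label `none`, which resets the register to its initial
  -- value, as the final configuration requires, and halts.
  refine ⟨⟨⟨c.machine, Equiv.refl _, Equiv.refl _⟩, p + 1, fun a => ?_⟩⟩
  have key : ∃ n ≤ p.eval (encIn a).length, ∃ v', Steps c.machine.m n
      ⟨some (some c.entry), none, store (encIn a) [] [] []⟩
      ⟨some none, v', store (encOut (f a)) [] [] []⟩ :=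
    (h a).steps (M := c.machine.m) some none (fun l => rfl) none
  have hi : initList c.machine (List.map (Equiv.refl Γ').invFun (encIn a)) =
      ⟨some (some c.entry), none, store (encIn a) [] [] []⟩ := by
    unfold initList
    congr 1
    funext k
    cases k <;> simp [machine, store] <;> rfl
  have ho : haltList c.machine (List.map (Equiv.refl Γ').invFun (encOut (f a))) =
      ⟨none, none, store (encOut (f a)) [] [] []⟩ := by
    unfold haltList
    congr 1
    funext k
    cases k <;> simp [machine, store] <;> rfl
  have hs : ∃ n ≤ (p + 1).eval (encIn a).length, Steps c.machine.m n
      ⟨some (some c.entry), none, store (encIn a) [] [] []⟩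
      ⟨none, none, store (encOut (f a)) [] [] []⟩ := by
    obtain ⟨n, hn, v', H⟩ := key
    refine ⟨n + 1, by simpa using hn, H.trans ?_⟩
    simp [Steps, flip, TM2.step, machine]
  refine ⟨⟨hs.choose, ?_⟩, hs.choose_spec.1⟩
  have := hs.choose_spec.2
  exact (congrArg _ (congrArg some hi)).trans
    (Eq.trans this (congrArg some ho).symm)

section Store

variable (m s a c x : List Γ')

@[simp] theorem store_main : store m s a c .main = m := rfl
@[simp] theorem store_save : store m s a c .save = s := rfl
@[simp] theorem store_aux : store m s a c .aux = a := rfl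
@[simp] theorem store_cnt : store m s a c .cnt = c := rfl

@[simp] theorem update_store_main : Function.update (store m s a c) .main x = store x s a c := by
  funext k; cases k <;> rfl

@[simp] theorem update_store_save : Function.update (store m s a c) .save x = store m x a c := by
  funext k; cases k <;> rfl

@[simp] theorem update_store_aux : Function.update (store m s a c) .aux x = store m s x c := by
  funext k; cases k <;> rfl

@[simp] theorem update_store_cnt : Function.update (store m s a c) .cnt x = store m s a x := by
  funext k; cases k <;> rfl

end Store

section Basic

variable {m s a c : List Γ'} {x : Γ'} {t t₁ t₂ : ℕ} {st st' st'' : Store}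

theorem Exec.comp {c d : Cmd} (h₁ : Exec c st t₁ st') (h₂ : Exec d st' t₂ st'') :
    Exec (Cmd.seq c d) st (t₁ + t₂) st'' := .seq h₁ h₂ le_rfl

theorem exec_skip : Exec skip st 1 st := .skip le_rfl

theorem exec_push_main : Exec (push .main x) (store m s a c) 1 (store (x :: m) s a c) := by
  have := Exec.push (k := .main) (a := x) (s := store m s a c) le_rfl
  simpa using this

theorem exec_push_save : Exec (push .save x) (store m s a c) 1 (store m (x :: s) a c) := by
  have := Exec.push (k := .save) (a := x) (s := store m s a c) le_rfl
  simpa using this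

theorem exec_push_aux : Exec (push .aux x) (store m s a c) 1 (store m s (x :: a) c) := by
  have := Exec.push (k := .aux) (a := x) (s := store m s a c) le_rfl
  simpa using this

theorem exec_push_cnt : Exec (push .cnt x) (store m s a c) 1 (store m s a (x :: c)) := by
  have := Exec.push (k := .cnt) (a := x) (s := store m s a c) le_rfl
  simpa using this

/-- Pop a symbol and branch on it. -/
def pop (k : Stk) (body : Option Γ' → Cmd) : Cmd := loop k (fun _ => false) body

theorem exec_pop_main {body : Option Γ' → Cmd} (h : Exec (body (some x)) (store m s a c) t st) :
    Exec (pop .main body) (store (x :: m) s a c) (t + 1) st :=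
  .last rfl (by simpa using h) le_rfl

theorem exec_pop_aux {body : Option Γ' → Cmd} (h : Exec (body (some x)) (store m s a c) t st) :
    Exec (pop .aux body) (store m s (x :: a) c) (t + 1) st :=
  .last rfl (by simpa using h) le_rfl

theorem exec_main_again {ag : Option Γ' → Bool} {body : Option Γ' → Cmd} (hx : ag (some x) = true)
    (h : Exec (body (some x)) (store m s a c) t₁ st) (h' : Exec (loop .main ag body) st t₂ st') :
    Exec (loop .main ag body) (store (x :: m) s a c) (t₁ + t₂ + 1) st' :=
  .again hx (by simpa using h) h' le_rfl

theorem exec_main_stop {ag : Option Γ' → Bool} {body : Option Γ' → Cmd} (hx : ag (some x) = false)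
    (h : Exec (body (some x)) (store m s a c) t₁ st) :
    Exec (loop .main ag body) (store (x :: m) s a c) (t₁ + 1) st :=
  .last hx (by simpa using h) le_rfl

theorem exec_aux_again {ag : Option Γ' → Bool} {body : Option Γ' → Cmd} (hx : ag (some x) = true)
    (h : Exec (body (some x)) (store m s a c) t₁ st) (h' : Exec (loop .aux ag body) st t₂ st') :
    Exec (loop .aux ag body) (store m s (x :: a) c) (t₁ + t₂ + 1) st' :=
  .again hx (by simpa using h) h' le_rfl

theorem exec_aux_stop_nil {ag : Option Γ' → Bool} {body : Option Γ' → Cmd} (hx : ag none = false)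
    (h : Exec (body none) (store m s [] c) t₁ st) :
    Exec (loop .aux ag body) (store m s [] c) (t₁ + 1) st :=
  .last hx (by simpa using h) le_rfl

theorem exec_cnt_again {ag : Option Γ' → Bool} {body : Option Γ' → Cmd} (hx : ag (some x) = true)
    (h : Exec (body (some x)) (store m s a c) t₁ st) (h' : Exec (loop .cnt ag body) st t₂ st') :
    Exec (loop .cnt ag body) (store m s a (x :: c)) (t₁ + t₂ + 1) st' :=
  .again hx (by simpa using h) h' le_rfl

theorem exec_cnt_stop_nil {ag : Option Γ' → Bool} {body : Option Γ' → Cmd} (hx : ag none = false)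
    (h : Exec (body none) (store m s a []) t₁ st) :
    Exec (loop .cnt ag body) (store m s a []) (t₁ + 1) st :=
  .last hx (by simpa using h) le_rfl

end Basic

/-- Push a symbol on several stacks. -/
def pushAll (x : Γ') : List Stk → Cmd
  | [] => skip
  | k :: ks => seq (push k x) (pushAll x ks)

theorem exec_pushAll (x : Γ') : ∀ (ks : List Stk) (_ : ks.Nodup) (s : Store),
    Exec (pushAll x ks) s (ks.length + 1) (fun j => if j ∈ ks then x :: s j else s j)
  | [], _, s => by simpa [pushAll] using exec_skip
  | k :: ks, h, s => by
    have h' := List.nodup_cons.1 h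
    have e := exec_pushAll x ks h'.2 (Function.update s k (x :: s k))
    refine .seq (.push le_rfl) ?_ (by simp [add_comm, add_left_comm] : 1 + (ks.length + 1) ≤ _)
    convert e using 2 with j
    by_cases hj : j = k
    · subst hj; simp [h'.1]
    · simp [hj]

/-- Empty a stack up to the symbol `bra`, which is removed as well, and push the symbols on the
stacks `ks`. -/
def drain (k : Stk) (ks : List Stk) : Cmd :=
  loop k (fun o => o.isSome && o != some .bra) fun o =>
    match o with
    | some .bra => skip
    | some x => pushAll x ks
    | none => skip

/-- The symbol `bra` does not occur in serialized values, so it can separate a value from whatever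
lies below it on the same stack. Moving a word reverses it. -/
theorem exec_drain {k : Stk} {ks : List Stk} (hks : (k :: ks).Nodup) {e : List Γ'}
    (he : e = [] ∨ ∃ r, e = .bra :: r) : ∀ (w : List Γ') (_ : Γ'.bra ∉ w) (s s' : Store)
      (_ : s k = w ++ e)
      (_ : ∀ j, s' j = if j = k then e.tail else if j ∈ ks then w.reverse ++ s j else s j),
      Exec (drain k ks) s ((ks.length + 2) * w.length + 2) s'
  | [], _, s, s', hs, hs' => by
    have h0 : s' = Function.update s k (s k).tail := by
      funext j
      rw [hs', hs]
      by_cases hj : j = k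
      · subst hj; simp
      · simp [hj]
    rcases he with rfl | ⟨r, rfl⟩
    · refine .last (t₁ := 1) (by simp [hs]) ?_ (by simp)
      simp only [hs, h0]
      exact exec_skip
    · refine .last (t₁ := 1) (by simp [hs]) ?_ (by simp)
      simp only [hs, h0]
      exact exec_skip
  | x :: w, hw, s, s', hs, hs' => by
    have hk := List.nodup_cons.1 hks
    have hx : x ≠ .bra := fun h => hw (h ▸ List.mem_cons_self)
    have hw' : Γ'.bra ∉ w := fun h => hw (List.mem_cons_of_mem _ h)
    have e1 := exec_pushAll x ks hk.2 (Function.update s k (s k).tail)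
    have hb : (match (some x : Option Γ') with
      | some .bra => skip
      | some x => pushAll x ks
      | none => skip) = pushAll x ks := by cases x <;> simp_all
    refine .again (t₁ := ks.length + 1) (t₂ := (ks.length + 2) * w.length + 2)
      (s' := fun j => if j ∈ ks then x :: Function.update s k (s k).tail j
        else Function.update s k (s k).tail j)
      (by simp [hs, hx]) ?_ (exec_drain hks he w hw' _ _ ?_ ?_) ?_
    · have : (s k).head? = some x := by simp [hs]
      rw [this]
      exact hb ▸ e1
    · simp [hk.1, hs]
    · intro j
      rw [hs']
      by_cases hj : j = k
      · subst hj; simp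
      · by_cases hj' : j ∈ ks <;> simp [hj, hj']
    · simp only [List.length_cons]; ring_nf; omega

end Cmd

/-! ### Binary trees as data, and programs for the basic tree operations -/

/-- Binary trees, the values on which the programs below operate. -/
inductive Tree
  | nil
  | node (l r : Tree)

namespace Tree

/-- The serialization of a tree. -/
def ser : Tree → List Γ'
  | nil => [.bit false]
  | node l r => .bit true :: (l.ser ++ r.ser)

/-- The left subtree. -/
def left : Tree → Tree
  | nil => nil
  | node l _ => l

/-- The right subtree. -/
def right : Tree → Tree
  | nil => nil
  | node _ r => r

theorem bra_notMem_ser (x : Tree) : Γ'.bra ∉ x.ser := by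
  induction x with
  | nil => simp [ser]
  | node l r hl hr => simp [ser, hl, hr]

theorem ser_length_pos (x : Tree) : 0 < x.ser.length := by cases x <;> simp [ser]

end Tree

namespace Cmd

open StackProgram.Tree

variable {m s a c : List Γ'}

theorem exec_main_to_aux {w : List Γ'} (hw : Γ'.bra ∉ w) :
    Exec (drain .main [.aux]) (store w s a c) (3 * w.length + 2)
      (store [] s (w.reverse ++ a) c) := by
  have := exec_drain (k := .main) (ks := [.aux]) (by decide) (.inl rfl) w hw (store w s a c)
    (store [] s (w.reverse ++ a) c) (by simp) (by rintro ⟨⟩ <;> simp)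
  simpa using this

theorem exec_aux_to_main {w : List Γ'} (hw : Γ'.bra ∉ w) :
    Exec (drain .aux [.main]) (store m s w c) (3 * w.length + 2)
      (store (w.reverse ++ m) s [] c) := by
  have := exec_drain (k := .aux) (ks := [.main]) (by decide) (.inl rfl) w hw (store m s w c)
    (store (w.reverse ++ m) s [] c) (by simp) (by rintro ⟨⟩ <;> simp)
  simpa using this

theorem exec_aux_to_save {w : List Γ'} (hw : Γ'.bra ∉ w) :
    Exec (drain .aux [.save]) (store m s w c) (3 * w.length + 2)
      (store m (w.reverse ++ s) [] c) := by
  have := exec_drain (k := .aux) (ks := [.save]) (by decide) (.inl rfl) w hw (store m s w c)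
    (store m (w.reverse ++ s) [] c) (by simp) (by rintro ⟨⟩ <;> simp)
  simpa using this

theorem exec_aux_to_main_save {w : List Γ'} (hw : Γ'.bra ∉ w) :
    Exec (drain .aux [.main, .save]) (store m s w c) (4 * w.length + 2)
      (store (w.reverse ++ m) (w.reverse ++ s) [] c) := by
  have := exec_drain (k := .aux) (ks := [.main, .save]) (by decide) (.inl rfl) w hw (store m s w c)
    (store (w.reverse ++ m) (w.reverse ++ s) [] c) (by simp) (by rintro ⟨⟩ <;> simp)
  simpa using this

theorem exec_cnt_to_main {w : List Γ'} (hw : Γ'.bra ∉ w) :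
    Exec (drain .cnt [.main]) (store m s a w) (3 * w.length + 2)
      (store (w.reverse ++ m) s a []) := by
  have := exec_drain (k := .cnt) (ks := [.main]) (by decide) (.inl rfl) w hw (store m s a w)
    (store (w.reverse ++ m) s a []) (by simp) (by rintro ⟨⟩ <;> simp)
  simpa using this

theorem exec_save_to_cnt {w : List Γ'} (hw : Γ'.bra ∉ w) :
    Exec (drain .save [.cnt]) (store m (w ++ .bra :: s) a c) (3 * w.length + 2)
      (store m s a (w.reverse ++ c)) := by
  have := exec_drain (k := .save) (ks := [.cnt]) (by decide) (.inr ⟨s, rfl⟩) w hw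
    (store m (w ++ .bra :: s) a c)
    (store m s a (w.reverse ++ c)) (by simp) (by rintro ⟨⟩ <;> simp)
  simpa using this

theorem exec_save_to_aux {w : List Γ'} (hw : Γ'.bra ∉ w) :
    Exec (drain .save [.aux]) (store m (w ++ .bra :: s) a c) (3 * w.length + 2)
      (store m s (w.reverse ++ a) c) := by
  have := exec_drain (k := .save) (ks := [.aux]) (by decide) (.inr ⟨s, rfl⟩) w hw
    (store m (w ++ .bra :: s) a c)
    (store m s (w.reverse ++ a) c) (by simp) (by rintro ⟨⟩ <;> simp)
  simpa using this

theorem exec_clear_main {w : List Γ'} (hw : Γ'.bra ∉ w) :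
    Exec (drain .main []) (store w s a c) (2 * w.length + 2) (store [] s a c) := by
  have := exec_drain (k := .main) (ks := []) (by decide) (.inl rfl) w hw (store w s a c)
    (store [] s a c) (by simp) (by rintro ⟨⟩ <;> simp)
  simpa using this

/-- Remove as many trees from the main stack as there are symbols on the counter; move them to the
auxiliary stack if `keep` is set. -/
def scan (keep : Bool) : Cmd :=
  loop .cnt Option.isSome fun o =>
    match o with
    | none => skip
    | some _ => pop .main fun o =>
      match o with
      | some (.bit true) => seq (bif keep then push .aux (.bit true) else skip)
          (seq (push .cnt .comma) (push .cnt .comma))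
      | some x => bif keep then push .aux x else skip
      | none => skip

/-- The counter holds the number of trees still to be read: an inner node replaces one pending tree
by two, a leaf completes one. The formulation with an arbitrary continuation lets the induction on
the tree treat the left and the right subtree one after the other. -/
theorem exec_scan (keep : Bool) (x : Tree) : ∀ (m s a c : List Γ') (t : ℕ) (st : Store),
    Exec (scan keep) (store m s (bif keep then x.ser.reverse ++ a else a) c) t st →
    Exec (scan keep) (store (x.ser ++ m) s a (.comma :: c)) (t + 8 * x.ser.length) st := by
  have hk : ∀ m s a c y, Exec (bif keep then push .aux y else skip) (store m s a c) 1
      (store m s (bif keep then y :: a else a) c) := by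
    intro m s a c y
    cases keep
    · exact exec_skip
    · exact exec_push_aux
  induction x with
  | nil =>
    intro m s a c t st h
    have h1 := hk m s a c (.bit false)
    have h2 : Exec (scan keep) (store (.bit false :: m) s a (.comma :: c)) (1 + 1 + t + 1) st :=
      exec_cnt_again rfl (exec_pop_main h1) (by cases keep <;> exact h)
    exact h2.mono (by simp [ser]; omega)
  | node l r hl hr =>
    intro m s a c t st h
    have h1 := hk (l.ser ++ (r.ser ++ m)) s a c (.bit true)
    have h2 := hl (r.ser ++ m) s (bif keep then .bit true :: a else a) (.comma :: c) _ st
      (hr m s _ c t st (by cases keep <;> simpa [ser] using h))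
    have h3 : Exec (scan keep) (store (.bit true :: (l.ser ++ (r.ser ++ m))) s a (.comma :: c)) _
      st := exec_cnt_again rfl (exec_pop_main (h1.comp (exec_push_cnt.comp exec_push_cnt))) h2
    simp only [ser, List.cons_append, List.append_assoc]
    exact h3.mono (by simp; omega)

theorem exec_scan_nil (keep : Bool) : Exec (scan keep) (store m s a []) 2 (store m s a []) :=
  exec_cnt_stop_nil rfl exec_skip

/-- Replace a tree by its left subtree. -/
def leftCmd : Cmd :=
  pop .main fun o =>
    match o with
    | some (.bit true) => seq (push .cnt .comma) (seq (scan true)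
        (seq (drain .main []) (drain .aux [.main])))
    | some x => push .main x
    | none => skip

theorem exec_leftCmd (x : Tree) :
    Exec leftCmd (store x.ser s [] []) (11 * x.ser.length + 8) (store x.left.ser s [] []) := by
  cases x with
  | nil => exact (exec_pop_main exec_push_main).mono (by simp)
  | node l r =>
    have h1 := exec_scan true l r.ser s [] [] 2 (store r.ser s l.ser.reverse [])
      (by simpa using exec_scan_nil true)
    have h2 := exec_clear_main (s := s) (a := l.ser.reverse) (c := []) r.bra_notMem_ser
    have h3 := exec_aux_to_main (m := []) (s := s) (c := []) (w := l.ser.reverse)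
      (by simpa using l.bra_notMem_ser)
    simp only [List.append_nil, List.reverse_reverse, List.length_reverse] at h3
    have h4 : Exec leftCmd (store (.bit true :: (l.ser ++ r.ser)) s [] []) _ _ :=
      exec_pop_main (exec_push_cnt.comp (h1.comp (h2.comp h3)))
    exact h4.mono (by simp [ser]; omega)

/-- Replace a tree by its right subtree. -/
def rightCmd : Cmd :=
  pop .main fun o =>
    match o with
    | some (.bit true) => seq (push .cnt .comma) (scan false)
    | some x => push .main x
    | none => skip

theorem exec_rightCmd (x : Tree) :
    Exec rightCmd (store x.ser s [] []) (11 * x.ser.length + 8) (store x.right.ser s [] []) := by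
  cases x with
  | nil => exact (exec_pop_main exec_push_main).mono (by simp)
  | node l r =>
    have h1 := exec_scan false l r.ser s [] [] 2 (store r.ser s [] [])
      (by simpa using exec_scan_nil false)
    have h4 : Exec rightCmd (store (.bit true :: (l.ser ++ r.ser)) s [] []) _ _ :=
      exec_pop_main (exec_push_cnt.comp h1)
    exact h4.mono (by simp [ser]; omega)

/-- Replace a tree `x` by `node (f x) (g x)`, given commands for `f` and `g`. -/
def pairCmd (f g : Cmd) : Cmd :=
  seq (drain .main [.aux]) <| seq (push .save .bra) <| seq (drain .aux [.main, .save]) <|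
  seq f <| seq (drain .main [.aux]) <| seq (drain .save [.cnt]) <| seq (push .save .bra) <|
  seq (drain .aux [.save]) <| seq (drain .cnt [.main]) <| seq g <|
  seq (drain .save [.aux]) <| seq (drain .aux [.main]) (push .main (.bit true))

/-- While `f` runs, a copy of the argument waits on `save` above the marker `bra`; then the result
of `f` takes its place there while `g` runs on the copy. This is why commands must work above
arbitrary contents `s` of `save`. -/
theorem exec_pairCmd {f g : Cmd} {x y z : Tree} {t₁ t₂ : ℕ}
    (hf : ∀ s, Exec f (store x.ser s [] []) t₁ (store y.ser s [] []))
    (hg : ∀ s, Exec g (store x.ser s [] []) t₂ (store z.ser s [] [])) :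
    Exec (pairCmd f g) (store x.ser s [] [])
      (t₁ + t₂ + 13 * x.ser.length + 12 * y.ser.length + 19)
      (store (node y z).ser s [] []) := by
  have hx := x.bra_notMem_ser
  have hy := y.bra_notMem_ser
  have hx' : Γ'.bra ∉ x.ser.reverse := by simpa using hx
  have hy' : Γ'.bra ∉ y.ser.reverse := by simpa using hy
  have h1 := exec_main_to_aux (s := s) (a := []) (c := []) hx
  have h2 := exec_aux_to_main_save (m := []) (s := .bra :: s) (c := []) hx'
  have h3 := hf (x.ser ++ .bra :: s)
  have h4 := exec_main_to_aux (s := x.ser ++ .bra :: s) (a := []) (c := []) hy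
  have h5 := exec_save_to_cnt (m := []) (s := s) (a := y.ser.reverse) (c := []) hx
  have h6 := exec_aux_to_save (m := []) (s := .bra :: s) (c := x.ser.reverse) hy'
  have h7 := exec_cnt_to_main (m := []) (s := y.ser ++ .bra :: s) (a := []) hx'
  have h8 := hg (y.ser ++ .bra :: s)
  have h9 := exec_save_to_aux (m := z.ser) (s := s) (a := []) (c := []) hy
  have h10 := exec_aux_to_main (m := z.ser) (s := s) (c := []) hy'
  simp only [List.append_nil, List.reverse_reverse, List.length_reverse] at h1 h2 h4 h5 h6 h7 h9 h10
  have H : Exec (pairCmd f g) (store x.ser s [] []) _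
      (store (.bit true :: (y.ser ++ z.ser)) s [] []) :=
    h1.comp <| exec_push_save.comp <| h2.comp <| h3.comp <| h4.comp <| h5.comp <|
    exec_push_save.comp <| h6.comp <| h7.comp <| h8.comp <| h9.comp <| h10.comp exec_push_main
  exact H.mono (by omega)

/-- On a tree `node y x`, run `f` on `x` if `y` is `nil`, and `g` on `x` otherwise. -/
def caseCmd (f g : Cmd) : Cmd :=
  pop .main fun _ => pop .main fun o =>
    match o with
    | some (.bit true) => seq (push .cnt .comma) <| seq (push .cnt .comma) <| seq (scan false) g
    | _ => f

theorem exec_caseCmd_nil {f g : Cmd} {x : Tree} {t : ℕ} {st : Store}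
    (hf : Exec f (store x.ser s [] []) t st) :
    Exec (caseCmd f g) (store (node nil x).ser s [] []) (t + 2) st :=
  exec_pop_main (exec_pop_main hf)

/-- Once the two leading bits are popped, the two subtrees of the tested tree precede `x`; setting
the counter to two makes `scan` skip exactly these. -/
theorem exec_caseCmd_node {f g : Cmd} {y z x : Tree} {t : ℕ} {st : Store}
    (hg : Exec g (store x.ser s [] []) t st) :
    Exec (caseCmd f g) (store (node (node y z) x).ser s [] [])
      (t + 8 * (node y z).ser.length + 6) st := by
  have h1 := exec_scan false y (z.ser ++ x.ser) s [] [.comma] _ (store x.ser s [] [])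
    (exec_scan false z x.ser s [] [] 2 _ (exec_scan_nil false))
  have h2 := exec_push_cnt.comp (exec_push_cnt.comp (h1.comp hg))
  have h3 : Exec (caseCmd f g)
      (store (.bit true :: .bit true :: (y.ser ++ (z.ser ++ x.ser))) s [] []) _ st :=
    exec_pop_main (exec_pop_main h2)
  simp only [ser, List.cons_append, List.append_assoc]
  exact h3.mono (by simp; omega)

/-- Write a fixed tree on the main stack. -/
def pushList : List Γ' → Cmd
  | [] => skip
  | x :: l => seq (pushList l) (push .main x)

theorem exec_pushList : ∀ l : List Γ', Exec (pushList l) (store m s a c) (l.length + 1)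
    (store (l ++ m) s a c)
  | [] => exec_skip
  | x :: l => by
    have h := (exec_pushList l).comp (exec_push_main (x := x))
    exact h.mono (by simp)

/-- Replace any tree by a fixed one. -/
def constCmd (x : Tree) : Cmd := seq (drain .main []) (pushList x.ser)

theorem exec_constCmd (x y : Tree) : Exec (constCmd x) (store y.ser s [] [])
    (2 * y.ser.length + x.ser.length + 3) (store x.ser s [] []) := by
  have := (exec_clear_main (s := s) (a := []) (c := []) y.bra_notMem_ser).comp
    (exec_pushList x.ser)
  simp only [List.append_nil] at this
  have H : Exec (constCmd x) _ _ _ := this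
  exact H.mono (by omega)

/-- While the left subtree of the current tree is not `nil`, run `f` on the right subtree and
continue with the result; finally return the right subtree. -/
def whileCmd (f : Cmd) : Cmd :=
  pop .main fun _ => loop .main (fun o => o == some (.bit true)) fun o =>
    match o with
    | some (.bit true) => seq (pop .main fun _ => pop .main fun _ => f) (pop .main fun _ => skip)
    | _ => skip

/-- The tree for `true`. -/
abbrev tt : Tree := node nil nil

/-- The loop finds flag and value on the stack without the root bit of their pair. Reading the first
bit of `tt` leaves two leaves to drop before `f` runs, and dropping the root bit of the result
restores the invariant. The offset `k` permits induction on the number of remaining rounds. -/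
theorem exec_whileCmd {f : Cmd} {x : ℕ → Tree} {T : ℕ} : ∀ {n : ℕ} {k : ℕ},
    (∀ j < n, ∀ s, Exec f (store (x (k + j)).ser s [] []) T
      (store (node (if j + 1 < n then tt else nil) (x (k + j + 1))).ser s [] [])) →
    Exec (whileCmd f) (store (node (if 0 < n then tt else nil) (x k)).ser s [] [])
      ((T + 7) * n + 3) (store (x (k + n)).ser s [] []) := by
  have key : ∀ {n : ℕ} {k : ℕ},
    (∀ j < n, ∀ s, Exec f (store (x (k + j)).ser s [] []) T
      (store (node (if j + 1 < n then tt else nil) (x (k + j + 1))).ser s [] [])) →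
    Exec (loop .main (fun o => o == some (.bit true)) fun o =>
      match o with
      | some (.bit true) => seq (pop .main fun _ => pop .main fun _ => f) (pop .main fun _ => skip)
      | _ => skip) (store ((if 0 < n then tt else nil).ser ++ (x k).ser) s [] [])
      ((T + 7) * n + 2) (store (x (k + n)).ser s [] []) := by
    intro n
    induction n with
    | zero =>
      intro k _
      exact exec_main_stop (by decide) exec_skip
    | succ n ih =>
      intro k h
      have h0 := h 0 (by omega) s
      have h1 := ih (k := k + 1) fun j hj s => by
        have := h (j + 1) (by omega) s
        rw [show k + 1 + j = k + (j + 1) by omega]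
        simpa using this
      have h2 := exec_pop_main (x := .bit true) (body := fun _ => skip)
        (m := ((if 0 < n then tt else nil).ser ++ (x (k + 1)).ser)) (s := s) (a := []) (c := [])
        exec_skip
      have h3 : Exec (seq (pop .main fun _ => pop .main fun _ => f) (pop .main fun _ => skip))
          (store (.bit false :: .bit false :: (x k).ser) s [] []) _ _ :=
        (exec_pop_main (body := fun _ => pop .main fun _ => f) (exec_pop_main h0)).comp
          (by simpa [ser] using h2)
      have h4 := exec_main_again (x := .bit true) (ag := fun o => o == some (.bit true))
        (body := fun o =>
      match o with
      | some (.bit true) => seq (pop .main fun _ => pop .main fun _ => f) (pop .main fun _ => skip)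
      | _ => skip) (by decide) h3 h1
      rw [show k + (n + 1) = k + 1 + n by omega]
      exact h4.mono (by ring_nf; omega)
  intro n k h
  exact (exec_pop_main (key h)).mono (by omega)

end Cmd

/-! ### Polynomial-time functions on encoded types and their combinators -/

theorem eval_le_eval (p : Polynomial ℕ) {m n : ℕ} (h : m ≤ n) : p.eval m ≤ p.eval n := by
  rw [Polynomial.eval_eq_sum, Polynomial.eval_eq_sum, Polynomial.sum, Polynomial.sum]
  gcongr

/-- Types whose elements are written as trees. -/
class Enc (α : Type) where
  enc : α → Tree

/-- The length of the serialization. -/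
def size {α : Type} [Enc α] (a : α) : ℕ := (Enc.enc a).ser.length

instance {α : Type} [Enc α] (p : α → Prop) : Enc {a // p a} := ⟨fun a => Enc.enc a.1⟩

instance : Enc Bool := ⟨fun b => bif b then .node .nil .nil else .nil⟩

instance {α β : Type} [Enc α] [Enc β] : Enc (α × β) := ⟨fun x => .node (Enc.enc x.1) (Enc.enc x.2)⟩

/-- The encoding of a list. -/
def encList {α : Type} [Enc α] : List α → Tree
  | [] => .nil
  | a :: l => .node (Enc.enc a) (encList l)

instance {α : Type} [Enc α] : Enc (List α) := ⟨encList⟩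

section Size

variable {α β : Type} [Enc α] [Enc β]

theorem size_pos (a : α) : 0 < size a := Tree.ser_length_pos _

theorem size_pair (a : α) (b : β) : size (a, b) = size a + size b + 1 := by
  simp [size, Enc.enc, Tree.ser]

theorem size_nil : size ([] : List α) = 1 := rfl

theorem size_cons (a : α) (l : List α) : size (a :: l) = size a + size l + 1 := by
  simp [size, Enc.enc, Tree.ser, encList]

theorem size_append (l l' : List α) : size (l ++ l') + 1 = size l + size l' := by
  induction l with
  | nil => simp [size_nil]; omega
  | cons a l ih => simp only [List.cons_append, size_cons]; omega

theorem size_reverse (l : List α) : size l.reverse = size l := by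
  induction l with
  | nil => rfl
  | cons a l ih =>
    have := size_append l.reverse [a]
    simp only [List.reverse_cons, size_cons, size_nil] at *
    omega

theorem length_lt_size (l : List α) : l.length < size l := by
  induction l with
  | nil => simp [size_nil]
  | cons a l ih => simp only [List.length_cons, size_cons]; omega

theorem size_lt_of_mem {l : List α} {a : α} (h : a ∈ l) : size a < size l := by
  induction l with
  | nil => simp at h
  | cons b l ih =>
    rw [size_cons]
    rcases List.mem_cons.1 h with rfl | h
    · omega
    · have := ih h; omega

theorem size_le_of_forall_mem {l : List α} {m : ℕ} (h : ∀ a ∈ l, size a ≤ m) :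
    size l ≤ l.length * (m + 1) + 1 := by
  induction l with
  | nil => simp [size_nil]
  | cons a l ih =>
    rw [size_cons, List.length_cons]
    have := h a (by simp)
    have := ih fun b hb => h b (List.mem_cons_of_mem _ hb)
    rw [add_mul]
    omega

theorem size_bool_le (b : Bool) : size b ≤ 3 := by cases b <;> decide

end Size

/-- A function that a command computes in polynomial time. -/
@[fun_prop]
def PolyTime {α β : Type} [Enc α] [Enc β] (f : α → β) : Prop :=
  ∃ (c : Cmd) (p : Polynomial ℕ), ∀ a s, Cmd.Exec c (Cmd.store (Enc.enc a).ser s [] [])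
    (p.eval (size a)) (Cmd.store (Enc.enc (f a)).ser s [] [])

/-- A quantity that is bounded by a polynomial in the size. -/
def PolyBdd {α : Type} [Enc α] (n : α → ℕ) : Prop := ∃ p : Polynomial ℕ, ∀ a, n a ≤ p.eval (size a)

section PolyBdd

variable {α β γ : Type} [Enc α] [Enc β] [Enc γ] {m n : α → ℕ}

theorem PolyBdd.mono (h : PolyBdd n) (hm : ∀ a, m a ≤ n a) : PolyBdd m :=
  let ⟨p, hp⟩ := h
  ⟨p, fun a => (hm a).trans (hp a)⟩

theorem PolyBdd.add (hm : PolyBdd m) (hn : PolyBdd n) : PolyBdd fun a => m a + n a :=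
  let ⟨p, hp⟩ := hm
  let ⟨q, hq⟩ := hn
  ⟨p + q, fun a => by rw [Polynomial.eval_add]; exact add_le_add (hp a) (hq a)⟩

theorem PolyBdd.mul (hm : PolyBdd m) (hn : PolyBdd n) : PolyBdd fun a => m a * n a :=
  let ⟨p, hp⟩ := hm
  let ⟨q, hq⟩ := hn
  ⟨p * q, fun a => by rw [Polynomial.eval_mul]; exact Nat.mul_le_mul (hp a) (hq a)⟩

theorem PolyBdd.const (k : ℕ) : PolyBdd fun _ : α => k := ⟨.C k, fun a => by simp⟩

theorem polyBdd_size : PolyBdd (size : α → ℕ) := ⟨.X, fun a => by simp⟩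

theorem polyBdd_eval (p : Polynomial ℕ) : PolyBdd fun a : α => p.eval (size a) :=
  ⟨p, fun _ => le_rfl⟩

theorem PolyTime.size_le {f : α → β} (h : PolyTime f) : PolyBdd fun a => size (f a) := by
  obtain ⟨c, p, hp⟩ := h
  refine ⟨.X + p, fun a => ?_⟩
  have := (hp a []).storeSize_le
  simpa [Cmd.storeSize, size] using this

/-- Substitution into a polynomial bound. -/
theorem PolyBdd.comp {n : β → ℕ} (hn : PolyBdd n) {f : α → β} (hf : PolyBdd fun a => size (f a)) :
    PolyBdd fun a => n (f a) := by
  obtain ⟨p, hp⟩ := hn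
  obtain ⟨q, hq⟩ := hf
  refine ⟨p.comp q, fun a => ?_⟩
  rw [Polynomial.eval_comp]
  exact (hp _).trans (eval_le_eval p (hq a))

end PolyBdd

section Combinators

variable {α β γ σ : Type} [Enc α] [Enc β] [Enc γ] [Enc σ]

theorem PolyTime.of_polyBdd {f : α → β} (c : Cmd) (n : α → ℕ) (hn : PolyBdd n)
    (h : ∀ a s, Cmd.Exec c (Cmd.store (Enc.enc a).ser s [] []) (n a)
      (Cmd.store (Enc.enc (f a)).ser s [] [])) : PolyTime f :=
  let ⟨p, hp⟩ := hn
  ⟨c, p, fun a s => (h a s).mono (hp a)⟩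

/-- A command together with a time bound that depends on the argument. -/
theorem PolyTime.exists_cmd {f : α → β} (h : PolyTime f) : ∃ (c : Cmd) (n : α → ℕ), PolyBdd n ∧
    ∀ a s, Cmd.Exec c (Cmd.store (Enc.enc a).ser s [] []) (n a)
      (Cmd.store (Enc.enc (f a)).ser s [] []) :=
  let ⟨c, p, hp⟩ := h
  ⟨c, fun a => p.eval (size a), polyBdd_eval p, hp⟩

theorem PolyTime.of_enc_eq {f : α → β} (h : ∀ a, Enc.enc (f a) = Enc.enc a) : PolyTime f :=
  .of_polyBdd .skip (fun _ => 1) (.const 1) fun a s => by rw [h]; exact Cmd.exec_skip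

theorem PolyTime.congr {f g : α → β} (h : PolyTime f) (hfg : ∀ a, f a = g a) : PolyTime g :=
  funext hfg ▸ h

@[fun_prop]
theorem PolyTime.id' : PolyTime fun a : α => a := .of_enc_eq fun _ => rfl

@[fun_prop]
theorem PolyTime.const (b : β) : PolyTime fun _ : α => b :=
  .of_polyBdd (Cmd.constCmd (Enc.enc b)) (fun a => 2 * size a + size b + 3)
    ((((PolyBdd.const 2).mul polyBdd_size).add (.const _)).add (.const _))
    fun _ _ => Cmd.exec_constCmd _ _

@[fun_prop]
theorem PolyTime.comp {g : β → γ} {f : α → β} (hg : PolyTime g) (hf : PolyTime f) :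
    PolyTime fun a => g (f a) := by
  obtain ⟨d, n, hn, hd⟩ := hg.exists_cmd
  obtain ⟨c, m, hm, hc⟩ := hf.exists_cmd
  exact .of_polyBdd (.seq c d) (fun a => m a + n (f a)) (hm.add (hn.comp hf.size_le))
    fun a s => (hc a s).comp (hd _ s)

@[fun_prop]
theorem PolyTime.pair {f : α → β} {g : α → γ} (hf : PolyTime f) (hg : PolyTime g) :
    PolyTime fun a => (f a, g a) := by
  obtain ⟨c, m, hm, hc⟩ := hf.exists_cmd
  obtain ⟨d, n, hn, hd⟩ := hg.exists_cmd
  exact .of_polyBdd (Cmd.pairCmd c d) (fun a => m a + n a + 13 * size a + 12 * size (f a) + 19)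
    ((((hm.add hn).add ((PolyBdd.const _).mul polyBdd_size)).add
      ((PolyBdd.const _).mul hf.size_le)).add (.const _))
    fun a s => Cmd.exec_pairCmd (hc a) (hd a)

theorem PolyTime.of_enc_left {f : α → β} (h : ∀ a, Enc.enc (f a) = (Enc.enc a).left) :
    PolyTime f :=
  .of_polyBdd Cmd.leftCmd (fun a => 11 * size a + 8)
    (((PolyBdd.const _).mul polyBdd_size).add (.const _))
    fun a s => by rw [h]; exact Cmd.exec_leftCmd _

theorem PolyTime.of_enc_right {f : α → β} (h : ∀ a, Enc.enc (f a) = (Enc.enc a).right) :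
    PolyTime f :=
  .of_polyBdd Cmd.rightCmd (fun a => 11 * size a + 8)
    (((PolyBdd.const _).mul polyBdd_size).add (.const _))
    fun a s => by rw [h]; exact Cmd.exec_rightCmd _

theorem PolyTime.fst' : PolyTime (Prod.fst : α × β → α) := .of_enc_left fun _ => rfl

theorem PolyTime.snd' : PolyTime (Prod.snd : α × β → β) := .of_enc_right fun _ => rfl

@[fun_prop]
theorem PolyTime.fst {f : α → β × γ} (h : PolyTime f) : PolyTime fun a => (f a).1 := fst'.comp h

@[fun_prop]
theorem PolyTime.snd {f : α → β × γ} (h : PolyTime f) : PolyTime fun a => (f a).2 := snd'.comp h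

/-- Case distinction on whether the encoding of a value is the leaf. -/
theorem PolyTime.cond_of_enc {t : α → σ} {b : α → Bool} {f g : α → β} (ht : PolyTime t)
    (hb : ∀ a, b a = true ↔ Enc.enc (t a) ≠ .nil)
    (hf : PolyTime fun a : {a // b a = true} => f a) (hg : PolyTime g) :
    PolyTime fun a => bif b a then f a else g a := by
  -- The tested value is paired with the argument, which `caseCmd` hands to the chosen branch. A
  -- subtype is encoded like the ambient type, so `f` has to be computable only where the test
  -- succeeds.
  obtain ⟨c, m, hm, hc⟩ := (ht.pair PolyTime.id').exists_cmd
  obtain ⟨d, p, hd⟩ := hf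
  obtain ⟨e, k, hk, he⟩ := hg.exists_cmd
  refine .of_polyBdd (.seq c (.caseCmd e d))
    (fun a => m a + (p.eval (size a) + k a + 8 * size (t a) + 6))
    (hm.add ((((polyBdd_eval p).add hk).add
      ((PolyBdd.const _).mul ht.size_le)).add (.const _))) fun a s => ?_
  refine (hc a s).comp ?_
  have ha := hb a
  rcases h : Enc.enc (t a) with _ | ⟨y, z⟩
  · have hf : b a = false := by simpa [h] using ha
    rw [hf]
    have := Cmd.exec_caseCmd_nil (g := d) (he a s)
    simp only [Enc.enc] at h ⊢
    rw [h]
    exact this.mono (by omega)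
  · have hf : b a = true := by simpa [h] using ha
    have := Cmd.exec_caseCmd_node (f := e) (y := y) (z := z) (hd ⟨a, hf⟩ s)
    have hs : size (t a) = (y.node z).ser.length := by rw [size, h]
    rw [hf]
    simp only [Enc.enc] at h ⊢
    rw [h]
    exact this.mono (by rw [hs]; simp only [size, Enc.enc]; omega)

theorem PolyTime.subtype {p : α → Prop} {f : α → β} (hf : PolyTime f) :
    PolyTime fun a : {a // p a} => f a :=
  let ⟨c, p, hp⟩ := hf
  ⟨c, p, fun a s => hp a s⟩

@[fun_prop]
theorem PolyTime.cond {b : α → Bool} {f g : α → β} (hb : PolyTime b) (hf : PolyTime f)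
    (hg : PolyTime g) : PolyTime fun a => bif b a then f a else g a :=
  .cond_of_enc hb (fun a => by cases b a <;> simp [Enc.enc]) hf.subtype hg

@[fun_prop]
theorem PolyTime.ite {p : α → Prop} [DecidablePred p] {f g : α → β}
    (hp : PolyTime fun a => decide (p a)) (hf : PolyTime f) (hg : PolyTime g) :
    PolyTime fun a => if p a then f a else g a := by
  have := hp.cond hf hg
  simpa only [Bool.cond_decide] using this

/-- Iteration while a test succeeds, with polynomially many rounds on values of polynomial size. -/
theorem PolyTime.while {g : σ → σ} {b : σ → Bool} {i : α → σ} {n : α → ℕ} (hg : PolyTime g)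
    (hb : PolyTime b) (hi : PolyTime i) (h : ∀ a j, j ≤ n a → (b (g^[j] (i a)) = decide (j < n a)))
    (hn : PolyBdd n) {m : α → ℕ} (hm : PolyBdd m) (hs : ∀ a j, j ≤ n a → size (g^[j] (i a)) ≤ m a) :
    PolyTime fun a => g^[n a] (i a) := by
  have hbody : PolyTime fun x : σ => (b (g x), g x) := (hb.comp hg).pair hg
  have hinit : PolyTime fun a => (b (i a), i a) := (hb.comp hi).pair hi
  obtain ⟨c, p, hp⟩ := hbody
  obtain ⟨d, k, hk, hd⟩ := hinit.exists_cmd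
  obtain ⟨q, hq⟩ := hm
  have hT : PolyBdd fun a : α => p.eval (q.eval (size a)) :=
    ⟨p.comp q, fun a => by rw [Polynomial.eval_comp]⟩
  refine .of_polyBdd (.seq d (.whileCmd c))
    (fun a => k a + ((p.eval (q.eval (size a)) + 7) * n a + 3))
    (hk.add (((hT.add (.const _)).mul hn).add (.const _))) fun a s => ?_
  refine (hd a s).comp ?_
  have key := Cmd.exec_whileCmd (s := s) (f := c) (x := fun j => Enc.enc (g^[j] (i a)))
    (T := p.eval (q.eval (size a))) (n := n a) (k := 0) fun j hj s => by
      have := hp (g^[j] (i a)) s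
      have e : Enc.enc (b (g (g^[j] (i a)))) = if j + 1 < n a then .node .nil .nil else .nil := by
        rw [← Function.iterate_succ_apply' g, h a (j + 1) hj]
        by_cases hlt : j + 1 < n a <;> simp [hlt, Enc.enc]
      rw [zero_add, Function.iterate_succ_apply', ← e]
      exact this.mono (eval_le_eval p ((hs a j hj.le).trans (hq a)))
  have e : Enc.enc (b (i a)) = if 0 < n a then .node .nil .nil else .nil := by
    have := h a 0 (Nat.zero_le _)
    rw [Function.iterate_zero_apply] at this
    rw [this]
    by_cases hlt : 0 < n a <;> simp [hlt, Enc.enc]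
  rw [zero_add, ← e] at key
  exact key

end Combinators

/-! ### Folds over lists -/

theorem foldl_cons_map {β γ : Type} (f : β → γ) (l : List β) (s : List γ) :
    l.foldl (fun s b => f b :: s) s = (l.map f).reverse ++ s := by
  induction l generalizing s with
  | nil => simp
  | cons b l ih => simp [ih]

theorem foldl_append_map {β γ : Type} (f : β → List γ) (l : List β) (s : List γ) :
    l.foldl (fun s b => s ++ f b) s = s ++ l.flatMap f := by
  induction l generalizing s with
  | nil => simp
  | cons b l ih => simp [ih]

section Lists

variable {α β γ σ : Type} [Enc α] [Enc β] [Enc γ] [Enc σ]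

/-- The test whether a list is nonempty. -/
def nonempty (l : List β) : Bool := !l.isEmpty

theorem nonempty_iff (l : List β) : nonempty l = true ↔ Enc.enc l ≠ .nil := by
  cases l <;> simp [nonempty, Enc.enc, encList]

@[fun_prop]
theorem PolyTime.nonempty {l : α → List β} (hl : PolyTime l) :
    PolyTime fun a => nonempty (l a) := by
  have := PolyTime.cond_of_enc hl (f := fun _ => true) (fun a => nonempty_iff (l a)) (.const true)
    (PolyTime.const (α := α) false)
  simpa using this

@[fun_prop]
theorem PolyTime.headD {l : α → List β} (hl : PolyTime l) (d : β) :
    PolyTime fun a => (l a).headD d := by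
  have h : PolyTime fun l : {l : List β // StackProgram.nonempty l = true} => l.1.headD d :=
    .of_enc_left fun ⟨l, h⟩ => by
      cases l with
      | nil => simp [StackProgram.nonempty] at h
      | cons b l => rfl
  have := PolyTime.cond_of_enc (f := fun l => l.headD d) PolyTime.id' nonempty_iff h (PolyTime.const d)
  refine (this.comp hl).congr fun a => ?_
  cases l a <;> rfl

@[fun_prop]
theorem PolyTime.tail {l : α → List β} (hl : PolyTime l) : PolyTime fun a => (l a).tail :=
  (PolyTime.of_enc_right fun l : List β => by cases l <;> rfl).comp hl

@[fun_prop]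
theorem PolyTime.cons {b : α → β} {l : α → List β} (hb : PolyTime b) (hl : PolyTime l) :
    PolyTime fun a => b a :: l a :=
  (PolyTime.of_enc_eq (f := fun x : β × List β => x.1 :: x.2) fun _ => rfl).comp (hb.pair hl)

/-- The loop carries the rest of the list, the parameter and the accumulator. The bound `hs` on all
intermediate accumulators is essential, since repeating a polynomial-time step may let sizes grow
exponentially. The default element is never read: the loop stops at the empty list. -/
theorem PolyTime.foldl [Inhabited β] {l : α → List β} {i : α → σ} {g : α → σ → β → σ} (hl : PolyTime l)
    (hi : PolyTime i) (hg : PolyTime fun x : α × σ × β => g x.1 x.2.1 x.2.2) {m : α → ℕ}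
    (hm : PolyBdd m) (hs : ∀ a l', l' <+: l a → size (l'.foldl (g a) (i a)) ≤ m a) :
    PolyTime fun a => (l a).foldl (g a) (i a) := by
  let step : List β × α × σ → List β × α × σ := fun x =>
    (x.1.tail, x.2.1, g x.2.1 x.2.2 (x.1.headD default))
  have hstep : PolyTime step := by
    have h2 : PolyTime fun x : List β × α × σ => g x.2.1 x.2.2 (x.1.headD default) :=
      hg.comp (f := fun x : List β × α × σ => (x.2.1, x.2.2, x.1.headD default)) (by fun_prop)
    exact PolyTime.pair (by fun_prop) (PolyTime.pair (by fun_prop) h2)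
  have key : ∀ a j, j ≤ (l a).length → step^[j] (l a, a, i a) =
      ((l a).drop j, a, ((l a).take j).foldl (g a) (i a)) := by
    intro a j
    induction j with
    | zero => intro _; simp
    | succ j ih =>
      intro hj
      rw [Function.iterate_succ_apply', ih (by omega)]
      have hd : (l a).drop j = (l a)[j] :: (l a).drop (j + 1) := List.drop_eq_getElem_cons hj
      simp only [step, hd, List.tail_cons, List.headD_cons]
      rw [List.take_succ_eq_append_getElem hj, List.foldl_append]
      rfl
  have := PolyTime.while (i := fun a => (l a, a, i a)) (n := fun a => (l a).length) hstep
    (b := fun x => StackProgram.nonempty x.1) (by fun_prop) (by fun_prop) (fun a j hj => by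
      rw [key a j hj, Bool.eq_iff_iff]
      simp [StackProgram.nonempty])
    (hl.size_le.mono fun a => (length_lt_size _).le)
    (m := fun a => size (l a) + (size a + m a) + 2) (by
      exact (hl.size_le.add (polyBdd_size.add hm)).add (.const _))
    (fun a j hj => by
      rw [key a j hj, size_pair, size_pair]
      have h1 := hs a _ (List.take_prefix j (l a))
      have h2 := size_append ((l a).take j) ((l a).drop j)
      rw [List.take_append_drop] at h2
      have := size_pos ((l a).take j)
      omega)
  refine (this.snd.snd).congr fun a => ?_
  rw [key a _ le_rfl]
  simp

@[fun_prop]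
theorem PolyTime.reverse [Inhabited β] {l : α → List β} (hl : PolyTime l) :
    PolyTime fun a => (l a).reverse := by
  have h := PolyTime.foldl (i := fun _ => []) (g := fun _ s b => b :: s) hl (by fun_prop)
    (by fun_prop) hl.size_le fun a l' h => by
      have : ∀ (l' s : List β), l'.foldl (fun s b => b :: s) s = l'.reverse ++ s := by
        intro l'; induction l' with
        | nil => simp
        | cons b l' ih => intro s; simp [ih]
      rw [this, List.append_nil, size_reverse]
      obtain ⟨t, ht⟩ := h
      rw [← ht]
      have := size_append l' t
      have := size_pos t
      omega
  refine h.congr fun a => ?_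
  simp

theorem size_le_of_prefix {l' l : List β} (h : l' <+: l) : size l' ≤ size l := by
  obtain ⟨t, rfl⟩ := h
  have := size_append l' t
  have := size_pos t
  omega

theorem PolyTime.polyBdd_map {l : α → List β} {f : α → β → γ} (hl : PolyTime l)
    (hf : PolyTime fun x : α × β => f x.1 x.2) : PolyBdd fun a => size ((l a).map (f a)) := by
  obtain ⟨p, hp⟩ := hf.size_le
  have h : PolyBdd fun a => size (l a) * (p.eval (size a + size (l a) + 1) + 1) + 1 :=
    (hl.size_le.mul ((PolyBdd.comp (polyBdd_eval p) (f := fun a => (a, l a))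
      (polyBdd_size.comp (by simpa only [size_pair] using
        ((polyBdd_size.add hl.size_le).add (.const 1))))).mono (m := fun a => _) (fun a => by
          rw [size_pair]) |>.add (.const 1))).add (.const 1)
  refine h.mono fun a => (size_le_of_forall_mem (m := p.eval (size a + size (l a) + 1)) ?_).trans ?_
  · intro c hc
    obtain ⟨b, hb, rfl⟩ := List.mem_map.1 hc
    refine (hp (a, b)).trans (eval_le_eval p ?_)
    rw [size_pair]
    have := size_lt_of_mem hb
    omega
  · rw [List.length_map]
    have := length_lt_size (l a)
    gcongr

@[fun_prop]
theorem PolyTime.map [Inhabited β] [Inhabited γ] {l : α → List β} {f : α → β → γ} (hl : PolyTime l)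
    (hf : PolyTime fun x : α × β => f x.1 x.2) : PolyTime fun a => (l a).map (f a) := by
  have h := PolyTime.foldl (i := fun _ => []) (g := fun a s b => f a b :: s) hl (by fun_prop)
    (by
      have : PolyTime fun x : α × List γ × β => f x.1 x.2.2 :=
        hf.comp (f := fun x : α × List γ × β => (x.1, x.2.2)) (by fun_prop)
      fun_prop) (polyBdd_map hl hf) fun a l' h => by
      rw [foldl_cons_map, List.append_nil, size_reverse]
      exact size_le_of_prefix (h.map _)
  refine h.reverse.congr fun a => ?_
  rw [foldl_cons_map]
  simp

@[fun_prop]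
theorem PolyTime.append [Inhabited β] {l l' : α → List β} (hl : PolyTime l) (hl' : PolyTime l') :
    PolyTime fun a => l a ++ l' a := by
  have h := PolyTime.foldl (l := fun a => (l a).reverse) (i := l') (g := fun _ s b => b :: s)
    (by fun_prop) hl' (by fun_prop) (hl.size_le.add hl'.size_le) fun a t h => by
      have e := foldl_cons_map (fun b : β => b) t (l' a)
      simp only [List.map_id_fun', id] at e
      rw [e]
      have h1 := size_append t.reverse (l' a)
      have h2 := size_le_of_prefix h
      rw [size_reverse] at h1 h2
      omega
  refine h.congr fun a => ?_
  have e := foldl_cons_map (fun b : β => b) (l a).reverse (l' a)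
  simp only [List.map_id_fun', id] at e
  rw [e, List.reverse_reverse]

theorem size_flatMap_le {β γ : Type} [Enc γ] (f : β → List γ) (l : List β) : size (l.flatMap f) ≤ size (l.map f) := by
  induction l with
  | nil => simp [size_nil]
  | cons b l ih =>
    rw [List.flatMap_cons, List.map_cons, size_cons]
    have := size_append (f b) (l.flatMap f)
    omega

@[fun_prop]
theorem PolyTime.flatMap [Inhabited β] [Inhabited γ] {l : α → List β} {f : α → β → List γ}
    (hl : PolyTime l) (hf : PolyTime fun x : α × β => f x.1 x.2) :
    PolyTime fun a => (l a).flatMap (f a) := by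
  have h := PolyTime.foldl (i := fun _ => []) (g := fun a s b => s ++ f a b) hl (by fun_prop)
    (by
      have : PolyTime fun x : α × List γ × β => f x.1 x.2.2 :=
        hf.comp (f := fun x : α × List γ × β => (x.1, x.2.2)) (by fun_prop)
      fun_prop) (polyBdd_map hl hf) fun a l' h => by
      rw [foldl_append_map, List.nil_append]
      exact (size_flatMap_le _ _).trans (size_le_of_prefix (h.map _))
  refine h.congr fun a => ?_
  rw [foldl_append_map, List.nil_append]

end Lists

/-! ### Binary arithmetic -/

instance : Enc ℕ := ⟨fun n => Enc.enc n.bits⟩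

theorem size_bits (n : ℕ) : size n.bits = size n := rfl

/-- A digit takes at most three symbols, its list cell one more, and the end of the list one. -/
theorem size_nat_le {n k : ℕ} (h : n < 2 ^ k) : size n ≤ 4 * k + 1 := by
  have := size_le_of_forall_mem (l := n.bits) (m := 3) fun b _ => size_bool_le b
  rw [size_bits, Nat.size_eq_bits_len] at this
  have := Nat.size_le.2 h
  omega

theorem lt_two_pow_size (n : ℕ) : n < 2 ^ size n := by
  have := length_lt_size n.bits
  rw [size_bits, Nat.size_eq_bits_len] at this
  exact Nat.size_le.1 this.le

theorem lt_two_pow_length_bits (n : ℕ) : n < 2 ^ n.bits.length := by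
  rw [Nat.size_eq_bits_len]
  exact Nat.lt_size_self n

theorem size_le_of_le {m n : ℕ} (h : m ≤ n) : size m ≤ 4 * size n + 1 :=
  size_nat_le (h.trans_lt (lt_two_pow_size n))

section Nat

variable {α β γ σ : Type} [Enc α] [Enc β] [Enc γ] [Enc σ]

@[fun_prop]
theorem PolyTime.bits {n : α → ℕ} (hn : PolyTime n) : PolyTime fun a => (n a).bits :=
  (PolyTime.of_enc_eq fun _ => rfl).comp hn

@[fun_prop]
theorem PolyTime.div2 {n : α → ℕ} (hn : PolyTime n) : PolyTime fun a => (n a).div2 :=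
  (PolyTime.of_enc_right fun n : ℕ => by
    simp only [Enc.enc, Nat.div2_bits_eq_tail]
    cases n.bits <;> rfl).comp hn

@[fun_prop]
theorem PolyTime.bodd {n : α → ℕ} (hn : PolyTime n) : PolyTime fun a => (n a).bodd := by
  have : PolyTime fun a => (n a).bits.headD false := by fun_prop
  refine this.congr fun a => ?_
  rw [Nat.bodd_eq_bits_head]
  cases (n a).bits <;> rfl

/-- The test whether a number is positive. -/
def isPos (n : ℕ) : Bool := decide (n ≠ 0)

@[fun_prop]
theorem PolyTime.isPos {n : α → ℕ} (hn : PolyTime n) : PolyTime fun a => isPos (n a) := by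
  have : PolyTime fun a => StackProgram.nonempty (n a).bits := by fun_prop
  refine this.congr fun a => ?_
  rcases Nat.eq_zero_or_pos (n a) with h | h
  · simp [h, StackProgram.nonempty, StackProgram.isPos]
  · have : (n a).bits.length ≠ 0 := by
      rw [Nat.size_eq_bits_len]; exact (Nat.size_pos.2 h).ne'
    cases h' : (n a).bits <;> simp_all [StackProgram.nonempty, StackProgram.isPos]
    omega

theorem PolyTime.bool_apply {f : Bool → α → β} {b : α → Bool} (hb : PolyTime b)
    (hf : ∀ x, PolyTime (f x)) : PolyTime fun a => f (b a) a :=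
  (hb.cond (hf true) (hf false)).congr fun a => by cases b a <;> rfl

@[fun_prop]
theorem PolyTime.and {b c : α → Bool} (hb : PolyTime b) (hc : PolyTime c) :
    PolyTime fun a => b a && c a :=
  (hb.cond hc (.const false)).congr fun a => by cases b a <;> rfl

@[fun_prop]
theorem PolyTime.or {b c : α → Bool} (hb : PolyTime b) (hc : PolyTime c) :
    PolyTime fun a => b a || c a :=
  (hb.cond (.const true) hc).congr fun a => by cases b a <;> rfl

@[fun_prop]
theorem PolyTime.not {b : α → Bool} (hb : PolyTime b) : PolyTime fun a => !b a :=
  (hb.cond (.const false) (.const true)).congr fun a => by cases b a <;> rfl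

@[fun_prop]
theorem PolyTime.bit {b : α → Bool} {n : α → ℕ} (hb : PolyTime b) (hn : PolyTime n) :
    PolyTime fun a => Nat.bit (b a) (n a) := by
  -- Appending a low digit is prepending to the digit list, except that `Nat.bit false 0` is zero,
  -- whose digit list is empty.
  have h : PolyTime fun x : {x : Bool × ℕ // (x.1 || StackProgram.isPos x.2) = true} =>
      Nat.bit x.1.1 x.1.2 := .of_enc_eq fun ⟨x, hx⟩ => by
    have : (Nat.bit x.1 x.2).bits = x.1 :: x.2.bits :=
      Nat.bits_append_bit _ _ fun h => by simpa [h, StackProgram.isPos] using hx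
    simp only [Enc.enc, this]
    rfl
  have h' : PolyTime fun x : Bool × ℕ => x.1 || StackProgram.isPos x.2 := by fun_prop
  have := PolyTime.cond_of_enc (f := fun x => Nat.bit x.1 x.2) h'
    (fun a => by cases a.1 || StackProgram.isPos a.2 <;> simp [Enc.enc]) h (.const 0)
  refine (this.comp (hb.pair hn)).congr fun a => ?_
  rcases hx : b a || StackProgram.isPos (n a) with _ | _
  · rw [cond_false]
    have : b a = false ∧ n a = 0 := by simpa [StackProgram.isPos] using hx
    simp [this]
  · rw [cond_true]

/-- The number with the given binary digits, most significant digit first, after those of `n`. -/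
def ofBits (l : List Bool) (n : ℕ) : ℕ := l.foldl (fun n b => Nat.bit b n) n

theorem ofBits_reverse_bits (n : ℕ) : ofBits n.bits.reverse 0 = n := by
  induction n using Nat.binaryRec' with
  | zero => rfl
  | bit b n h ih =>
    rw [Nat.bits_append_bit _ _ h, List.reverse_cons, ofBits, List.foldl_append]
    rw [ofBits] at ih
    rw [ih]
    rfl

theorem le_ofBits (l : List Bool) (n : ℕ) : n ≤ ofBits l n := by
  induction l generalizing n with
  | nil => exact le_rfl
  | cons b l ih =>
    refine le_trans ?_ (ih (Nat.bit b n))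
    rw [Nat.bit_val]; omega

theorem ofBits_lt (l : List Bool) (n k : ℕ) (h : n < 2 ^ k) : ofBits l n < 2 ^ (k + l.length) := by
  induction l generalizing n k with
  | nil => exact h
  | cons b l ih =>
    have := ih (Nat.bit b n) (k + 1) (by rw [Nat.bit_val, pow_succ]; cases b <;> simp <;> omega)
    rw [List.length_cons, show k + (l.length + 1) = k + 1 + l.length by omega]
    exact this

theorem ofBits_prefix_le {l l' : List Bool} {n : ℕ} (h : l' <+: l) : ofBits l' n ≤ ofBits l n := by
  obtain ⟨t, rfl⟩ := h
  rw [ofBits, ofBits, List.foldl_append]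
  exact le_ofBits _ _

@[fun_prop]
theorem PolyTime.ofBits {l : α → List Bool} (hl : PolyTime l) :
    PolyTime fun a => ofBits (l a) 0 :=
  PolyTime.foldl (i := fun _ => 0) (g := fun _ n b => Nat.bit b n) hl (by fun_prop) (by fun_prop)
    (m := fun a => 4 * (0 + size (l a)) + 1)
    (((PolyBdd.const 4).mul ((PolyBdd.const 0).add hl.size_le)).add (.const 1)) fun a l' h => by
      refine size_nat_le ((ofBits_lt l' 0 0 (by simp)).trans_le ?_)
      have h1 := length_lt_size l'
      have h2 := size_le_of_prefix h
      exact Nat.pow_le_pow_right (by norm_num) (by omega)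

/-- One step of a bit-serial computation on two numbers, with a carry and the list of the output
digits so far. -/
def serialStep (f : Bool → Bool → Bool → Bool × Bool) (s : ℕ × ℕ × Bool × List Bool) :
    ℕ × ℕ × Bool × List Bool :=
  (s.1.div2, s.2.1.div2, (f s.1.bodd s.2.1.bodd s.2.2.1).2,
    (f s.1.bodd s.2.1.bodd s.2.2.1).1 :: s.2.2.2)

/-- A bit-serial computation on two numbers. -/
def serial (f : Bool → Bool → Bool → Bool × Bool) (a b : ℕ) : ℕ × ℕ × Bool × List Bool :=
  -- Enough rounds for all digits of both numbers and a last carry. The count is the length of a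
  -- list, so that the iteration is a fold.
  (serialStep f)^[(a.bits ++ b.bits ++ [true]).length] (a, b, false, [])

theorem size_div2_le (n : ℕ) : size n.div2 ≤ size n := by
  rw [← size_bits, ← size_bits, Nat.div2_bits_eq_tail]
  cases n.bits with
  | nil => exact le_rfl
  | cons b l => rw [size_cons, List.tail_cons]; omega

theorem size_serial_le (f : Bool → Bool → Bool → Bool × Bool) (k : ℕ) :
    ∀ s, size ((serialStep f)^[k] s) ≤ size s + 4 * k + 3 := by
  have key : ∀ s, size ((serialStep f)^[k] s).1 ≤ size s.1 ∧
      size ((serialStep f)^[k] s).2.1 ≤ size s.2.1 ∧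
      size ((serialStep f)^[k] s).2.2.2 ≤ size s.2.2.2 + 4 * k := by
    induction k with
    | zero => simp
    | succ k ih =>
      intro s
      rw [Function.iterate_succ_apply]
      obtain ⟨h1, h2, h3⟩ := ih (serialStep f s)
      refine ⟨h1.trans (size_div2_le _), h2.trans (size_div2_le _), h3.trans ?_⟩
      have := size_bool_le (f s.1.bodd s.2.1.bodd s.2.2.1).1
      simp only [serialStep, size_cons]
      omega
  intro s
  obtain ⟨h1, h2, h3⟩ := key s
  obtain ⟨a, b, c, l⟩ := s
  generalize (serialStep f)^[k] (a, b, c, l) = s' at *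
  obtain ⟨a', b', c', l'⟩ := s'
  have := size_bool_le c'
  simp only [size_pair] at *
  omega

theorem PolyTime.serial (f : Bool → Bool → Bool → Bool × Bool) {m n : α → ℕ} (hm : PolyTime m)
    (hn : PolyTime n) : PolyTime fun a => serial f (m a) (n a) := by
  have hs : PolyTime (serialStep f) := by
    have : PolyTime fun s : ℕ × ℕ × Bool × List Bool => f s.1.bodd s.2.1.bodd s.2.2.1 :=
      PolyTime.bool_apply (f := fun x (s : ℕ × ℕ × Bool × List Bool) => f x s.2.1.bodd s.2.2.1) (by fun_prop) fun x =>
      PolyTime.bool_apply (f := fun y (s : ℕ × ℕ × Bool × List Bool) => f x y s.2.2.1) (by fun_prop) fun y =>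
      PolyTime.bool_apply (f := fun z (s : ℕ × ℕ × Bool × List Bool) => f x y z) (by fun_prop) fun z => .const _
    exact .pair (by fun_prop) (.pair (by fun_prop) (.pair this.snd (.cons this.fst (by fun_prop))))
  have hl : PolyTime fun a => (m a).bits ++ (n a).bits ++ [true] := by fun_prop
  have hi : PolyTime fun a => (m a, n a, false, ([] : List Bool)) := by fun_prop
  have := PolyTime.foldl (i := fun a => (m a, n a, false, [])) (g := fun _ s _ => serialStep f s)
    hl hi (by fun_prop)
    (m := fun a => size (m a, n a, false, ([] : List Bool)) +
      4 * size ((m a).bits ++ (n a).bits ++ [true]) + 3)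
    ((hi.size_le.add ((PolyBdd.const 4).mul hl.size_le)).add (.const 3)) fun a l' h => by
      rw [List.foldl_const]
      refine (size_serial_le _ _ _).trans ?_
      have h1 := length_lt_size l'
      have h2 := size_le_of_prefix h
      omega
  refine this.congr fun a => ?_
  rw [List.foldl_const]
  rfl

/-- The full adder. -/
def fullAdder (x y c : Bool) : Bool × Bool := (x ^^ (y ^^ c), (x && y) || (c && (x || y)))

/-- The full subtractor. -/
def fullSubtractor (x y c : Bool) : Bool × Bool := (x ^^ (y ^^ c), (!x && (y || c)) || (y && c))

theorem fullAdder_spec (x y c : Bool) :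
    2 * (fullAdder x y c).2.toNat + (fullAdder x y c).1.toNat = x.toNat + y.toNat + c.toNat := by
  revert x y c; decide

theorem fullSubtractor_spec (x y c : Bool) : x.toNat + 2 * (fullSubtractor x y c).2.toNat =
    (fullSubtractor x y c).1.toNat + y.toNat + c.toNat := by
  revert x y c; decide

theorem exists_bit (n : ℕ) : ∃ b m, n = Nat.bit b m := ⟨n.bodd, n.div2, (Nat.bit_bodd_div2 n).symm⟩

/-- The invariant of the school method: the digits still to be produced are those of `a + b + c`,
and they are more significant than the digits already in `l`, whose head is the latest one. -/
theorem serial_add (k : ℕ) : ∀ a b c l, a + b + c.toNat < 2 ^ k →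
    ofBits ((serialStep fullAdder)^[k] (a, b, c, l)).2.2.2 0 = ofBits l (a + b + c.toNat) := by
  induction k with
  | zero =>
    intro a b c l h
    have : a + b + c.toNat = 0 := by simpa using h
    rw [this]; rfl
  | succ k ih =>
    intro a b c l h
    obtain ⟨x, a, rfl⟩ := exists_bit a
    obtain ⟨y, b, rfl⟩ := exists_bit b
    rw [Function.iterate_succ_apply, serialStep]
    simp only [Nat.bodd_bit, Nat.div2_bit]
    rw [ih]
    · simp only [ofBits, List.foldl_cons]
      congr 1
      have := fullAdder_spec x y c
      simp only [Nat.bit_val]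
      omega
    · rw [pow_succ] at h
      have := fullAdder_spec x y c
      simp only [Nat.bit_val] at h
      omega

theorem serial_sub (k : ℕ) : ∀ a b c l, a < 2 ^ k → b + c.toNat ≤ a →
    ofBits ((serialStep fullSubtractor)^[k] (a, b, c, l)).2.2.2 0 =
      ofBits l (a - (b + c.toNat)) := by
  induction k with
  | zero =>
    intro a b c l h h'
    have : a - (b + c.toNat) = 0 := by simp at h; omega
    rw [this]; rfl
  | succ k ih =>
    intro a b c l h h'
    obtain ⟨x, a, rfl⟩ := exists_bit a
    obtain ⟨y, b, rfl⟩ := exists_bit b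
    rw [pow_succ] at h
    simp only [Nat.bit_val] at h h'
    rw [Function.iterate_succ_apply, serialStep]
    simp only [Nat.bodd_bit, Nat.div2_bit]
    rw [ih]
    · simp only [ofBits, List.foldl_cons]
      congr 1
      have := fullSubtractor_spec x y c
      have := Bool.toNat_le (fullSubtractor x y c).1
      simp only [Nat.bit_val]
      omega
    · omega
    · have := fullSubtractor_spec x y c
      have := Bool.toNat_le (fullSubtractor x y c).1
      omega

/-- The borrow that remains after all digits tells whether the subtraction would be negative. -/
theorem serial_lt (k : ℕ) : ∀ a b c l, a < 2 ^ k → b < 2 ^ k →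
    ((serialStep fullSubtractor)^[k] (a, b, c, l)).2.2.1 = decide (a < b + c.toNat) := by
  induction k with
  | zero =>
    intro a b c l h h'
    obtain rfl : a = 0 := by simpa using h
    obtain rfl : b = 0 := by simpa using h'
    cases c <;> simp
  | succ k ih =>
    intro a b c l h h'
    obtain ⟨x, a, rfl⟩ := exists_bit a
    obtain ⟨y, b, rfl⟩ := exists_bit b
    rw [pow_succ] at h h'
    simp only [Nat.bit_val] at h h'
    rw [Function.iterate_succ_apply, serialStep]
    simp only [Nat.bodd_bit, Nat.div2_bit]
    rw [ih _ _ _ _ (by omega) (by omega), decide_eq_decide]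
    have := fullSubtractor_spec x y c
    have := Bool.toNat_le (fullSubtractor x y c).1
    simp only [Nat.bit_val]
    omega

theorem two_pow_length_le (a b : ℕ) :
    a + b < 2 ^ (a.bits ++ b.bits ++ [true]).length ∧ a < 2 ^ (a.bits ++ b.bits ++ [true]).length ∧
      b < 2 ^ (a.bits ++ b.bits ++ [true]).length := by
  have h1 := lt_two_pow_length_bits a
  have h2 := lt_two_pow_length_bits b
  have h3 : 2 ^ a.bits.length ≤ 2 ^ (a.bits.length + b.bits.length) :=
    Nat.pow_le_pow_right (by norm_num) (by omega)
  have h4 : 2 ^ b.bits.length ≤ 2 ^ (a.bits.length + b.bits.length) :=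
    Nat.pow_le_pow_right (by norm_num) (by omega)
  have h5 : (a.bits ++ b.bits ++ [true]).length = a.bits.length + b.bits.length + 1 := by
    simp [add_assoc]
  rw [h5, pow_succ]
  omega

@[fun_prop]
theorem PolyTime.add {m n : α → ℕ} (hm : PolyTime m) (hn : PolyTime n) :
    PolyTime fun a => m a + n a := by
  have h := PolyTime.serial fullAdder hm hn
  have : PolyTime fun a => StackProgram.ofBits (StackProgram.serial fullAdder (m a) (n a)).2.2.2 0 := by
    fun_prop
  refine this.congr fun a => ?_
  rw [StackProgram.serial, serial_add]
  · rfl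
  · exact (two_pow_length_le (m a) (n a)).1

@[fun_prop]
theorem PolyTime.lt {m n : α → ℕ} (hm : PolyTime m) (hn : PolyTime n) :
    PolyTime fun a => decide (m a < n a) := by
  have h := PolyTime.serial fullSubtractor hm hn
  have : PolyTime fun a => (StackProgram.serial fullSubtractor (m a) (n a)).2.2.1 := by fun_prop
  refine this.congr fun a => ?_
  have := two_pow_length_le (m a) (n a)
  rw [StackProgram.serial, serial_lt _ _ _ _ _ this.2.1 this.2.2]
  rfl

@[fun_prop]
theorem PolyTime.le {m n : α → ℕ} (hm : PolyTime m) (hn : PolyTime n) :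
    PolyTime fun a => decide (m a ≤ n a) := by
  have : PolyTime fun a => !decide (n a < m a) := by fun_prop
  exact this.congr fun a => by rw [Bool.eq_iff_iff]; simp

@[fun_prop]
theorem PolyTime.nat_eq {m n : α → ℕ} (hm : PolyTime m) (hn : PolyTime n) :
    PolyTime fun a => decide (m a = n a) := by
  have : PolyTime fun a => decide (m a ≤ n a) && decide (n a ≤ m a) := by fun_prop
  exact this.congr fun a => by simp [le_antisymm_iff]

@[fun_prop]
theorem PolyTime.sub {m n : α → ℕ} (hm : PolyTime m) (hn : PolyTime n) :
    PolyTime fun a => m a - n a := by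
  have h := PolyTime.serial fullSubtractor hm hn
  have : PolyTime fun a => bif decide (n a ≤ m a) then
      StackProgram.ofBits (StackProgram.serial fullSubtractor (m a) (n a)).2.2.2 0 else 0 := by
    fun_prop
  refine this.congr fun a => ?_
  by_cases hle : n a ≤ m a
  · rw [decide_eq_true hle, cond_true, StackProgram.serial, serial_sub]
    · rfl
    · exact (two_pow_length_le (m a) (n a)).2.1
    · exact hle
  · rw [decide_eq_false hle, cond_false]
    omega

/-- Multiplication by doubling and adding. Applied to prefixes of the digits, it shows that no
intermediate value exceeds the product. -/
theorem foldl_double_add (y : ℕ) (l : List Bool) (n : ℕ) :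
    l.foldl (fun s b => bif b then Nat.bit false s + y else Nat.bit false s) (n * y) =
      ofBits l n * y := by
  induction l generalizing n with
  | nil => rfl
  | cons b l ih =>
    rw [ofBits, List.foldl_cons, List.foldl_cons]
    have : (bif b then Nat.bit false (n * y) + y else Nat.bit false (n * y)) = Nat.bit b n * y := by
      cases b <;> simp [Nat.bit_val] <;> ring
    rw [this, ih]
    rfl

theorem size_mul_le {m n k : ℕ} (h : k ≤ m * n) : size k ≤ 4 * (size m + size n) + 1 := by
  refine size_nat_le (h.trans_lt ?_)
  rw [pow_add]
  exact Nat.mul_lt_mul'' (lt_two_pow_size m) (lt_two_pow_size n)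

@[fun_prop]
theorem PolyTime.mul {m n : α → ℕ} (hm : PolyTime m) (hn : PolyTime n) :
    PolyTime fun a => m a * n a := by
  have := PolyTime.foldl (l := fun a => (m a).bits.reverse) (i := fun _ => 0)
    (g := fun a s b => bif b then Nat.bit false s + n a else Nat.bit false s) (by fun_prop)
    (by fun_prop)
    (by
      have : PolyTime fun x : α × ℕ × Bool => n x.1 := hn.comp (by fun_prop)
      fun_prop) (m := fun a => 4 * (size (m a) + size (n a)) + 1)
    (((PolyBdd.const 4).mul (hm.size_le.add hn.size_le)).add (.const 1)) fun a l' h => by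
      refine size_mul_le ?_
      have := foldl_double_add (n a) l' 0
      rw [zero_mul] at this
      rw [this]
      refine Nat.mul_le_mul_right _ ((ofBits_prefix_le h).trans ?_)
      rw [ofBits_reverse_bits]
  refine this.congr fun a => ?_
  have := foldl_double_add (n a) (m a).bits.reverse 0
  rw [zero_mul] at this
  rw [this, ofBits_reverse_bits]

/-- One step of the long division by `d`, on the quotient and the remainder. -/
def divStep (d : ℕ) (s : ℕ × ℕ) (b : Bool) : ℕ × ℕ :=
  bif decide (d ≤ Nat.bit b s.2) then (Nat.bit true s.1, Nat.bit b s.2 - d)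
  else (Nat.bit false s.1, Nat.bit b s.2)

/-- The invariant of long division. The bound on the quotient is also claimed for `d = 0`, where the
result is meaningless but the program must still keep its values small. -/
theorem foldl_divStep (d : ℕ) (l : List Bool) : ∀ (s : ℕ × ℕ) (v k : ℕ), s.1 * d + s.2 = v →
    s.1 < 2 ^ k → (0 < d → s.2 < d) →
    (l.foldl (divStep d) s).1 * d + (l.foldl (divStep d) s).2 = ofBits l v ∧
      (l.foldl (divStep d) s).1 < 2 ^ (k + l.length) ∧
      (0 < d → (l.foldl (divStep d) s).2 < d) := by
  induction l with
  | nil => intro s v k h1 h2 h3; exact ⟨h1, h2, h3⟩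
  | cons b l ih =>
    intro s v k h1 h2 h3
    rw [List.foldl_cons, List.length_cons, show k + (l.length + 1) = k + 1 + l.length by omega]
    apply ih
    · subst h1
      rw [divStep]
      by_cases h : d ≤ Nat.bit b s.2
      · rw [decide_eq_true h, cond_true]
        simp only [Nat.bit_val] at *
        cases b <;> simp at * <;> ring_nf <;> ring_nf at h <;> omega
      · rw [decide_eq_false h, cond_false]
        simp only [Nat.bit_val] at *
        cases b <;> simp at * <;> ring_nf
    · rw [divStep, pow_succ]
      by_cases h : d ≤ Nat.bit b s.2
      · rw [decide_eq_true h, cond_true, Nat.bit_val]; simp; omega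
      · rw [decide_eq_false h, cond_false, Nat.bit_val]; simp; omega
    · intro hd
      have := h3 hd
      rw [divStep]
      by_cases h : d ≤ Nat.bit b s.2
      · rw [decide_eq_true h, cond_true]
        simp only [Nat.bit_val] at *
        cases b <;> simp at * <;> omega
      · rw [decide_eq_false h, cond_false]
        simpa using h

theorem PolyTime.divMod {m n : α → ℕ} (hm : PolyTime m) (hn : PolyTime n) :
    PolyTime fun a => (m a).bits.reverse.foldl (divStep (n a)) (0, 0) := by
  refine PolyTime.foldl (l := fun a => (m a).bits.reverse) (i := fun _ => (0, 0))
    (g := fun a s b => divStep (n a) s b) (by fun_prop) (by fun_prop)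
    (by
      have : PolyTime fun x : α × (ℕ × ℕ) × Bool => n x.1 := hn.comp (by fun_prop)
      unfold divStep
      fun_prop) (m := fun a => (4 * (size (m a)) + 1) + (4 * size (m a) + 1) + 1)
    (((((PolyBdd.const 4).mul hm.size_le).add (.const 1)).add
      (((PolyBdd.const 4).mul hm.size_le).add (.const 1))).add (.const 1)) fun a l' h => ?_
  obtain ⟨h1, h2, -⟩ := foldl_divStep (n a) l' (0, 0) 0 0 (by simp) (by simp) (by simp)
  have h3 := ofBits_prefix_le (n := 0) h
  rw [ofBits_reverse_bits] at h3
  have h4 : size (l'.foldl (divStep (n a)) (0, 0)).1 ≤ 4 * size (m a) + 1 := by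
    refine size_nat_le (h2.trans_le (Nat.pow_le_pow_right (by norm_num) ?_))
    have := length_lt_size l'
    have h5 := size_le_of_prefix h
    rw [size_reverse, size_bits] at h5
    omega
  have h5 : size (l'.foldl (divStep (n a)) (0, 0)).2 ≤ 4 * size (m a) + 1 :=
    size_le_of_le (by omega)
  change size ((l'.foldl (divStep (n a)) (0, 0)).1, (l'.foldl (divStep (n a)) (0, 0)).2) ≤ _
  rw [size_pair]
  omega

theorem foldl_divStep_eq (m n : ℕ) (hn : 0 < n) :
    m.bits.reverse.foldl (divStep n) (0, 0) = (m / n, m % n) := by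
  obtain ⟨h1, -, h3⟩ := foldl_divStep n m.bits.reverse (0, 0) 0 0 (by simp) (by simp) (by simp)
  rw [ofBits_reverse_bits] at h1
  have h3 := h3 hn
  have := (Nat.div_mod_unique (a := m) hn).2 ⟨by rw [add_comm, mul_comm]; exact h1, h3⟩
  exact (Prod.ext this.1 this.2).symm

@[fun_prop]
theorem PolyTime.div {m n : α → ℕ} (hm : PolyTime m) (hn : PolyTime n) :
    PolyTime fun a => m a / n a := by
  have := PolyTime.divMod hm hn
  have : PolyTime fun a => bif decide (0 < n a) then
    ((m a).bits.reverse.foldl (divStep (n a)) (0, 0)).1 else 0 := by fun_prop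
  refine this.congr fun a => ?_
  rcases Nat.eq_zero_or_pos (n a) with h | h
  · simp [h]
  · rw [decide_eq_true h, cond_true, foldl_divStep_eq _ _ h]

@[fun_prop]
theorem PolyTime.mod {m n : α → ℕ} (hm : PolyTime m) (hn : PolyTime n) :
    PolyTime fun a => m a % n a := by
  have := PolyTime.divMod hm hn
  have : PolyTime fun a => bif decide (0 < n a) then
    ((m a).bits.reverse.foldl (divStep (n a)) (0, 0)).2 else m a := by fun_prop
  refine this.congr fun a => ?_
  rcases Nat.eq_zero_or_pos (n a) with h | h
  · simp [h]
  · rw [decide_eq_true h, cond_true, foldl_divStep_eq _ _ h]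

/-- One step of the Euclidean algorithm. -/
def gcdStep (s : ℕ × ℕ) : ℕ × ℕ := bif decide (0 < s.2) then (s.2, s.1 % s.2) else s

theorem gcdStep_bound (m k : ℕ) : ∀ s : ℕ × ℕ, s.1 ≤ m → s.2 ≤ m →
    (gcdStep^[k] s).1 ≤ m ∧ (gcdStep^[k] s).2 ≤ m := by
  induction k with
  | zero => exact fun s h h' => ⟨h, h'⟩
  | succ k ih =>
    intro s h h'
    rw [Function.iterate_succ_apply]
    apply ih <;> rw [gcdStep] <;> by_cases hs : 0 < s.2 <;> simp [hs, h, h']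
    exact (Nat.mod_le _ _).trans h

theorem gcd_gcdStep (k : ℕ) : ∀ s : ℕ × ℕ,
    Nat.gcd (gcdStep^[k] s).1 (gcdStep^[k] s).2 = Nat.gcd s.1 s.2 := by
  induction k with
  | zero => exact fun s => rfl
  | succ k ih =>
    intro s
    rw [Function.iterate_succ_apply, ih, gcdStep]
    by_cases hs : 0 < s.2
    · rw [decide_eq_true hs, cond_true, Nat.gcd_comm, ← Nat.gcd_rec, Nat.gcd_comm]
    · rw [decide_eq_false hs, cond_false]

/-- For `r = a % b`, the remainder `b % r` is less than `r` and at most `b - r`. So the number of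
Euclidean steps is linear in the number of digits. -/
theorem gcdStep_gcdStep (s : ℕ × ℕ) : 2 * (gcdStep (gcdStep s)).2 ≤ s.2 := by
  obtain ⟨a, b⟩ := s
  rcases Nat.eq_zero_or_pos b with rfl | hb
  · simp [gcdStep]
  have h1 : gcdStep (a, b) = (b, a % b) := by simp [gcdStep, hb]
  rw [h1]
  rcases Nat.eq_zero_or_pos (a % b) with h | h
  · rw [h]; simp [gcdStep]
  have h2 : gcdStep (b, a % b) = (a % b, b % (a % b)) := by simp [gcdStep, h]
  rw [h2]
  have h3 := Nat.mod_lt a hb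
  have h4 := Nat.mod_lt b h
  have h5 := Nat.div_add_mod b (a % b)
  have h6 : 1 ≤ b / (a % b) := (Nat.one_le_div_iff h).2 h3.le
  have h7 : (a % b) * 1 ≤ (a % b) * (b / (a % b)) := Nat.mul_le_mul_left _ h6
  simp only
  omega

theorem gcdStep_snd_eq_zero (k : ℕ) : ∀ s : ℕ × ℕ, s.2 < 2 ^ k → (gcdStep^[k + k] s).2 = 0 := by
  induction k with
  | zero => intro s h; simpa using h
  | succ k ih =>
    intro s h
    rw [show k + 1 + (k + 1) = (k + k + 1) + 1 by omega, Function.iterate_succ_apply,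
      Function.iterate_succ_apply]
    apply ih
    have := gcdStep_gcdStep s
    rw [pow_succ] at h
    omega

@[fun_prop]
theorem PolyTime.gcd {m n : α → ℕ} (hm : PolyTime m) (hn : PolyTime n) :
    PolyTime fun a => Nat.gcd (m a) (n a) := by
  -- This list only counts rounds: two for each digit of `n a`, as two steps halve the second entry.
  have := PolyTime.foldl (l := fun a => (n a).bits ++ (n a).bits) (i := fun a => (m a, n a))
    (g := fun a s b => gcdStep s) (by fun_prop) (by fun_prop)
    (by
      unfold gcdStep
      fun_prop) (m := fun a => (4 * size (m a + n a) + 1) + (4 * size (m a + n a) + 1) + 1)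
    (((((PolyBdd.const 4).mul (hm.add hn).size_le).add (.const 1)).add
      (((PolyBdd.const 4).mul (hm.add hn).size_le).add (.const 1))).add (.const 1)) fun a l' h => by
      rw [List.foldl_const]
      obtain ⟨h1, h2⟩ := gcdStep_bound (m a + n a) l'.length (m a, n a) (Nat.le_add_right _ _)
        (Nat.le_add_left _ _)
      change size ((gcdStep^[l'.length] (m a, n a)).1, (gcdStep^[l'.length] (m a, n a)).2) ≤ _
      rw [size_pair]
      have := size_le_of_le h1
      have := size_le_of_le h2
      omega
  refine this.fst.congr fun a => ?_
  rw [List.foldl_const, List.length_append]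
  have h0 := gcdStep_snd_eq_zero _ (m a, n a) (lt_two_pow_length_bits (n a))
  have h1 := gcd_gcdStep ((n a).bits.length + (n a).bits.length) (m a, n a)
  rw [h0, Nat.gcd_zero_right] at h1
  exact h1

end Nat

/-! ### Counted iteration, ranges and list access -/

section Iteration

variable {α β γ σ : Type} [Enc α] [Enc β] [Enc γ] [Enc σ]

/-- The number of rounds is given in binary, so that besides its computability a polynomial bound
`hn'` on its value, not just on its size, is needed. The same applies to ranges. -/
theorem PolyTime.iterate {g : α → σ → σ} {i : α → σ} {n : α → ℕ} (hn : PolyTime n)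
    (hi : PolyTime i) (hg : PolyTime fun x : α × σ => g x.1 x.2) (hn' : PolyBdd n) {m : α → ℕ}
    (hm : PolyBdd m) (hs : ∀ a j, j ≤ n a → size ((g a)^[j] (i a)) ≤ m a) :
    PolyTime fun a => (g a)^[n a] (i a) := by
  let step : ℕ × α × σ → ℕ × α × σ := fun x => (x.1 - 1, x.2.1, g x.2.1 x.2.2)
  have hstep : PolyTime step := by
    have h2 : PolyTime fun x : ℕ × α × σ => g x.2.1 x.2.2 :=
      hg.comp (f := fun x : ℕ × α × σ => (x.2.1, x.2.2)) (by fun_prop)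
    exact PolyTime.pair (by fun_prop) (PolyTime.pair (by fun_prop) h2)
  have key : ∀ a j, step^[j] (n a, a, i a) = (n a - j, a, (g a)^[j] (i a)) := by
    intro a j
    induction j with
    | zero => simp
    | succ j ih =>
      rw [Function.iterate_succ_apply', ih, Function.iterate_succ_apply']
      rfl
  have := PolyTime.while (i := fun a => (n a, a, i a)) (n := n) hstep
    (b := fun x => StackProgram.isPos x.1) (by fun_prop) (by fun_prop) (fun a j hj => by
      rw [key a j, Bool.eq_iff_iff]
      simp only [StackProgram.isPos, decide_eq_true_eq]
      omega)
    hn'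
    (m := fun a => (4 * size (n a) + 1) + (size a + m a) + 2) (by
      exact ((((PolyBdd.const 4).mul hn.size_le).add (.const 1)).add (polyBdd_size.add hm)).add
        (.const 2))
    (fun a j hj => by
      rw [key a j, size_pair, size_pair]
      have h1 := hs a j hj
      have h2 := size_le_of_le (Nat.sub_le (n a) j)
      omega)
  refine (this.snd.snd).congr fun a => ?_
  rw [key a]

theorem iterate_range (n : ℕ) : ∀ j ≤ n, (fun s : ℕ × List ℕ => (s.1 - 1, (s.1 - 1) :: s.2))^[j]
    (n, []) = (n - j, List.range' (n - j) j) := by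
  intro j hj
  induction j with
  | zero => simp
  | succ j ih =>
    rw [Function.iterate_succ_apply', ih (by omega)]
    simp only [Prod.mk.injEq]
    refine ⟨by omega, ?_⟩
    rw [List.range'_succ, show n - j - 1 = n - (j + 1) by omega,
      show n - (j + 1) + 1 = n - j by omega]

theorem PolyTime.range {n : α → ℕ} (hn : PolyTime n) (hn' : PolyBdd n) :
    PolyTime fun a => List.range (n a) := by
  have hk : PolyBdd fun a => 4 * size (n a) + 1 := ((PolyBdd.const 4).mul hn.size_le).add (.const 1)
  have := PolyTime.iterate (i := fun a => (n a, ([] : List ℕ)))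
    (g := fun _ s => (s.1 - 1, (s.1 - 1) :: s.2)) hn (by fun_prop) (by fun_prop) hn'
    (m := fun a => (4 * size (n a) + 1) + (n a * ((4 * size (n a) + 1) + 1) + 1) + 1)
    ((hk.add ((hn'.mul (hk.add (.const 1))).add (.const 1))).add (.const 1)) fun a j hj => by
      rw [iterate_range _ _ hj, size_pair]
      have h1 := size_le_of_le (Nat.sub_le (n a) j)
      have h2 : size (List.range' (n a - j) j) ≤ j * ((4 * size (n a) + 1) + 1) + 1 := by
        have := size_le_of_forall_mem (l := List.range' (n a - j) j) (m := 4 * size (n a) + 1)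
          fun x hx => by
            rw [List.mem_range'_1] at hx
            exact size_le_of_le (by omega)
        simpa using this
      have h3 : j * ((4 * size (n a) + 1) + 1) ≤ n a * ((4 * size (n a) + 1) + 1) :=
        Nat.mul_le_mul_right _ hj
      omega
  refine this.snd.congr fun a => ?_
  rw [iterate_range _ _ le_rfl, List.range_eq_range']
  simp

@[fun_prop]
theorem PolyTime.length [Inhabited β] {l : α → List β} (hl : PolyTime l) :
    PolyTime fun a => (l a).length := by
  have e : ∀ (l : List β) (n : ℕ), l.foldl (fun n _ => n + 1) n = n + l.length := by
    intro l
    induction l with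
    | nil => simp
    | cons b l ih => intro n; rw [List.foldl_cons, ih, List.length_cons]; omega
  have := PolyTime.foldl (i := fun _ => 0) (g := fun _ n _ => n + 1) hl (by fun_prop) (by fun_prop)
    (m := fun a => 4 * size (l a) + 1) (((PolyBdd.const 4).mul hl.size_le).add (.const 1))
    fun a l' h => by
      rw [e, zero_add]
      have h1 := length_lt_size l'
      have h2 := size_le_of_prefix h
      refine size_nat_le (Nat.lt_two_pow_self.trans_le ?_)
      exact Nat.pow_le_pow_right (by norm_num) (by omega)
  exact this.congr fun a => by rw [e, zero_add]

theorem PolyTime.polyBdd_length {l : α → List β} (hl : PolyTime l) :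
    PolyBdd fun a => (l a).length := hl.size_le.mono fun _ => (length_lt_size _).le

theorem iterate_tail {β : Type} (l : List β) (n : ℕ) : List.tail^[n] l = l.drop n := by
  induction n with
  | zero => rfl
  | succ n ih => rw [Function.iterate_succ_apply', ih, List.tail_drop]

@[fun_prop]
theorem PolyTime.min {m n : α → ℕ} (hm : PolyTime m) (hn : PolyTime n) :
    PolyTime fun a => min (m a) (n a) := by
  have : PolyTime fun a => if m a ≤ n a then m a else n a := by fun_prop
  exact this.congr fun a => (min_def _ _).symm

@[fun_prop]
theorem PolyTime.drop [Inhabited β] {n : α → ℕ} {l : α → List β} (hn : PolyTime n)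
    (hl : PolyTime l) : PolyTime fun a => (l a).drop (n a) := by
  -- The index may be exponentially large; capping it at the length of the list bounds the number of
  -- rounds.
  have := PolyTime.iterate (i := l) (n := fun a => Min.min (n a) (l a).length)
    (g := fun _ l => l.tail) (by fun_prop) hl (by fun_prop)
    (hl.polyBdd_length.mono fun a => Nat.min_le_right _ _) hl.size_le fun a j hj => by
      rw [iterate_tail]
      have := size_append ((l a).take j) ((l a).drop j)
      rw [List.take_append_drop] at this
      have := size_pos ((l a).take j)
      omega
  refine this.congr fun a => ?_
  rw [iterate_tail]
  rcases le_total (n a) (l a).length with h | h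
  · rw [min_eq_left h]
  · rw [min_eq_right h, List.drop_length, List.drop_eq_nil_of_le h]

@[fun_prop]
theorem PolyTime.getD [Inhabited β] {n : α → ℕ} {l : α → List β} (hn : PolyTime n)
    (hl : PolyTime l) (d : β) : PolyTime fun a => (l a).getD (n a) d := by
  have : PolyTime fun a => ((l a).drop (n a)).headD d := by fun_prop
  refine this.congr fun a => ?_
  rw [List.headD_eq_head?_getD, List.head?_drop, List.getD_eq_getElem?_getD]

theorem sum_lt_two_pow_size (l : List ℕ) : l.sum < 2 ^ size l := by
  induction l with
  | nil => simp [size_nil]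
  | cons a l ih =>
    rw [List.sum_cons, size_cons, pow_succ, pow_add]
    have h1 := lt_two_pow_size a
    have h2 := Nat.one_le_two_pow (n := size a)
    have h3 := Nat.one_le_two_pow (n := size l)
    nlinarith

theorem prod_lt_two_pow_size (l : List ℕ) : l.prod < 2 ^ size l := by
  induction l with
  | nil => simp [size_nil]
  | cons a l ih =>
    rw [List.prod_cons, size_cons, pow_succ, pow_add]
    have h1 := Nat.mul_lt_mul'' (lt_two_pow_size a) ih
    omega

@[fun_prop]
theorem PolyTime.sum {l : α → List ℕ} (hl : PolyTime l) : PolyTime fun a => (l a).sum := by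
  have := PolyTime.foldl (i := fun _ => 0) (g := fun _ m n => m + n) hl (by fun_prop) (by fun_prop)
    (m := fun a => 4 * size (l a) + 1) (((PolyBdd.const 4).mul hl.size_le).add (.const 1))
    fun a l' h => by
      rw [← List.sum_eq_foldl]
      exact (size_nat_le ((sum_lt_two_pow_size l').trans_le
        (Nat.pow_le_pow_right (by norm_num) (size_le_of_prefix h))))
  exact this.congr fun a => by rw [← List.sum_eq_foldl]

@[fun_prop]
theorem PolyTime.prod {l : α → List ℕ} (hl : PolyTime l) : PolyTime fun a => (l a).prod := by
  have := PolyTime.foldl (i := fun _ => 1) (g := fun _ m n => m * n) hl (by fun_prop) (by fun_prop)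
    (m := fun a => 4 * size (l a) + 1) (((PolyBdd.const 4).mul hl.size_le).add (.const 1))
    fun a l' h => by
      rw [← List.prod_eq_foldl]
      exact (size_nat_le ((prod_lt_two_pow_size l').trans_le
        (Nat.pow_le_pow_right (by norm_num) (size_le_of_prefix h))))
  exact this.congr fun a => by rw [← List.prod_eq_foldl]

@[fun_prop]
theorem PolyTime.mem {n : α → ℕ} {l : α → List ℕ} (hn : PolyTime n) (hl : PolyTime l) :
    PolyTime fun a => decide (n a ∈ l a) := by
  have := PolyTime.foldl (i := fun _ => false) (g := fun a s b => s || decide (b = n a)) hl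
    (by fun_prop) (by
      have : PolyTime fun x : α × Bool × ℕ => n x.1 := hn.comp (by fun_prop)
      fun_prop) (.const 3) fun a l' h => size_bool_le _
  refine this.congr fun a => ?_
  have e : ∀ (l : List ℕ) (s : Bool) (n : ℕ),
      l.foldl (fun s b => s || decide (b = n)) s = (s || decide (n ∈ l)) := by
    intro l
    induction l with
    | nil => simp
    | cons b l ih =>
      intro s n
      rw [List.foldl_cons, ih]
      rcases eq_or_ne n b with rfl | hb
      · simp
      · simp [hb, hb.symm]
  rw [e, Bool.false_or]

end Iteration

/-! ### Dual numbers and truncated matrix series -/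

section Dual

variable {α ι : Type} [Enc α] [Enc ι]

/-- Dual numbers with natural coefficients. -/
abbrev Dual : Type := DualNumber ℕ

/-- The dual number with the given coefficients. -/
def dual (m n : ℕ) : Dual := (m, n)

@[simp] theorem fst_dual (m n : ℕ) : (dual m n).fst = m := rfl
@[simp] theorem snd_dual (m n : ℕ) : (dual m n).snd = n := rfl

instance : Enc Dual := ⟨fun x => Enc.enc ((x.fst, x.snd) : ℕ × ℕ)⟩

instance : Inhabited Dual := ⟨0⟩

theorem size_dual (x : Dual) : size x = size x.fst + size x.snd + 1 := size_pair x.fst x.snd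

@[fun_prop]
theorem PolyTime.dual_fst {x : α → Dual} (h : PolyTime x) : PolyTime fun a => (x a).fst :=
  (PolyTime.of_enc_left fun _ => rfl).comp h

@[fun_prop]
theorem PolyTime.dual_snd {x : α → Dual} (h : PolyTime x) : PolyTime fun a => (x a).snd :=
  (PolyTime.of_enc_right fun _ => rfl).comp h

@[fun_prop]
theorem PolyTime.dual {m n : α → ℕ} (hm : PolyTime m) (hn : PolyTime n) :
    PolyTime fun a => dual (m a) (n a) :=
  (PolyTime.of_enc_eq (f := fun x : ℕ × ℕ => StackProgram.dual x.1 x.2) fun _ => rfl).comp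
    (hm.pair hn)

@[fun_prop]
theorem PolyTime.dual_add {x y : α → Dual} (hx : PolyTime x) (hy : PolyTime y) :
    PolyTime fun a => x a + y a := by
  have : PolyTime fun a =>
      StackProgram.dual ((x a).fst + (y a).fst) ((x a).snd + (y a).snd) := by fun_prop
  exact this.congr fun a => by ext <;> simp

@[fun_prop]
theorem PolyTime.dual_mul {x y : α → Dual} (hx : PolyTime x) (hy : PolyTime y) :
    PolyTime fun a => x a * y a := by
  have : PolyTime fun a => StackProgram.dual ((x a).fst * (y a).fst)
      ((x a).fst * (y a).snd + (y a).fst * (x a).snd) := by fun_prop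
  exact this.congr fun a => by ext <;> simp [mul_comm]

theorem fst_list_sum (l : List Dual) : l.sum.fst = (l.map fun x => x.fst).sum := by
  induction l with
  | nil => rfl
  | cons x l ih => simp [ih]

theorem snd_list_sum (l : List Dual) : l.sum.snd = (l.map fun x => x.snd).sum := by
  induction l with
  | nil => rfl
  | cons x l ih => simp [ih]

@[fun_prop]
theorem PolyTime.dual_sum {l : α → List Dual} (hl : PolyTime l) : PolyTime fun a => (l a).sum := by
  have : PolyTime fun a => StackProgram.dual ((l a).map fun x => x.fst).sum
      ((l a).map fun x => x.snd).sum := by fun_prop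
  exact this.congr fun a => by rw [← fst_list_sum, ← snd_list_sum]; rfl

/-- A submultiplicative norm. -/
def dualNorm (x : Dual) : ℕ := x.fst + x.snd

theorem dualNorm_add (x y : Dual) : dualNorm (x + y) = dualNorm x + dualNorm y := by
  simp [dualNorm]; ring

theorem dualNorm_mul_le (x y : Dual) : dualNorm (x * y) ≤ dualNorm x * dualNorm y := by
  simp [dualNorm]; nlinarith

theorem dualNorm_sum_le (l : List Dual) (m : ℕ) (h : ∀ x ∈ l, dualNorm x ≤ m) :
    dualNorm l.sum ≤ l.length * m := by
  induction l with
  | nil => simp [dualNorm]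
  | cons x l ih =>
    rw [List.sum_cons, dualNorm_add, List.length_cons, add_mul]
    have := h x (by simp)
    have := ih fun y hy => h y (List.mem_cons_of_mem _ hy)
    omega

theorem dualNorm_le (x : Dual) : dualNorm x ≤ 2 ^ size x := by
  have h1 := lt_two_pow_size x.fst
  have h2 := lt_two_pow_size x.snd
  rw [size_dual, pow_succ, pow_add, dualNorm]
  have h3 := Nat.one_le_two_pow (n := size x.fst)
  have h4 := Nat.one_le_two_pow (n := size x.snd)
  nlinarith

theorem size_dual_le {x : Dual} {k : ℕ} (h : dualNorm x ≤ 2 ^ k) : size x ≤ 8 * k + 11 := by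
  have h0 : 2 ^ k < 2 ^ (k + 1) := by rw [pow_succ]; have := Nat.one_le_two_pow (n := k); omega
  have h1 : size x.fst ≤ 4 * (k + 1) + 1 := size_nat_le (by rw [dualNorm] at h; omega)
  have h2 : size x.snd ≤ 4 * (k + 1) + 1 := size_nat_le (by rw [dualNorm] at h; omega)
  rw [size_dual]
  omega

/-- The first `l + 1` terms of the series `∑ Sⁱ f`, for the matrix `S` with index set `cs`. -/
def horner {ι R : Type} [Semiring R] (cs : List ι) (f : ι → R) (S : ι → ι → R) : ℕ → ι → R
  | 0, c => f c
  | l + 1, c => f c + (cs.map fun c' => S c c' * horner cs f S l c').sum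

/-- A step multiplies the norm by at most `2 ^ b * (cs.length + 1)`, which is at most `2 ^ (b +
cs.length)`. So after polynomially many steps the coefficients still have polynomially many digits.
-/
theorem dualNorm_horner_le {ι : Type} {cs : List ι} {f : ι → Dual} {S : ι → ι → Dual} {b : ℕ}
    (hf : ∀ c ∈ cs, dualNorm (f c) ≤ 2 ^ b) (hS : ∀ c ∈ cs, ∀ c' ∈ cs, dualNorm (S c c') ≤ 2 ^ b)
    (l : ℕ) : ∀ c ∈ cs, dualNorm (horner cs f S l c) ≤ 2 ^ ((l + 1) * (b + cs.length)) := by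
  induction l with
  | zero =>
    intro c hc
    exact (hf c hc).trans (Nat.pow_le_pow_right (by norm_num) (by omega))
  | succ l ih =>
    intro c hc
    rw [horner, dualNorm_add]
    have h1 := dualNorm_sum_le (cs.map fun c' => S c c' * horner cs f S l c')
      (2 ^ b * 2 ^ ((l + 1) * (b + cs.length))) fun x hx => by
        obtain ⟨c', hc', rfl⟩ := List.mem_map.1 hx
        exact (dualNorm_mul_le _ _).trans (Nat.mul_le_mul (hS c hc c' hc') (ih c' hc'))
    rw [List.length_map] at h1
    have h2 := hf c hc
    have h3 : cs.length + 1 ≤ 2 ^ cs.length := Nat.lt_two_pow_self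
    have h4 := Nat.one_le_two_pow (n := (l + 1) * (b + cs.length))
    calc _ ≤ 2 ^ b * 2 ^ ((l + 1) * (b + cs.length)) +
          cs.length * (2 ^ b * 2 ^ ((l + 1) * (b + cs.length))) := by nlinarith
      _ = (cs.length + 1) * (2 ^ b * 2 ^ ((l + 1) * (b + cs.length))) := by ring
      _ ≤ 2 ^ cs.length * (2 ^ b * 2 ^ ((l + 1) * (b + cs.length))) := by gcongr
      _ = _ := by rw [← pow_add, ← pow_add]; congr 1; ring

/-- Unfolding the recursion would take exponential time, so a table of all values on `cs` is updated
`L a` times. The last step is taken at `c a` alone, which therefore need not lie in `cs a`; hence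
the index `L a + 1`. -/
theorem PolyTime.horner [Inhabited ι] {cs : α → List ι} {f : α → ι → Dual} {S : α → ι → ι → Dual}
    {L : α → ℕ} {c : α → ι} (hcs : PolyTime cs) (hf : PolyTime fun x : α × ι => f x.1 x.2)
    (hS : PolyTime fun x : α × ι × ι => S x.1 x.2.1 x.2.2) (hL : PolyTime L) (hL' : PolyBdd L)
    (hc : PolyTime c) : PolyTime fun a => horner (cs a) (f a) (S a) (L a + 1) (c a) := by
  have hstep : PolyTime fun x : (α × List (ι × Dual)) × ι => (x.2, f x.1.1 x.2 +
      (x.1.2.map fun y => S x.1.1 x.2 y.1 * y.2).sum) := by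
    have h1 : PolyTime fun x : (α × List (ι × Dual)) × ι => f x.1.1 x.2 :=
      hf.comp (f := fun x : (α × List (ι × Dual)) × ι => (x.1.1, x.2)) (by fun_prop)
    have h2 : PolyTime fun x : ((α × List (ι × Dual)) × ι) × (ι × Dual) =>
        S x.1.1.1 x.1.2 x.2.1 :=
      hS.comp (f := fun x : ((α × List (ι × Dual)) × ι) × (ι × Dual) => (x.1.1.1, x.1.2, x.2.1))
        (by fun_prop)
    have h3 : PolyTime fun x : (α × List (ι × Dual)) × ι =>
        x.1.2.map fun y => S x.1.1 x.2 y.1 * y.2 :=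
      PolyTime.map (by fun_prop) (h2.dual_mul (by fun_prop))
    exact .pair (by fun_prop) (h1.dual_add h3.dual_sum)
  have htab : ∀ a j, (fun t : List (ι × Dual) => (cs a).map fun c =>
      (c, f a c + (t.map fun y => S a c y.1 * y.2).sum))^[j] ((cs a).map fun c => (c, f a c)) =
      (cs a).map fun c => (c, StackProgram.horner (cs a) (f a) (S a) j c) := by
    intro a j
    induction j with
    | zero => rfl
    | succ j ih =>
      rw [Function.iterate_succ_apply', ih]
      refine List.map_congr_left fun c _ => ?_
      rw [StackProgram.horner, List.map_map]
      rfl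
  obtain ⟨p, hp⟩ := hf.size_le
  obtain ⟨q, hq⟩ := hS.size_le
  let b : α → ℕ := fun a => p.eval (size a + size (cs a) + 1) +
    q.eval (size a + (size (cs a) + size (cs a) + 1) + 1)
  have hb : PolyBdd b := by
    refine PolyBdd.add ?_ ?_
    · exact PolyBdd.comp (n := fun x : α × List ι => p.eval (size x)) (polyBdd_eval p)
        (f := fun a => (a, cs a)) (PolyTime.size_le (by fun_prop)) |>.mono fun a => by rw [size_pair]
    · exact PolyBdd.comp (n := fun x : α × List ι × List ι => q.eval (size x)) (polyBdd_eval q)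
        (f := fun a => (a, cs a, cs a)) (PolyTime.size_le (by fun_prop)) |>.mono fun a => by
          rw [size_pair, size_pair]
  have hfb : ∀ a, ∀ c ∈ cs a, dualNorm (f a c) ≤ 2 ^ b a := fun a c hc => by
    refine (dualNorm_le _).trans (Nat.pow_le_pow_right (by norm_num) ?_)
    have h := hp (a, c)
    have h1 := size_lt_of_mem hc
    refine (h.trans (eval_le_eval p ?_)).trans (Nat.le_add_right _ _)
    rw [size_pair]; omega
  have hSb : ∀ a, ∀ c ∈ cs a, ∀ c' ∈ cs a, dualNorm (S a c c') ≤ 2 ^ b a := fun a c hc c' hc' => by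
    refine (dualNorm_le _).trans (Nat.pow_le_pow_right (by norm_num) ?_)
    have h := hq (a, c, c')
    have h1 := size_lt_of_mem hc
    have h2 := size_lt_of_mem hc'
    refine (h.trans (eval_le_eval q ?_)).trans (Nat.le_add_left _ _)
    rw [size_pair, size_pair]; omega
  let k : α → ℕ := fun a => 8 * ((L a + 1) * (b a + (cs a).length)) + 11
  have hk : PolyBdd k := ((PolyBdd.const 8).mul ((hL'.add (.const 1)).mul
    (hb.add hcs.polyBdd_length))).add (.const 11)
  have hiter := PolyTime.iterate (g := fun a t => (cs a).map fun c =>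
      (c, f a c + (t.map fun y => S a c y.1 * y.2).sum)) (i := fun a => (cs a).map fun c => (c, f a c))
      hL (.map hcs (by fun_prop))
      (.map (l := fun x : α × List (ι × Dual) => cs x.1) (by fun_prop) hstep) hL'
      (m := fun a => (cs a).length * ((size (cs a) + k a + 1) + 1) + 1)
      ((hcs.polyBdd_length.mul (((hcs.size_le.add hk).add (.const 1)).add (.const 1))).add (.const 1))
      fun a j hj => by
        rw [htab]
        have := size_le_of_forall_mem (m := size (cs a) + k a + 1) (l := (cs a).map fun c =>
          (c, StackProgram.horner (cs a) (f a) (S a) j c)) fun x hx => by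
            obtain ⟨c, hc, rfl⟩ := List.mem_map.1 hx
            have h1 := size_lt_of_mem hc
            have h2 := size_dual_le (dualNorm_horner_le (hfb a) (hSb a) j c hc)
            have h3 : (j + 1) * (b a + (cs a).length) ≤ (L a + 1) * (b a + (cs a).length) :=
              Nat.mul_le_mul_right _ (by omega)
            rw [size_pair]
            simp only [k]
            omega
        simpa using this
  have hfin := hstep.comp (f := fun a => ((a, _), c a)) ((PolyTime.id'.pair hiter).pair hc)
  refine hfin.snd.congr fun a => ?_
  simp only
  rw [htab, StackProgram.horner, List.map_map]
  rfl

end Dual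

/-! ### Translation between words over the tape alphabet and trees -/

open Spanner (encodeNats)

theorem encodePosNum_eq_bits (p : PosNum) : Computability.encodePosNum p = (p : ℕ).bits := by
  induction p with
  | one => simp [Computability.encodePosNum]
  | bit0 p ih =>
    rw [Computability.encodePosNum, ih, PosNum.cast_bit0, ← two_mul, Nat.bit0_bits]
    exact p.cast_pos.ne'
  | bit1 p ih =>
    rw [Computability.encodePosNum, ih, PosNum.cast_bit1, ← two_mul, Nat.bit1_bits]

theorem encodeNat_eq_bits (n : ℕ) : Computability.encodeNat n = n.bits := by
  rw [Computability.encodeNat]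
  conv_rhs => rw [← Num.to_of_nat n]
  cases (n : Num) with
  | zero => rfl
  | pos p => exact encodePosNum_eq_bits p

theorem encodeNats_append (L L' : List ℕ) :
    encodeNats (L ++ L') = encodeNats L ++ encodeNats L' := by
  simp [encodeNats]

theorem encodeNats_cons (n : ℕ) (L : List ℕ) :
    encodeNats (n :: L) = n.bits.map Γ'.bit ++ .comma :: encodeNats L := by
  simp [encodeNats, encodeNat_eq_bits]

theorem bra_notMem_encodeNats (L : List ℕ) : Γ'.bra ∉ encodeNats L := by
  induction L with
  | nil => simp [encodeNats]
  | cons n L ih => simp [encodeNats_cons, ih]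

/-- The serialization of a list of truth values without the mark of its end. -/
def serBits (l : List Bool) : List Γ' := l.flatMap fun b => .bit true :: (Enc.enc b).ser

theorem ser_enc_bits (l : List Bool) : (Enc.enc l).ser = serBits l ++ [.bit false] := by
  induction l with
  | nil => rfl
  | cons b l ih =>
    have : Enc.enc (b :: l) = .node (Enc.enc b) (Enc.enc l) := rfl
    rw [this, Tree.ser, ih]
    simp [serBits]

theorem ser_enc_nats_cons (n : ℕ) (L : List ℕ) : (Enc.enc (n :: L)).ser =
    .bit true :: serBits n.bits ++ .bit false :: (Enc.enc L).ser := by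
  have : Enc.enc (n :: L) = .node (Enc.enc n.bits) (Enc.enc L) := rfl
  rw [this, Tree.ser, ser_enc_bits]
  simp

/-- The translation of the input from right to left. -/
def convert : List Γ' → List Γ' → List Γ'
  | [], m => .bit true :: m
  | .bit b :: u, m => convert u (.bit true :: (Enc.enc b).ser ++ m)
  | .comma :: u, m => convert u (.bit false :: .bit true :: m)
  | _ :: u, m => convert u m

theorem convert_bits (l : List Bool) (u m : List Γ') :
    convert ((l.map Γ'.bit).reverse ++ u) m = convert u (serBits l ++ m) := by
  induction l generalizing u with
  | nil => rfl
  | cons b l ih =>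
    rw [List.map_cons, List.reverse_cons, List.append_assoc, ih]
    simp [convert, serBits]

theorem convert_nats (L : List ℕ) (m : List Γ') : convert (encodeNats L).reverse m =
    .bit true :: (L.flatMap fun n => serBits n.bits ++ [.bit false, .bit true]) ++ m := by
  induction L using List.reverseRecOn generalizing m with
  | nil => rfl
  | append_singleton L n ih =>
    rw [encodeNats_append, encodeNats_cons]
    simp only [List.reverse_append, List.reverse_cons, List.append_assoc]
    simp only [encodeNats, List.flatMap_nil, List.reverse_nil, List.nil_append, List.cons_append,
      convert]
    rw [convert_bits, ← encodeNats, ih]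
    simp

/-- Read from the right, a comma between two numbers supplies the leaf that ends the digits of the
left one and the node that opens the list cell of the right one. The cell of the first number is
opened when the input is exhausted. -/
theorem convert_eq_ser (L : List ℕ) (n : ℕ) :
    convert ((n.bits.map Γ'.bit).reverse ++ (encodeNats L).reverse) [.bit false, .bit false] =
      (Enc.enc (L ++ [n])).ser := by
  rw [convert_bits, convert_nats]
  induction L with
  | nil =>
    rw [List.nil_append, ser_enc_nats_cons]
    rfl
  | cons k L ih =>
    rw [show k :: L ++ [n] = k :: (L ++ [n]) from rfl, ser_enc_nats_cons, ← ih]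
    simp

namespace Cmd

variable {m s a c : List Γ'}

/-- The body of the loop that translates the input. -/
def convertBody : Option Γ' → Cmd
  | none => push .main (.bit true)
  | some (.bit true) => seq (push .main (.bit false)) <| seq (push .main (.bit false)) <|
      seq (push .main (.bit true)) (push .main (.bit true))
  | some (.bit false) => seq (push .main (.bit false)) (push .main (.bit true))
  | some .comma => seq (push .main (.bit true)) (push .main (.bit false))
  | _ => skip

theorem exec_convert (u : List Γ') : ∀ m, Exec (loop .aux Option.isSome convertBody)
    (store m s u c) (5 * u.length + 2) (store (convert u m) s [] c) := by
  induction u with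
  | nil => exact fun m => exec_aux_stop_nil rfl exec_push_main
  | cons x u ih =>
    intro m
    rw [List.length_cons]
    rcases x with _ | b | _ | _ | _
    · exact (exec_aux_again rfl exec_skip (ih m)).mono (by omega)
    · cases b
      · exact (exec_aux_again rfl (exec_push_main.comp exec_push_main) (ih _)).mono (by omega)
      · exact (exec_aux_again rfl (exec_push_main.comp (exec_push_main.comp
          (exec_push_main.comp exec_push_main))) (ih _)).mono (by omega)
    · exact (exec_aux_again rfl exec_skip (ih m)).mono (by omega)
    · exact (exec_aux_again rfl exec_skip (ih m)).mono (by omega)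
    · exact (exec_aux_again rfl (exec_push_main.comp exec_push_main) (ih _)).mono (by omega)

/-- Translate the input word to a tree. -/
def inputCmd : Cmd :=
  -- The last comma has no number to its right. It is replaced by two leaves, which end the outer
  -- list and the digits of the last number.
  seq (drain .main [.aux]) <| seq (pop .aux fun _ => skip) <| seq (push .main (.bit false)) <|
    seq (push .main (.bit false)) (loop .aux Option.isSome convertBody)

theorem exec_inputCmd {L : List ℕ} (hL : L ≠ []) :
    Exec inputCmd (store (encodeNats L) [] [] []) (8 * (encodeNats L).length + 8)
      (store (Enc.enc L).ser [] [] []) := by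
  obtain ⟨L, n, rfl⟩ : ∃ L' n, L = L' ++ [n] :=
    ⟨_, _, (List.dropLast_append_getLast hL).symm⟩
  have h1 := exec_main_to_aux (s := []) (a := []) (c := []) (bra_notMem_encodeNats (L ++ [n]))
  have e : (encodeNats (L ++ [n])).reverse ++ [] =
      .comma :: ((n.bits.map Γ'.bit).reverse ++ (encodeNats L).reverse) := by
    rw [encodeNats_append, encodeNats_cons]
    simp [encodeNats]
  rw [e] at h1
  have h2 := exec_convert (s := []) (c := [])
    ((n.bits.map Γ'.bit).reverse ++ (encodeNats L).reverse) [.bit false, .bit false]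
  rw [convert_eq_ser] at h2
  have h3 : Exec inputCmd (store (encodeNats (L ++ [n])) [] [] []) _
      (store (Enc.enc (L ++ [n])).ser [] [] []) :=
    h1.comp <| (exec_pop_aux exec_skip).comp <| exec_push_main.comp <| exec_push_main.comp h2
  refine h3.mono ?_
  have e' := congrArg List.length e
  simp only [List.length_append, List.length_reverse, List.length_cons, List.length_nil] at e' ⊢
  omega

/-- Write the digits of the current number on the auxiliary stack. -/
def outputInner : Cmd :=
  loop .main (fun o => o == some (.bit true)) fun o =>
    match o with
    | some (.bit true) => pop .main fun o =>
      match o with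
      | some (.bit true) => seq (pop .main fun _ => skip) <| seq (pop .main fun _ => skip) <|
          push .aux (.bit true)
      | _ => push .aux (.bit false)
    | _ => push .aux .comma

theorem exec_outputInner (l : List Bool) : ∀ a, Exec outputInner
    (store (serBits l ++ .bit false :: m) s a c) (8 * l.length + 2)
    (store m s (.comma :: (l.map Γ'.bit).reverse ++ a) c) := by
  induction l with
  | nil => exact fun a => exec_main_stop (by decide) exec_push_aux
  | cons b l ih =>
    intro a
    have h := ih (.bit b :: a)
    have e : .comma :: ((b :: l).map Γ'.bit).reverse ++ a =
      .comma :: (l.map Γ'.bit).reverse ++ .bit b :: a := by simp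
    rw [e, List.length_cons]
    cases b
    · exact (exec_main_again (by decide) (exec_pop_main exec_push_aux) h).mono (by omega)
    · have := exec_main_again (x := .bit true) (m := .bit true :: .bit false :: .bit false ::
        (serBits l ++ .bit false :: m)) (ag := fun o => o == some (.bit true)) (body := fun o =>
        match o with
        | some (.bit true) => pop .main fun o =>
          match o with
          | some (.bit true) => seq (pop .main fun _ => skip) <| seq (pop .main fun _ => skip) <|
              push .aux (.bit true)
          | _ => push .aux (.bit false)
        | _ => push .aux .comma) (by decide)
        (exec_pop_main ((exec_pop_main (body := fun _ => skip) exec_skip).comp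
          ((exec_pop_main (body := fun _ => skip) exec_skip).comp exec_push_aux))) h
      exact this.mono (by omega)

/-- Translate a tree to the output word. -/
def outputCmd : Cmd :=
  seq (loop .main (fun o => o == some (.bit true)) fun o =>
    match o with
    | some (.bit true) => outputInner
    | _ => skip) (drain .aux [.main])

theorem length_serBits (l : List Bool) : l.length ≤ (serBits l).length := by
  induction l with
  | nil => exact le_rfl
  | cons b l ih =>
    simp only [serBits, List.flatMap_cons, List.length_append, List.length_cons] at *
    omega

theorem exec_outputLoop (L : List ℕ) : ∀ a,
    Exec (loop .main (fun o => o == some (.bit true)) fun o =>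
      match o with
      | some (.bit true) => outputInner
      | _ => skip) (store (Enc.enc L).ser s a c) (8 * (Enc.enc L).ser.length + 2)
      (store [] s ((encodeNats L).reverse ++ a) c) := by
  induction L with
  | nil => exact fun a => (exec_main_stop (by decide) exec_skip).mono (by omega)
  | cons n L ih =>
    intro a
    rw [ser_enc_nats_cons]
    have h1 := exec_outputInner (m := (Enc.enc L).ser) (s := s) (c := c) n.bits a
    have h2 := ih (.comma :: (n.bits.map Γ'.bit).reverse ++ a)
    have e : (encodeNats (n :: L)).reverse ++ a =
        (encodeNats L).reverse ++ (.comma :: (n.bits.map Γ'.bit).reverse ++ a) := by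
      simp [encodeNats_cons]
    rw [e]
    have h3 := exec_main_again (x := .bit true) (ag := fun o => o == some (.bit true))
      (body := fun o =>
      match o with
      | some (.bit true) => outputInner
      | _ => skip) (by decide) h1 h2
    refine Exec.mono h3 ?_
    have := length_serBits n.bits
    simp only [List.length_append, List.length_cons]
    omega

theorem exec_outputCmd (L : List ℕ) : Exec outputCmd (store (Enc.enc L).ser [] [] [])
    (8 * size L + 3 * (encodeNats L).length + 4) (store (encodeNats L) [] [] []) := by
  have h1 := exec_outputLoop (s := []) (c := []) L []
  have h2 := exec_aux_to_main (m := []) (s := []) (c := []) (w := (encodeNats L).reverse)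
    (by simpa using bra_notMem_encodeNats L)
  simp only [List.append_nil, List.reverse_reverse, List.length_reverse] at h1 h2
  have h3 : Exec outputCmd _ _ _ := h1.comp h2
  exact h3.mono (by rw [size]; omega)

end Cmd

theorem length_encodeNats_le (L : List ℕ) : (encodeNats L).length ≤ size L := by
  induction L with
  | nil => exact Nat.zero_le _
  | cons n L ih =>
    rw [encodeNats_cons, size_cons, ← size_bits]
    have := length_lt_size n.bits
    simp only [List.length_append, List.length_cons, List.length_map]
    omega

theorem size_le_length_encodeNats (L : List ℕ) : size L ≤ 8 * (encodeNats L).length + 1 := by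
  induction L with
  | nil => exact le_rfl
  | cons n L ih =>
    rw [encodeNats_cons, size_cons]
    have := size_nat_le (lt_two_pow_length_bits n)
    simp only [List.length_append, List.length_cons, List.length_map]
    omega

/-- A function between types whose elements are written as lists of numbers can be computed by a
Turing machine in polynomial time if a command does so. -/
theorem PolyTime.nonempty_polyTime {α β : Type} [Enc α] {f : α → β} {g : α → List ℕ}
    {h : β → List ℕ} (hα : ∀ a, Enc.enc a = Enc.enc (g a)) (hg : ∀ a, g a ≠ [])
    (hf : PolyTime fun a => h (f a)) :
    Nonempty (Turing.TM2ComputableInPolyTime (fun a => encodeNats (g a))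
      (fun b => encodeNats (h b)) f) := by
  obtain ⟨q, hq⟩ := hf.size_le
  obtain ⟨c, p, hp⟩ := hf
  refine Cmd.nonempty_polyTime (.seq Cmd.inputCmd (.seq c Cmd.outputCmd))
    ((8 * .X + 8) + (p.comp (8 * .X + 1) + (11 * q.comp (8 * .X + 1) + 4))) fun a => ?_
  have hs : size a ≤ 8 * (encodeNats (g a)).length + 1 := by
    rw [size, hα]
    exact size_le_length_encodeNats (g a)
  have h2 := hp a []
  rw [hα] at h2
  refine ((Cmd.exec_inputCmd (hg a)).comp (h2.comp (Cmd.exec_outputCmd _))).mono ?_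
  have h3 := length_encodeNats_le (h (f a))
  have h4 : size (h (f a)) ≤ _ := hq a
  have h5 := eval_le_eval q hs
  have h6 := eval_le_eval p hs
  simp only [Polynomial.eval_add, Polynomial.eval_mul, Polynomial.eval_ofNat, Polynomial.eval_X,
    Polynomial.eval_comp, Polynomial.eval_one]
  omega

end StackProgram

/-! ### Ordered ref-words are determined by document and tuple -/

namespace Spanner

namespace RefWord

variable {k : ℕ} {lt : VarOp → VarOp → Prop}

@[simp] theorem doc_nil : doc ([] : RefWord k) = [] := rfl

@[simp] theorem doc_letter (a : Fin k) (r : RefWord k) : doc (.letter a :: r) = a :: doc r := rfl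

@[simp] theorem doc_op (o : VarOp) (r : RefWord k) : doc (.op o :: r) = doc r := rfl

theorem pos_letter (a : Fin k) (r : RefWord k) (o : VarOp) :
    pos (.letter a :: r) o = pos r o + 1 := by
  simp [pos]

theorem pos_op_self (r : RefWord k) (o : VarOp) : pos (.op o :: r) o = 1 := by
  simp [pos]

theorem pos_op_of_ne (r : RefWord k) {o o' : VarOp} (h : o' ≠ o) :
    pos (.op o' :: r) o = pos r o := by
  simp [pos, h]

theorem one_le_pos (r : RefWord k) (o : VarOp) : 1 ≤ pos r o := Nat.le_add_left _ _

/-- Position one means that no letter precedes `o'`. So `o` and `o'` lie in the same block of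
adjacent operations, which increases. -/
theorem lt_of_pos_eq_one [IsTrans VarOp lt] {o' : VarOp} (r : RefWord k) : ∀ o : VarOp,
    OrderCondition lt (.op o :: r) → Sym.op o' ∈ r → pos r o' = 1 → lt o o' := by
  induction r with
  | nil => intro o _ h; simp at h
  | cons x r ih =>
    intro o hc hm hp
    rw [OrderCondition, List.isChain_cons_cons] at hc
    cases x with
    | letter a =>
      rw [pos_letter] at hp
      have := one_le_pos r o'
      omega
    | op o₁ =>
      have h1 : lt o o₁ := hc.1
      by_cases h : o₁ = o'
      · exact h ▸ h1
      · rw [pos_op_of_ne _ h] at hp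
        have hm' : Sym.op o' ∈ r := by
          rcases List.mem_cons.1 hm with h' | h'
          · exact absurd (Sym.op.inj h').symm h
          · exact h'
        exact _root_.trans h1 (ih o₁ hc.2 hm' hp)

/-- The first symbols must agree. A letter cannot face an operation, since that operation would have
position one in one word and a later position in the other. If two different operations faced each
other, each would occur in the other word before any letter, so each would precede the other in the
order. -/
theorem ext_of_pos [IsStrictTotalOrder VarOp lt] (r₁ : RefWord k) : ∀ r₂ : RefWord k,
    OrderCondition lt r₁ → OrderCondition lt r₂ → (∀ o, r₁.count (.op o) ≤ 1) →
    (∀ o, r₂.count (.op o) ≤ 1) → (∀ o, Sym.op o ∈ r₁ ↔ Sym.op o ∈ r₂) → doc r₁ = doc r₂ →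
    (∀ o, Sym.op o ∈ r₁ → pos r₁ o = pos r₂ o) → r₁ = r₂ := by
  induction r₁ with
  | nil =>
    intro r₂ _ _ _ _ hm hd _
    cases r₂ with
    | nil => rfl
    | cons x r₂ =>
      cases x with
      | letter a => simp at hd
      | op o => simpa using hm o
  | cons x r₁ ih =>
    intro r₂ hc₁ hc₂ hn₁ hn₂ hm hd hp
    cases r₂ with
    | nil =>
      cases x with
      | letter a => simp at hd
      | op o => simpa using hm o
    | cons y r₂ =>
      have tail_chain : ∀ {z : Sym k} {r : RefWord k}, OrderCondition lt (z :: r) →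
          OrderCondition lt r := fun h => List.IsChain.tail h
      cases x with
      | letter a =>
        cases y with
        | letter b =>
          rw [doc_letter, doc_letter, List.cons.injEq] at hd
          rw [hd.1, ih r₂ (tail_chain hc₁) (tail_chain hc₂) (by simpa using hn₁)
            (by simpa using hn₂) (by simpa using hm) hd.2 fun o ho => ?_]
          have := hp o (List.mem_cons_of_mem _ ho)
          rw [pos_letter, pos_letter] at this
          omega
        | op o =>
          have ho : Sym.op o ∈ Sym.letter a :: r₁ := (hm o).2 (by simp)
          have h1 := hp o ho
          rw [pos_letter, pos_op_self] at h1
          have := one_le_pos r₁ o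
          omega
      | op o =>
        have ho : Sym.op o ∈ Sym.op o :: r₁ := by simp
        have h1 := hp o ho
        rw [pos_op_self] at h1
        cases y with
        | letter b =>
          rw [pos_letter] at h1
          have := one_le_pos r₂ o
          omega
        | op o' =>
          by_cases h : o = o'
          · subst h
            have n₁ : Sym.op o ∉ r₁ := fun h => by
              have h2 := hn₁ o
              rw [List.count_cons_self] at h2
              have := List.count_pos_iff.2 h
              omega
            have n₂ : Sym.op o ∉ r₂ := fun h => by
              have h2 := hn₂ o
              rw [List.count_cons_self] at h2
              have := List.count_pos_iff.2 h
              omega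
            rw [ih r₂ (tail_chain hc₁) (tail_chain hc₂)
              (fun o' => (List.count_le_count_cons ..).trans (hn₁ o'))
              (fun o' => (List.count_le_count_cons ..).trans (hn₂ o')) (fun o' => ?_)
              (by simpa using hd) fun o' ho' => ?_]
            · by_cases h : o' = o
              · subst h; simp [n₁, n₂]
              · simpa [h] using hm o'
            · have hne : o ≠ o' := fun h => n₁ (h ▸ ho')
              have := hp o' (List.mem_cons_of_mem _ ho')
              rwa [pos_op_of_ne _ hne, pos_op_of_ne _ hne] at this
          · exfalso
            have h2 : Sym.op o ∈ r₂ := by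
              have := (hm o).1 ho
              simpa [h] using this
            have h3 : Sym.op o' ∈ r₁ := by
              have := (hm o').2 (by simp)
              simpa [Ne.symm h] using this
            have h4 := hp o' (List.mem_cons_of_mem _ h3)
            rw [pos_op_self, pos_op_of_ne _ h] at h4
            rw [pos_op_of_ne _ (Ne.symm h)] at h1
            have h5 := lt_of_pos_eq_one r₁ o hc₁ h3 h4
            have h6 := lt_of_pos_eq_one r₂ o' hc₂ h2 h1.symm
            exact asymm h5 h6

/-- The test whether a symbol is not an operation of a variable outside `V`. -/
def keep (V : Finset ℕ) : Sym k → Bool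
  | .letter _ => true
  | .op o => decide (o.var ∈ V)

/-- The restriction of a ref-word to the variables in `V`. -/
def restrict (V : Finset ℕ) (r : RefWord k) : RefWord k := r.filter (keep V)

variable (V : Finset ℕ)

theorem doc_restrict (r : RefWord k) : doc (restrict V r) = doc r := by
  induction r with
  | nil => rfl
  | cons x r ih =>
    rw [restrict] at *
    cases x with
    | letter a =>
      rw [List.filter_cons_of_pos rfl]
      simp [ih]
    | op o =>
      rw [List.filter_cons]
      split <;> simp [ih]

theorem op_mem_restrict (r : RefWord k) (o : VarOp) :
    Sym.op o ∈ restrict V r ↔ Sym.op o ∈ r ∧ o.var ∈ V := by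
  simp [restrict, List.mem_filter, keep]

theorem count_restrict_le (r : RefWord k) (x : Sym k) : (restrict V r).count x ≤ r.count x :=
  List.Sublist.count_le x List.filter_sublist

theorem pos_restrict (r : RefWord k) {o : VarOp} (ho : o.var ∈ V) :
    pos (restrict V r) o = pos r o := by
  induction r with
  | nil => rfl
  | cons x r ih =>
    rw [restrict] at *
    cases x with
    | letter a =>
      rw [List.filter_cons_of_pos rfl, pos_letter, pos_letter, ih]
    | op o' =>
      rw [List.filter_cons]
      by_cases h : o' = o
      · subst h
        simp [keep, ho, pos_op_self]
      · rw [pos_op_of_ne _ h]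
        split
        · rw [pos_op_of_ne _ h, ih]
        · exact ih

/-- Erasing an operation between two others keeps them in order by transitivity, and next to a
letter nothing is required. -/
theorem orderCondition_restrict [IsTrans VarOp lt] (r : RefWord k) (h : OrderCondition lt r) :
    OrderCondition lt (restrict V r) := by
  have key : ∀ (r : RefWord k) (x : Sym k), OrderCondition lt (x :: r) →
      OrderCondition lt (x :: restrict V r) := by
    intro r
    induction r with
    | nil => exact fun x h => h
    | cons y r ih =>
      intro x h
      have h' := List.isChain_cons_cons.1 h
      rw [restrict, List.filter_cons]
      split
      · exact List.isChain_cons_cons.2 ⟨h'.1, ih y h'.2⟩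
      · rename_i hy
        refine ih x ?_
        cases y with
        | letter a => exact absurd rfl hy
        | op o =>
          cases r with
          | nil => exact List.isChain_singleton _
          | cons z r =>
            have h'' := List.isChain_cons_cons.1 h'.2
            refine List.isChain_cons_cons.2 ⟨?_, h''.2⟩
            cases x with
            | letter a => trivial
            | op o₁ =>
              cases z with
              | letter a => trivial
              | op o₂ => exact show lt o₁ o₂ from IsTrans.trans o₁ o o₂ h'.1 h''.1
  cases r with
  | nil => exact h
  | cons x r =>
    rw [restrict, List.filter_cons]
    split
    · exact key r x h
    · have := key r x h
      exact List.IsChain.tail this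

variable {V}

theorem op_mem_iff {r : RefWord k} (h : Valid r) (hV : vars r = (V : Set ℕ)) (o : VarOp) :
    Sym.op o ∈ r ↔ o.var ∈ V := by
  have hf : Factors r o.var ↔ o.var ∈ V := Set.ext_iff.1 hV o.var
  constructor
  · intro ho
    refine hf.1 (h o.var ?_).2.2
    cases o with
    | opn x => exact .inl ho
    | cls x => exact .inr ho
  · intro ho
    obtain ⟨a, b, c, rfl⟩ := hf.2 ho
    cases o <;> simp [VarOp.var]

theorem count_op_le {r : RefWord k} (h : Valid r) (o : VarOp) : r.count (.op o) ≤ 1 := by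
  by_cases ho : Sym.op o ∈ r
  · cases o with
    | opn x => exact (h x (.inl ho)).1.le
    | cls x => exact (h x (.inr ho)).2.1.le
  · rw [List.count_eq_zero_of_not_mem ho]; omega

/-- This makes the passage from ref-words to tuples injective on a fixed document, so that the sum
over tuples can be taken over runs of the spanner. -/
theorem ext_of_tup [IsStrictTotalOrder VarOp lt] {r₁ r₂ : RefWord k} (hv₁ : Valid r₁)
    (hv₂ : Valid r₂) (hV₁ : vars r₁ = (V : Set ℕ)) (hV₂ : vars r₂ = (V : Set ℕ))
    (h₁ : OrderCondition lt r₁) (h₂ : OrderCondition lt r₂) (hd : doc r₁ = doc r₂)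
    (ht : tup V r₁ = tup V r₂) : r₁ = r₂ := by
  refine ext_of_pos r₁ r₂ h₁ h₂ (count_op_le hv₁) (count_op_le hv₂)
    (fun o => by rw [op_mem_iff hv₁ hV₁, op_mem_iff hv₂ hV₂]) hd fun o ho => ?_
  have hx := congrFun ht ⟨o.var, (op_mem_iff hv₁ hV₁ o).1 ho⟩
  cases o with
  | opn x => exact congrArg Prod.fst hx
  | cls x => exact congrArg Prod.snd hx

/-- Erasing operations moves no letter, so it projects the tuple and keeps the document; and the
erased word still satisfies the order condition, so no other ordered word encodes the projected
tuple. The weight automaton can thus follow the run of the spanner symbol by symbol. -/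
theorem tup_restrict_iff [IsStrictTotalOrder VarOp lt] {V U : Finset ℕ} (hU : U ⊆ V)
    {r r' : RefWord k} (hv : Valid r) (hv' : Valid r') (hV : vars r = (V : Set ℕ))
    (hV' : vars r' = (U : Set ℕ)) (h : OrderCondition lt r) (h' : OrderCondition lt r') :
    (doc r' = doc r ∧ tup U r' = Finset.restrict₂ (π := fun _ => Span) hU (tup V r)) ↔
      r' = restrict U r := by
  constructor
  · rintro ⟨hd, ht⟩
    refine ext_of_pos r' _ h' (orderCondition_restrict U r h) (count_op_le hv')
      (fun o => (count_restrict_le U r _).trans (count_op_le hv o))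
      (fun o => ?_) (by rw [doc_restrict, hd]) fun o ho => ?_
    · rw [op_mem_iff hv' hV', op_mem_restrict, op_mem_iff hv hV]
      exact ⟨fun ho => ⟨hU ho, ho⟩, fun ho => ho.2⟩
    · have hoU := (op_mem_iff hv' hV' o).1 ho
      rw [pos_restrict U r hoU]
      have hx := congrFun ht ⟨o.var, hoU⟩
      cases o with
      | opn x => exact congrArg Prod.fst hx
      | cls x => exact congrArg Prod.snd hx
  · rintro rfl
    refine ⟨doc_restrict U r, ?_⟩
    funext x
    exact Prod.ext (pos_restrict U r x.2) (pos_restrict U r x.2)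

end RefWord

end Spanner

/-! ### Matrix series as sums over words -/

open StackProgram (horner)

section Words

open Classical in
/-- The words of length at most `l` over the alphabet `Λ`. -/
noncomputable def wordsLE {σ : Type} (Λ : Finset σ) : ℕ → Finset (List σ)
  | 0 => {[]}
  | l + 1 => insert [] ((Λ ×ˢ wordsLE Λ l).image fun x => x.1 :: x.2)

theorem mem_wordsLE {σ : Type} {Λ : Finset σ} {l : ℕ} : ∀ {w : List σ},
    w ∈ wordsLE Λ l ↔ w.length ≤ l ∧ ∀ x ∈ w, x ∈ Λ := by
  classical
  induction l with
  | zero =>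
    intro w
    simp only [wordsLE, Finset.mem_singleton]
    constructor
    · rintro rfl; simp
    · intro h; exact List.eq_nil_of_length_eq_zero (by omega)
  | succ l ih =>
    intro w
    simp only [wordsLE, Finset.mem_insert, Finset.mem_image, Finset.mem_product]
    cases w with
    | nil => simp
    | cons x w =>
      constructor
      · rintro (h | ⟨⟨y, v⟩, ⟨hy, hv⟩, h⟩)
        · cases h
        · cases h
          have := ih.1 hv
          simpa [hy] using this
      · rintro ⟨h1, h2⟩
        exact .inr ⟨(x, w), ⟨h2 x (by simp), ih.2 ⟨by simpa using h1,
          fun y hy => h2 y (List.mem_cons_of_mem _ hy)⟩⟩, rfl⟩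

theorem sum_wordsLE_succ {σ R : Type} [AddCommMonoid R] (Λ : Finset σ) (l : ℕ) (f : List σ → R) :
    ∑ w ∈ wordsLE Λ (l + 1), f w = f [] + ∑ x ∈ Λ, ∑ w ∈ wordsLE Λ l, f (x :: w) := by
  classical
  rw [wordsLE, Finset.sum_insert (by simp), Finset.sum_image, Finset.sum_product]
  rintro ⟨x, w⟩ _ ⟨y, v⟩ _ h
  simpa using h

/-- The product of the matrices `T s` along a word, applied to the vector `f`. -/
def wordVal {σ C R : Type} [Semiring R] [Fintype C] (T : σ → C → C → R) (f : C → R) :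
    List σ → C → R
  | [], c => f c
  | s :: w, c => ∑ c', T s c c' * wordVal T f w c'

/-- Powers of a sum of matrices expand into the products along all words. The hypothesis `hcs`
expresses that `cs` lists every index once. -/
theorem horner_eq_sum_wordVal {σ C R : Type} [CommSemiring R] [Fintype C] (Λ : Finset σ)
    (T : σ → C → C → R) (f : C → R) (cs : List C) (hcs : ∀ g : C → R, (cs.map g).sum = ∑ c, g c)
    (l : ℕ) (c : C) :
    horner cs f (fun c c' => ∑ s ∈ Λ, T s c c') l c = ∑ w ∈ wordsLE Λ l, wordVal T f w c := by
  induction l generalizing c with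
  | zero => simp [horner, wordsLE, wordVal]
  | succ l ih =>
    rw [horner, hcs, sum_wordsLE_succ]
    congr 1
    simp only [wordVal, ih]
    calc _ = ∑ c', ∑ s ∈ Λ, T s c c' * ∑ w ∈ wordsLE Λ l, wordVal T f w c' := by
          simp only [Finset.sum_mul]
      _ = ∑ s ∈ Λ, ∑ c', ∑ w ∈ wordsLE Λ l, T s c c' * wordVal T f w c' := by
          rw [Finset.sum_comm]
          simp only [Finset.mul_sum]
      _ = _ := Finset.sum_congr rfl fun s _ => Finset.sum_comm

/-- It transfers the series from typed indices to the plain numbers on which the programs operate.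
-/
theorem horner_map {ι κ R : Type} [Semiring R] (φ : κ → ι) (cs : List κ) {f : ι → R}
    {S : ι → ι → R} {f' : κ → R} {S' : κ → κ → R} (hf : ∀ c ∈ cs, f (φ c) = f' c)
    (hS : ∀ c ∈ cs, ∀ c' ∈ cs, S (φ c) (φ c') = S' c c') (l : ℕ) :
    ∀ c ∈ cs, horner (cs.map φ) f S l (φ c) = horner cs f' S' l c := by
  induction l with
  | zero => exact hf
  | succ l ih =>
    intro c hc
    rw [horner, horner, hf c hc, List.map_map]
    congr 2
    refine List.map_congr_left fun c' hc' => ?_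
    rw [Function.comp_apply, hS c hc c' hc', ih c' hc']

theorem sum_map_finRange {R : Type} [AddCommMonoid R] (n : ℕ) (g : Fin n → R) :
    ((List.finRange n).map g).sum = ∑ i, g i := by
  rw [← List.ofFn_eq_map, List.sum_ofFn]

theorem sum_map_flatMap {ι κ R : Type} [AddCommMonoid R] (l : List ι) (f : ι → List κ) (g : κ → R) :
    ((l.flatMap f).map g).sum = (l.map fun i => ((f i).map g).sum).sum := by
  induction l with
  | nil => rfl
  | cons i l ih => simp [ih]

end Words

/-! ### Length of runs, and the product of spanner, document and matrices -/

namespace Spanner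

namespace RefWord

theorem length_le_of_valid {k : ℕ} {r : RefWord k} {V : Finset ℕ} (h : Valid r)
    (hV : vars r = (V : Set ℕ)) : r.length ≤ (doc r).length + 2 * V.card := by
  classical
  let op? : Sym k → Option VarOp := fun x => match x with
    | .letter _ => none
    | .op o => some o
  have h1 : ∀ r : RefWord k, r.length = (doc r).length + (r.filterMap op?).length := by
    intro r
    induction r with
    | nil => rfl
    | cons x r ih =>
      cases x with
      | letter a => simp [op?] at *; omega
      | op o => simp [op?] at *; omega
  have hc : ∀ (r : RefWord k) o, (r.filterMap op?).count o = r.count (.op o) := by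
    intro r o
    induction r with
    | nil => rfl
    | cons x r ih =>
      cases x with
      | letter a => simpa [op?] using ih
      | op o' =>
        rw [List.filterMap_cons_some (f := op?) (b := o') rfl, List.count_cons, List.count_cons, ih]
        simp
  have hn : (r.filterMap op?).Nodup := by
    rw [List.nodup_iff_count_le_one]
    intro o
    rw [hc]
    exact count_op_le h o
  have hs : (r.filterMap op?).toFinset ⊆ V.image .opn ∪ V.image .cls := by
    intro o ho
    rw [List.mem_toFinset] at ho
    have h2 : Sym.op o ∈ r := by
      rw [← List.count_pos_iff, ← hc]
      exact List.count_pos_iff.2 ho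
    have := (op_mem_iff h hV o).1 h2
    cases o <;> simpa [VarOp.var] using this
  have h3 := Finset.card_le_card hs
  rw [List.toFinset_card_of_nodup hn] at h3
  have h4 := (Finset.card_union_le (V.image VarOp.opn) (V.image VarOp.cls))
  have h5 := Finset.card_image_le (s := V) (f := VarOp.opn)
  have h6 := Finset.card_image_le (s := V) (f := VarOp.cls)
  rw [h1]
  omega

end RefWord

namespace VsetAutomaton

variable {K : Type} [CommSemiring K] {k : ℕ} (A : VsetAutomaton K k)

/-- The rank counts the states reachable by a nonempty ε-path. Along an ε-transition from `p` to `q`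
it drops, since `q` is reachable from `p` but not from itself. -/
theorem exists_rank (h : A.NoEpsCycle) : ∃ rk : Fin A.n → ℕ, (∀ q, rk q < A.n) ∧
    ∀ p q, A.trans p none q ≠ 0 → rk q < rk p := by
  classical
  let E : Fin A.n → Fin A.n → Prop := fun p p' => A.trans p none p' ≠ 0
  refine ⟨fun p => (Finset.univ.filter fun q => Relation.TransGen E p q).card, fun q => ?_,
    fun p q hpq => ?_⟩
  · have : (Finset.univ.filter fun q' => Relation.TransGen E q q') ⊂ Finset.univ := by
      refine Finset.filter_ssubset.2 ⟨q, Finset.mem_univ _, h q⟩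
    simpa using Finset.card_lt_card this
  · refine Finset.card_lt_card ⟨fun x hx => ?_, fun hs => ?_⟩
    · simp only [Finset.mem_filter, Finset.mem_univ, true_and] at *
      exact Relation.TransGen.head hpq hx
    · have : q ∈ Finset.univ.filter fun q' => Relation.TransGen E q q' :=
        hs (Finset.mem_filter.2 ⟨Finset.mem_univ _, Relation.TransGen.single (r := E) hpq⟩)
      exact h q (by simpa using this)

variable {A}

/-- Every ε-step lowers the rank, and a step that reads a symbol raises it to at most `A.n - 1`. -/
theorem length_le_of_isPath {rk : Fin A.n → ℕ} (h1 : ∀ q, rk q < A.n)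
    (h2 : ∀ p q, A.trans p none q ≠ 0 → rk q < rk p) (w : List (Option (Sym k) × Fin A.n)) :
    ∀ p, A.IsPath p w → w.length ≤ rk p + (w.filterMap Prod.fst).length * A.n := by
  induction w with
  | nil => intro p _; simp
  | cons s w ih =>
    obtain ⟨a, q⟩ := s
    intro p h
    have h3 := ih q h.2
    cases a with
    | none =>
      have h4 := h2 p q h.1
      simp only [List.filterMap_cons_none, List.length_cons]
      omega
    | some a =>
      have h4 := h1 q
      have e : ((some a, q) :: w).filterMap Prod.fst = a :: w.filterMap Prod.fst := rfl
      rw [e, List.length_cons, List.length_cons, add_mul]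
      omega

theorem mem_labels_of_trans_ne_zero {p q : Fin A.n} {a : Option (Sym k)} (h : A.trans p a q ≠ 0) :
    a ∈ A.labels := by
  rw [labels]
  rcases a with _ | a | o
  · simp
  · simp
  · have : o.var ∈ A.vars := by
      by_contra ho
      exact h (A.trans_eq_zero p o q ho)
    cases o <;> simpa [VarOp.var] using this

variable (A) in
open Classical in
/-- The possible steps of a run. -/
noncomputable def stepSet : Finset (Option (Sym k) × Fin A.n) :=
  A.labels.toFinset ×ˢ Finset.univ

theorem mem_stepSet_of_isPath (w : List (Option (Sym k) × Fin A.n)) :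
    ∀ p, A.IsPath p w → ∀ s ∈ w, s ∈ A.stepSet := by
  induction w with
  | nil => simp
  | cons s w ih =>
    obtain ⟨a, q⟩ := s
    intro p h s' hs'
    rcases List.mem_cons.1 hs' with rfl | hs'
    · simpa [stepSet] using mem_labels_of_trans_ne_zero h.1
    · exact ih q h.2 s' hs'

/-- A bound for the lengths of the paths with a ref-word of length at most `l`. -/
theorem mem_wordsLE_of_isPath (hA : A.NoEpsCycle) {w : List (Option (Sym k) × Fin A.n)}
    {p : Fin A.n} (h : A.IsPath p w) {l : ℕ} (hl : (w.filterMap Prod.fst).length ≤ l) :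
    w ∈ wordsLE A.stepSet ((l + 1) * A.n) := by
  obtain ⟨rk, h1, h2⟩ := A.exists_rank hA
  refine mem_wordsLE.2 ⟨?_, mem_stepSet_of_isPath w p h⟩
  have h3 := length_le_of_isPath h1 h2 w p h
  have h4 := h1 p
  have h5 := Nat.mul_le_mul_right A.n hl
  rw [add_mul]
  omega

section Dynamic

variable {R : Type} [CommSemiring R] {X : Type} [Fintype X]

/-- The label `a` leads from position `i` of the document to position `j`. -/
def Advances (d : Doc k) (a : Option (Sym k)) (i j : ℕ) : Prop :=
  match a with
  | some (.letter b) => d[i]? = some b ∧ j = i + 1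
  | _ => j = i

variable (A) in
open Classical in
/-- The transition matrices of the product of the spanner with a document and a matrix-valued
function on labels. -/
noncomputable def prodTrans (d : Doc k) (M : X → Option (Sym k) → X → R)
    (s : Option (Sym k) × Fin A.n) (c c' : Fin (d.length + 1) × Fin A.n × X) : R :=
  if c'.2.1 = s.2 ∧ A.trans c.2.1 s.1 s.2 ≠ 0 ∧ Advances d s.1 c.1 c'.1 then M c.2.2 s.1 c'.2.2
  else 0

variable (A) in
open Classical in
/-- The vector of final values of the product. -/
noncomputable def prodFinal (d : Doc k) (g : X → R) (c : Fin (d.length + 1) × Fin A.n × X) : R :=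
  if c.1.val = d.length ∧ A.final c.2.1 ≠ 0 then g c.2.2 else 0

/-- The product of matrices along a sequence of labels. -/
def labelVal (M : X → Option (Sym k) → X → R) (g : X → R) : List (Option (Sym k)) → X → R
  | [], x => g x
  | a :: l, x => ∑ x', M x a x' * labelVal M g l x'

-- The word of steps fixes the states and positions along the path, so the sum over intermediate
-- configurations collapses to one over `X`. It vanishes unless the word is an accepting path that
-- reads exactly the rest of the document.
open Classical in
theorem wordVal_prodTrans (d : Doc k) (M : X → Option (Sym k) → X → R) (g : X → R)
    (w : List (Option (Sym k) × Fin A.n)) : ∀ (i : Fin (d.length + 1)) (p : Fin A.n) (x : X),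
    wordVal (A.prodTrans d M) (A.prodFinal d g) w (i, p, x) =
      if A.IsPath p w ∧ A.final (A.lastState p w) ≠ 0 ∧
          RefWord.doc (w.filterMap Prod.fst) = d.drop i then
        labelVal M g (w.map Prod.fst) x else 0 := by
  induction w with
  | nil =>
    intro i p x
    have : RefWord.doc (k := k) [] = d.drop i ↔ (i : ℕ) = d.length := by
      rw [RefWord.doc_nil, eq_comm, List.drop_eq_nil_iff]
      omega
    simp only [wordVal, prodFinal, IsPath, lastState, List.filterMap_nil, this, true_and,
      List.map_nil, labelVal]
    congr 1
    rw [and_comm]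
  | cons s w ih =>
    obtain ⟨a, q⟩ := s
    intro i p x
    rw [wordVal, Fintype.sum_prod_type]
    simp only [Fintype.sum_prod_type, ih, prodTrans]
    by_cases ha : A.trans p a q = 0
    · simp [ha, IsPath]
    have hlast : A.lastState p ((a, q) :: w) = A.lastState q w := rfl
    have hpath : A.IsPath p ((a, q) :: w) ↔ A.IsPath q w := by simp [IsPath, ha]
    rw [hlast, hpath]
    have hq : ∀ (j : Fin (d.length + 1)) , (∑ p', ∑ x',
        (if p' = q ∧ A.trans p a q ≠ 0 ∧ Advances d a i j then M x a x' else 0) *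
        (if A.IsPath p' w ∧ A.final (A.lastState p' w) ≠ 0 ∧
          RefWord.doc (w.filterMap Prod.fst) = d.drop j then
          labelVal M g (w.map Prod.fst) x' else 0)) =
        if Advances d a i j ∧ A.IsPath q w ∧ A.final (A.lastState q w) ≠ 0 ∧
          RefWord.doc (w.filterMap Prod.fst) = d.drop j then
          ∑ x', M x a x' * labelVal M g (w.map Prod.fst) x' else 0 := by
      intro j
      rw [Finset.sum_eq_single q]
      · by_cases h1 : Advances d a i j
        · by_cases h2 : A.IsPath q w ∧ A.final (A.lastState q w) ≠ 0 ∧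
            RefWord.doc (w.filterMap Prod.fst) = d.drop j
          · simp only [h1, h2, ha, ne_eq, not_false_eq_true, and_self, if_true]
          · simp [h2]
        · simp [h1]
      · intro p' _ hp'
        simp [hp']
      · simp
    simp only [hq]
    -- Common to ε and to variable operations, which both leave the position unchanged.
    have hsolo : (∀ j : ℕ, Advances d a i j ↔ j = i) →
        RefWord.doc (((a, q) :: w).filterMap Prod.fst) = RefWord.doc (w.filterMap Prod.fst) →
        (∑ j : Fin (d.length + 1), if Advances d a i j ∧ A.IsPath q w ∧
          A.final (A.lastState q w) ≠ 0 ∧ RefWord.doc (w.filterMap Prod.fst) = d.drop j then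
          ∑ x', M x a x' * labelVal M g (w.map Prod.fst) x' else 0) =
        if A.IsPath q w ∧ A.final (A.lastState q w) ≠ 0 ∧
          RefWord.doc (((a, q) :: w).filterMap Prod.fst) = d.drop i then
          labelVal M g (((a, q) :: w).map Prod.fst) x else 0 := by
      intro h1 h2
      rw [Finset.sum_eq_single i]
      · rw [h2]
        simp only [h1, true_and]
        rfl
      · intro j _ hj
        rw [if_neg]
        rintro ⟨h, -⟩
        exact hj (Fin.ext ((h1 j).1 h))
      · simp
    rcases a with _ | b | o
    · exact hsolo (fun j => Iff.rfl) rfl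
    · have hdoc : RefWord.doc (((some (Sym.letter b), q) :: w).filterMap Prod.fst) =
          b :: RefWord.doc (w.filterMap Prod.fst) := rfl
      rw [hdoc]
      by_cases hi : (i : ℕ) < d.length
      · rw [Finset.sum_eq_single ⟨i + 1, by omega⟩]
        · refine if_congr ?_ rfl rfl
          rw [List.drop_eq_getElem_cons hi, List.cons.injEq]
          simp only [Advances, List.getElem?_eq_getElem hi, Option.some.injEq, and_true]
          constructor
          · rintro ⟨h1, h2, h3, h4⟩; exact ⟨h2, h3, h1.symm, h4⟩
          · rintro ⟨h2, h3, h1, h4⟩; exact ⟨h1.symm, h2, h3, h4⟩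
        · intro j _ hj
          rw [if_neg]
          rintro ⟨h, -⟩
          exact hj (Fin.ext h.2)
        · simp
      · have h1 : d.drop i = [] := List.drop_eq_nil_of_le (by omega)
        rw [Finset.sum_eq_zero]
        · simp [h1]
        · intro j _
          rw [if_neg]
          rintro ⟨h, -⟩
          have := h.1
          rw [List.getElem?_eq_none (by omega)] at this
          cases this
    · exact hsolo (fun j => Iff.rfl) rfl

end Dynamic

end VsetAutomaton

end Spanner

/-! ### Elimination of ε-transitions in the weight automaton -/

open StackProgram (dual Dual fst_dual snd_dual)

namespace Spanner

namespace VsetAutomaton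

section Solve

variable {K R : Type} [CommSemiring K] [CommSemiring R] {k n : ℕ}

/-- The solution `x` of `x = b + T_ε x`, where `T_ε` is the matrix of `ε`-transitions. -/
def epsSolve (T : Fin n → Option (Sym k) → Fin n → R) (b : Fin n → R) : Fin n → R :=
  -- Without ε-cycles the series is finite, and any order from `n - 1` on gives its sum. The chosen
  -- one has the form that `PolyTime.horner` provides.
  horner (List.finRange n) b (fun p q => T p none q) (n + 1)

/-- The truncated series at `q` becomes stationary once its order reaches the rank of `q`, and a
stationary value solves the equation. -/
theorem epsSolve_eq {A : VsetAutomaton K k} (hA : A.NoEpsCycle)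
    {T : Fin A.n → Option (Sym k) → Fin A.n → R} (hT : ∀ p a q, A.trans p a q = 0 → T p a q = 0)
    (b : Fin A.n → R) (q : Fin A.n) :
    epsSolve T b q = b q + ∑ q', T q none q' * epsSolve T b q' := by
  obtain ⟨rk, h1, h2⟩ := A.exists_rank hA
  have key : ∀ l q, rk q ≤ l → horner (List.finRange A.n) b (fun p q => T p none q) l q =
      horner (List.finRange A.n) b (fun p q => T p none q) (l + 1) q := by
    intro l
    induction l with
    | zero =>
      intro q hq
      have : ∀ q', T q none q' = 0 := fun q' => hT _ _ _ <| by
        by_contra h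
        have := h2 q q' h
        omega
      simp [horner, this]
    | succ l ih =>
      intro q hq
      rw [horner, horner, sum_map_finRange, sum_map_finRange]
      congr 1
      refine Finset.sum_congr rfl fun q' _ => ?_
      by_cases h : A.trans q none q' = 0
      · simp [hT _ _ _ h]
      · have := h2 q q' h
        rw [ih q' (by omega)]
  rw [epsSolve, key _ _ (by have := h1 q; omega), horner, sum_map_finRange]

/-- The value of the paths from a state that read a ref-word. -/
def wordSolve (T : Fin n → Option (Sym k) → Fin n → R) (f : Fin n → R) :
    RefWord k → Fin n → R
  | [] => epsSolve T f
  | a :: r => fun q => ∑ q', epsSolve T (fun p => T p (some a) q') q * wordSolve T f r q'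

/-- The value of a path. -/
def pathVal (T : Fin n → Option (Sym k) → Fin n → R) (f : Fin n → R) :
    Fin n → List (Option (Sym k) × Fin n) → R
  | q, [] => f q
  | q, (a, q') :: w => T q a q' * pathVal T f q' w

theorem wordSolve_nil {A : VsetAutomaton K k} (hA : A.NoEpsCycle)
    {T : Fin A.n → Option (Sym k) → Fin A.n → R} (hT : ∀ p a q, A.trans p a q = 0 → T p a q = 0)
    (f : Fin A.n → R) (q : Fin A.n) :
    wordSolve T f [] q = f q + ∑ q', T q none q' * wordSolve T f [] q' :=
  epsSolve_eq hA hT f q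

/-- Decomposition by the first step of a path: it either reads the symbol at once or is an ε-step.
-/
theorem wordSolve_cons {A : VsetAutomaton K k} (hA : A.NoEpsCycle)
    {T : Fin A.n → Option (Sym k) → Fin A.n → R} (hT : ∀ p a q, A.trans p a q = 0 → T p a q = 0)
    (f : Fin A.n → R) (a : Sym k) (r : RefWord k) (q : Fin A.n) :
    wordSolve T f (a :: r) q = ∑ q', T q (some a) q' * wordSolve T f r q' +
      ∑ q', T q none q' * wordSolve T f (a :: r) q' := by
  simp only [wordSolve]
  conv_lhs =>
    enter [2, q']
    rw [epsSolve_eq hA hT, add_mul]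
  rw [Finset.sum_add_distrib]
  congr 1
  simp only [Finset.sum_mul, Finset.mul_sum, mul_assoc]
  exact Finset.sum_comm

-- The sum over paths obeys the same first-step recursion as `wordSolve`. Paths that read `r` have
-- bounded length, so a finite set of words contains them all.
open Classical in
theorem sum_pathVal_eq_wordSolve {A : VsetAutomaton K k} (hA : A.NoEpsCycle)
    {T : Fin A.n → Option (Sym k) → Fin A.n → R} (hT : ∀ p a q, A.trans p a q = 0 → T p a q = 0)
    (f : Fin A.n → R) (r : RefWord k) (q : Fin A.n) :
    (∑ w ∈ wordsLE A.stepSet ((r.length + 1) * A.n),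
      if w.filterMap Prod.fst = r then pathVal T f q w else 0) = wordSolve T f r q := by
  obtain ⟨rk, h1, h2⟩ := A.exists_rank hA
  have hstep : ∀ (q : Fin A.n) (g : Option (Sym k) → Fin A.n → R),
      ∑ x ∈ A.stepSet, T q x.1 x.2 * g x.1 x.2 =
      ∑ a ∈ A.labels.toFinset, ∑ q', T q a q' * g a q' := by
    intro q g
    rw [stepSet, Finset.sum_product]
  have hnil : (none : Option (Sym k)) ∈ A.labels.toFinset := by simp [labels]
  -- The quantity on the left bounds the number of steps of a path from `q` that reads `r`. It
  -- decreases with every step of such a path, whether or not the step reads a symbol.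
  have key : ∀ l r q, rk q + r.length * A.n ≤ l → (∑ w ∈ wordsLE A.stepSet l,
      if w.filterMap Prod.fst = r then pathVal T f q w else 0) = wordSolve T f r q := by
    intro l
    induction l with
    | zero =>
      intro r q h
      have hr : r = [] := by
        have := h1 q
        rcases r with _ | ⟨a, r⟩
        · rfl
        · simp only [List.length_cons, add_mul] at h
          omega
      subst hr
      have : ∀ q', T q none q' = 0 := fun q' => hT _ _ _ <| by
        by_contra h'
        have := h2 q q' h'
        simp at h
        omega
      rw [wordSolve_nil hA hT]
      simp [this, wordsLE, pathVal]
    | succ l ih =>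
      intro r q h
      rw [sum_wordsLE_succ]
      have hfac : ∀ x : Option (Sym k) × Fin A.n, (∑ w ∈ wordsLE A.stepSet l,
          if (x :: w).filterMap Prod.fst = r then pathVal T f q (x :: w) else 0) =
          T q x.1 x.2 * ∑ w ∈ wordsLE A.stepSet l,
            if (x :: w).filterMap Prod.fst = r then pathVal T f x.2 w else 0 := by
        intro x
        rw [Finset.mul_sum]
        refine Finset.sum_congr rfl fun w _ => ?_
        split_ifs
        · rfl
        · simp
      simp only [hfac]
      rw [hstep q fun a q' => ∑ w ∈ wordsLE A.stepSet l,
            if ((a, q') :: w).filterMap Prod.fst = r then pathVal T f q' w else 0,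
        ← Finset.add_sum_erase _ _ hnil]
      have hnone : (∑ q', T q none q' * ∑ w ∈ wordsLE A.stepSet l,
          if ((none, q') :: w).filterMap Prod.fst = r then pathVal T f q' w else 0) =
          ∑ q', T q none q' * wordSolve T f r q' := by
        refine Finset.sum_congr rfl fun q' _ => ?_
        by_cases hq : A.trans q none q' = 0
        · simp [hT _ _ _ hq]
        · have := h2 q q' hq
          rw [← ih r q' (by omega)]
          rfl
      rw [hnone]
      rcases r with _ | ⟨b, r⟩
      · rw [wordSolve_nil hA hT, Finset.sum_eq_zero (s := A.labels.toFinset.erase none), add_zero]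
        · rfl
        · intro a ha
          rcases a with _ | a
          · simp at ha
          · refine Finset.sum_eq_zero fun q' _ => ?_
            rw [Finset.sum_eq_zero, mul_zero]
            intro w _
            rw [if_neg]
            intro h
            cases h
      · rw [wordSolve_cons hA hT, if_neg (by simp), zero_add, add_comm]
        congr 1
        rw [Finset.sum_eq_single (some b)]
        · refine Finset.sum_congr rfl fun q' _ => ?_
          rw [← ih r q' (by
            have := h1 q'
            simp only [List.length_cons, add_mul] at h
            omega)]
          congr 1
          refine Finset.sum_congr rfl fun w _ => if_congr ?_ rfl rfl
          exact List.cons_inj_right b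
        · intro a ha hab
          rcases a with _ | a
          · simp at ha
          · refine Finset.sum_eq_zero fun q' _ => ?_
            rw [Finset.sum_eq_zero, mul_zero]
            intro w _
            rw [if_neg]
            intro h
            have : a = b := (List.cons.inj h).1
            exact hab (by rw [this])
        · intro hb
          refine Finset.sum_eq_zero fun q' _ => ?_
          rw [hT, zero_mul]
          by_contra h
          exact hb (Finset.mem_erase.2 ⟨by simp,
            List.mem_toFinset.2 (mem_labels_of_trans_ne_zero h)⟩)
  refine key _ _ _ ?_
  have := h1 q
  rw [add_mul]
  omega

/-- The matrix that a label of the spanner contributes: the weight automaton with the set `V` of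
variables reads the label unless it is `ε` or an operation of a variable that it does not have. -/
def labelMatrix (V : Finset ℕ) (T : Fin n → Option (Sym k) → Fin n → R) (p : Fin n)
    (a : Option (Sym k)) (q : Fin n) : R :=
  match a with
  | none => if p = q then 1 else 0
  | some a => if RefWord.keep V a then epsSolve T (fun p => T p (some a) q) p
      else if p = q then 1 else 0

/-- The ε-steps of the weight automaton are absorbed in front of each symbol it reads and in front
of the final weight, so every one of its paths is counted once. On ε-steps of the spanner and on
foreign operations it stands still. -/
theorem labelVal_labelMatrix (V : Finset ℕ) (T : Fin n → Option (Sym k) → Fin n → R) (f : Fin n → R)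
    (l : List (Option (Sym k))) (q : Fin n) :
    labelVal (labelMatrix V T) (epsSolve T f) l q =
      wordSolve T f (RefWord.restrict V (l.filterMap id)) q := by
  induction l generalizing q with
  | nil => rfl
  | cons a l ih =>
    rcases a with _ | a
    · simp [labelVal, labelMatrix, ih]
    · simp only [labelVal, labelMatrix, ih]
      have e : RefWord.restrict V ((some a :: l).filterMap id) =
          if RefWord.keep V a = true then a :: RefWord.restrict V (l.filterMap id)
          else RefWord.restrict V (l.filterMap id) := List.filter_cons
      rw [e]
      split_ifs with h
      · rfl
      · simp

end Solve

end VsetAutomaton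

/-! ### Tropical numbers as pairs of dual numbers -/

/-- A tropical number as a dual number: `∞` becomes zero, and a rational number `q` becomes
`1 + m ε`, where `m` is the numerator of `q` with respect to the common denominator `D` if the
sign of `q` is the given one, and `0` otherwise. -/
def dualWeight (D : ℕ) (s : Bool) (w : TropicalQ) : Dual :=
  match Tropical.untrop w with
  | none => 0
  | some q => dual 1 (if decide (q < 0) = s then q.num.natAbs * (D / q.den) else 0)

/-- The dual numbers `v₀` and `v₁` represent the tropical number `w`. -/
def Represents (D : ℕ) (v₀ v₁ : Dual) (w : TropicalQ) : Prop :=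
  (w = 0 ∧ v₀ = 0 ∧ v₁ = 0) ∨ ∃ a b : ℕ, v₀ = dual 1 a ∧ v₁ = dual 1 b ∧
    w = Tropical.trop ((((a : ℚ) - b) / D : ℚ) : WithTop ℚ)

/-- Since $(1+a\varepsilon)(1+a'\varepsilon)=1+(a+a')\varepsilon$, multiplication of dual numbers
adds the rational weights, as tropical multiplication does, and zero is absorbing like $\infty$. -/
theorem Represents.mul {D : ℕ} {v₀ v₁ v₀' v₁' : Dual} {w w' : TropicalQ}
    (h : Represents D v₀ v₁ w) (h' : Represents D v₀' v₁' w') :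
    Represents D (v₀ * v₀') (v₁ * v₁') (w * w') := by
  rcases h with ⟨rfl, rfl, rfl⟩ | ⟨a, b, rfl, rfl, rfl⟩
  · exact .inl ⟨zero_mul _, zero_mul _, zero_mul _⟩
  rcases h' with ⟨rfl, rfl, rfl⟩ | ⟨a', b', rfl, rfl, rfl⟩
  · exact .inl ⟨mul_zero _, mul_zero _, mul_zero _⟩
  refine .inr ⟨a + a', b + b', ?_, ?_, ?_⟩
  · ext <;> simp [fst_dual, snd_dual, add_comm]
  · ext <;> simp [fst_dual, snd_dual, add_comm]
  · rw [← Tropical.trop_add, ← WithTop.coe_add]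
    congr 2
    push_cast
    ring

theorem represents_zero (D : ℕ) : Represents D 0 0 0 := .inl ⟨rfl, rfl, rfl⟩

/-- The denominator of a tropical number, and `1` for `∞`. -/
def tropDen (w : TropicalQ) : ℕ :=
  match Tropical.untrop w with
  | none => 1
  | some q => q.den

/-- The scaled numerator goes into the component of the matching sign, and the other ε-coefficient
is zero. The division by the denominator is exact because the latter divides `D`. -/
theorem represents_dualWeight {D : ℕ} (hD : D ≠ 0) {w : TropicalQ} (h : tropDen w ∣ D) :
    Represents D (dualWeight D false w) (dualWeight D true w) w := by
  unfold dualWeight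
  unfold tropDen at h
  rcases hw : Tropical.untrop w with _ | q
  · left
    refine ⟨?_, rfl, rfl⟩
    apply Tropical.untrop_injective
    rw [hw]
    rfl
  · right
    rw [hw] at h
    refine ⟨_, _, rfl, rfl, ?_⟩
    apply Tropical.untrop_injective
    rw [hw, Tropical.untrop_trop]
    refine congrArg WithTop.some ?_
    obtain ⟨e, rfl⟩ := h
    have hd : (q.den : ℚ) ≠ 0 := by simp
    have he : (e : ℚ) ≠ 0 := by
      have := right_ne_zero_of_mul hD
      exact_mod_cast this
    rw [Nat.mul_div_cancel_left _ q.den_pos]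
    have hq : (q.num : ℚ) = q * q.den := by
      rw [Rat.mul_den_eq_num]
    by_cases hs : q < 0
    · have h1 : ((q.num.natAbs : ℕ) : ℚ) = - q.num := by
        have : ((q.num.natAbs : ℕ) : ℤ) = - q.num := by
          have := Rat.num_neg.2 hs
          omega
        rw [← Int.cast_natCast, this]
        push_cast
        rfl
      simp only [hs, decide_true]
      push_cast
      rw [h1]
      simp
      field_simp
      exact hq.symm
    · have h1 : ((q.num.natAbs : ℕ) : ℚ) = q.num := by
        have : ((q.num.natAbs : ℕ) : ℤ) = q.num := by
          have := Rat.num_nonneg.2 (not_lt.1 hs)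
          omega
        rw [← Int.cast_natCast, this]
      simp only [hs, decide_false]
      push_cast
      rw [h1]
      simp
      field_simp
      exact hq.symm

theorem dualWeight_eq_zero {D : ℕ} {s : Bool} {w : TropicalQ} (h : w = 0) :
    dualWeight D s w = 0 := by
  subst h
  rfl

/-- The sum of represented numbers. -/
theorem sum_untrop_eq {ι : Type} {D : ℕ} (S : Finset ι) (v₀ v₁ : ι → Dual) (w : ι → TropicalQ)
    (h : ∀ i ∈ S, Represents D (v₀ i) (v₁ i) (w i)) :
    ∑ i ∈ S, Tropical.untrop (w i) =
      if (∑ i ∈ S, v₀ i).fst = S.card then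
        ((((∑ i ∈ S, v₀ i).snd - (∑ i ∈ S, v₁ i).snd) / D : ℚ) : WithTop ℚ)
      else ⊤ := by
  classical
  -- The coefficient without ε counts the finite terms. The inequality keeps it below the
  -- cardinality for good once an infinite term has occurred.
  have key : (∑ i ∈ S, v₀ i).fst ≤ S.card ∧
      ((∑ i ∈ S, v₀ i).fst = S.card → ∑ i ∈ S, Tropical.untrop (w i) =
        ((((∑ i ∈ S, v₀ i).snd - (∑ i ∈ S, v₁ i).snd) / D : ℚ) : WithTop ℚ)) ∧
      ((∑ i ∈ S, v₀ i).fst ≠ S.card → ∑ i ∈ S, Tropical.untrop (w i) = ⊤) := by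
    induction S using Finset.induction_on with
    | empty => simp
    | insert i S hi ih =>
      obtain ⟨ih1, ih2, ih3⟩ := ih fun j hj => h j (Finset.mem_insert_of_mem hj)
      rw [Finset.sum_insert hi, Finset.sum_insert hi, Finset.sum_insert hi,
        Finset.card_insert_of_notMem hi]
      rcases h i (Finset.mem_insert_self _ _) with ⟨h1, h2, h3⟩ | ⟨a, b, h1, h2, h3⟩
      · rw [h1, h2, h3, zero_add, zero_add]
        exact ⟨by omega, fun h => by omega, fun _ => WithTop.top_add _⟩
      · have e1 : (v₀ i + ∑ i ∈ S, v₀ i).fst = 1 + (∑ i ∈ S, v₀ i).fst := by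
          rw [h1, TrivSqZeroExt.fst_add, fst_dual]
        have e2 : (v₀ i + ∑ i ∈ S, v₀ i).snd = a + (∑ i ∈ S, v₀ i).snd := by
          rw [h1, TrivSqZeroExt.snd_add, snd_dual]
        have e3 : (v₁ i + ∑ i ∈ S, v₁ i).snd = b + (∑ i ∈ S, v₁ i).snd := by
          rw [h2, TrivSqZeroExt.snd_add, snd_dual]
        rw [e1, e2, e3, h3, Tropical.untrop_trop]
        refine ⟨by omega, fun hc => ?_, fun hc => ?_⟩
        · rw [ih2 (by omega), ← WithTop.coe_add]
          congr 1
          push_cast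
          ring
        · rw [ih3 (by omega)]
          exact WithTop.add_top _
  split_ifs with hc
  · exact key.2.1 hc
  · exact key.2.2 hc

/-! ### Sums over all runs by dynamic programming -/

namespace VsetAutomaton

section General

variable {K : Type} [CommSemiring K] {k : ℕ} (A : VsetAutomaton K k)

theorem nodup_labels : A.labels.Nodup := by
  rw [labels]
  have h1 : ((List.finRange k).map fun a => (some (Sym.letter a) : Option (Sym k))).Nodup := by
    refine (List.nodup_finRange k).map fun a b h => ?_
    simpa using h
  have h2 : ((A.vars.sort (· ≤ ·)).flatMap fun x =>
      [(some (Sym.op (.opn x)) : Option (Sym k)), some (Sym.op (.cls x))]).Nodup := by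
    rw [List.nodup_flatMap]
    refine ⟨fun x _ => by simp, (A.vars.sort_nodup (· ≤ ·)).imp ?_⟩
    intro x y hxy
    simp [Function.onFun, hxy.symm]
  refine List.Nodup.append (List.Nodup.append (by simp) h1 ?_) h2 ?_
  · simp
  · intro a ha ha'
    simp only [List.mem_append, List.mem_singleton, List.mem_map] at ha
    simp only [List.mem_flatMap, List.mem_cons, List.not_mem_nil, or_false] at ha'
    obtain ⟨x, -, rfl | rfl⟩ := ha' <;> simp at ha

open Classical in
/-- The runs on the document `d` with at most `l` steps. -/
noncomputable def runsOn (d : Doc k) (l : ℕ) : Finset A.StateSeq :=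
  ((Finset.univ ×ˢ wordsLE A.stepSet l).map
    ⟨fun x => ⟨x.1, x.2⟩, fun x y h => by cases x; cases y; simpa using h⟩).filter
    fun ρ => A.IsRun ρ ∧ RefWord.doc (A.refWord ρ) = d

variable {A}

/-- By functionality, a ref-word has at most two operations per variable besides the letters of the
document, and without ε-cycles this bounds the number of steps. So the length restriction excludes
no run. -/
theorem mem_runsOn (hA : A.NoEpsCycle) (hF : A.Functional) {d : Doc k} {l : ℕ}
    (hl : (d.length + 2 * A.vars.card + 1) * A.n ≤ l) {ρ : A.StateSeq} :
    ρ ∈ A.runsOn d l ↔ A.IsRun ρ ∧ RefWord.doc (A.refWord ρ) = d := by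
  simp only [runsOn, Finset.mem_filter, Finset.mem_map, Finset.mem_product, Finset.mem_univ,
    true_and, and_iff_right_iff_imp]
  rintro ⟨h, rfl⟩
  refine ⟨(ρ.start, ρ.steps), ?_, rfl⟩
  obtain ⟨h1, h2⟩ := hF _ ⟨ρ, h, rfl⟩
  have h3 := mem_wordsLE_of_isPath hA h.2.1 (RefWord.length_le_of_valid h1 h2)
  rw [mem_wordsLE] at h3 ⊢
  exact ⟨h3.1.trans hl, h3.2⟩

open Classical in
theorem sum_runsOn {R : Type} [AddCommMonoid R] (d : Doc k) (l : ℕ) (g : A.StateSeq → R) :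
    ∑ ρ ∈ A.runsOn d l, g ρ = ∑ p, ∑ w ∈ wordsLE A.stepSet l,
      if A.IsRun ⟨p, w⟩ ∧ RefWord.doc (w.filterMap Prod.fst) = d then g ⟨p, w⟩ else 0 := by
  rw [runsOn, Finset.sum_filter, Finset.sum_map, Finset.sum_product]
  rfl

variable (A)

/-- The configurations of the product of the spanner with a document and a set `Fin m`. -/
def configs (d : Doc k) (m : ℕ) : List (Fin (d.length + 1) × Fin A.n × Fin m) :=
  (List.finRange (d.length + 1)).flatMap fun i => (List.finRange A.n).flatMap fun p =>
    (List.finRange m).map fun x => (i, p, x)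

theorem sum_map_configs {R : Type} [AddCommMonoid R] (d : Doc k) (m : ℕ)
    (g : Fin (d.length + 1) × Fin A.n × Fin m → R) : ((A.configs d m).map g).sum = ∑ c, g c := by
  rw [configs, sum_map_flatMap, sum_map_finRange, Fintype.sum_prod_type]
  refine Finset.sum_congr rfl fun i _ => ?_
  rw [sum_map_flatMap, sum_map_finRange, Fintype.sum_prod_type]
  refine Finset.sum_congr rfl fun p _ => ?_
  rw [List.map_map, sum_map_finRange]
  rfl

variable {R : Type} [CommSemiring R] {m : ℕ}

open Classical in
/-- The sum of the matrices of all steps from one configuration to another. -/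
noncomputable def prodStep (d : Doc k) (M : Fin m → Option (Sym k) → Fin m → R)
    (c c' : Fin (d.length + 1) × Fin A.n × Fin m) : R :=
  (A.labels.map fun a => if A.trans c.2.1 a c'.2.1 ≠ 0 ∧ Advances d a c.1 c'.1 then
    M c.2.2 a c'.2.2 else 0).sum

theorem sum_prodTrans (d : Doc k) (M : Fin m → Option (Sym k) → Fin m → R)
    (c c' : Fin (d.length + 1) × Fin A.n × Fin m) :
    ∑ s ∈ A.stepSet, A.prodTrans d M s c c' = A.prodStep d M c c' := by
  classical
  rw [stepSet, Finset.sum_product, prodStep]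
  rw [List.sum_toFinset _ A.nodup_labels]
  congr 1
  refine List.map_congr_left fun a _ => ?_
  rw [Finset.sum_eq_single c'.2.1]
  · simp [prodTrans]
  · intro q _ hq
    simp [prodTrans, hq.symm]
  · simp

open Classical in
/-- The sum over all runs on a document, by dynamic programming. -/
noncomputable def dynSum (d : Doc k) (M : Fin m → Option (Sym k) → Fin m → R) (g₀ g : Fin m → R)
    (l : ℕ) : R :=
  ∑ p, ∑ x, (if A.init p ≠ 0 then g₀ x else 0) *
    horner (A.configs d m) (A.prodFinal d g) (A.prodStep d M) l (0, p, x)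

/-- The series expands into words of steps of the spanner, and only those that form accepting paths
on `d` survive. -/
theorem dynSum_eq (d : Doc k) (M : Fin m → Option (Sym k) → Fin m → R) (g₀ g : Fin m → R) (l : ℕ) :
    A.dynSum d M g₀ g l =
      ∑ ρ ∈ A.runsOn d l, ∑ x, g₀ x * labelVal M g (ρ.steps.map Prod.fst) x := by
  classical
  rw [sum_runsOn, dynSum]
  refine Finset.sum_congr rfl fun p _ => ?_
  have h1 : ∀ x, horner (A.configs d m) (A.prodFinal d g) (A.prodStep d M) l (0, p, x) =
      ∑ w ∈ wordsLE A.stepSet l, if A.IsPath p w ∧ A.final (A.lastState p w) ≠ 0 ∧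
          RefWord.doc (w.filterMap Prod.fst) = d then labelVal M g (w.map Prod.fst) x else 0 := by
    intro x
    have : A.prodStep d M = fun c c' => ∑ s ∈ A.stepSet, A.prodTrans d M s c c' := by
      funext c c'
      rw [sum_prodTrans]
    rw [this, horner_eq_sum_wordVal _ _ _ _ (A.sum_map_configs d m)]
    refine Finset.sum_congr rfl fun w _ => ?_
    rw [wordVal_prodTrans]
    refine if_congr ?_ rfl rfl
    simp
  simp only [h1, Finset.mul_sum]
  rw [Finset.sum_comm]
  refine Finset.sum_congr rfl fun w _ => ?_
  by_cases h2 : A.init p = 0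
  · simp [h2, IsRun]
  · by_cases h3 : A.IsPath p w ∧ A.final (A.lastState p w) ≠ 0 ∧
        RefWord.doc (w.filterMap Prod.fst) = d
    · have h4 : A.IsRun ⟨p, w⟩ ∧ RefWord.doc (w.filterMap Prod.fst) = d :=
        ⟨⟨h2, h3.1, h3.2.1⟩, h3.2.2⟩
      simp [h2, h3, h4.1]
    · have h4 : ¬ (A.IsRun ⟨p, w⟩ ∧ RefWord.doc (w.filterMap Prod.fst) = d) :=
        fun h => h3 ⟨h.1.2.1, h.1.2.2, h.2⟩
      rw [if_neg h4]
      simp [h3]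

end General

section Tropical

variable {k : ℕ} (W : VsetAutomaton TropicalQ k)

/-- The transition weights as dual numbers. -/
def dualTrans (D : ℕ) (s : Bool) (p : Fin W.n) (a : Option (Sym k)) (q : Fin W.n) : Dual :=
  dualWeight D s (W.trans p a q)

/-- The final weights as dual numbers. -/
def dualFinal (D : ℕ) (s : Bool) (p : Fin W.n) : Dual := dualWeight D s (W.final p)

/-- The initial weights as dual numbers. -/
def dualInit (D : ℕ) (s : Bool) (p : Fin W.n) : Dual := dualWeight D s (W.init p)

/-- `D` is a common denominator of all weights. -/
def IsDenominator (D : ℕ) : Prop :=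
  D ≠ 0 ∧ (∀ q, tropDen (W.init q) ∣ D) ∧ (∀ q, tropDen (W.final q) ∣ D) ∧
    ∀ p a q, tropDen (W.trans p a q) ∣ D

variable {W}

theorem _root_.Spanner.Represents.eq_zero {D : ℕ} {v₀ v₁ : Dual} (h : Represents D v₀ v₁ 0) :
    v₀ = 0 ∧ v₁ = 0 := by
  rcases h with ⟨_, h⟩ | ⟨a, b, -, -, h⟩
  · exact h
  · have := congrArg Tropical.untrop h
    cases this

theorem isPath_of_pathWeight_ne_zero (w : List (Option (Sym k) × Fin W.n)) :
    ∀ p, W.pathWeight p w ≠ 0 → W.IsPath p w := by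
  induction w with
  | nil => intro p _; trivial
  | cons s w ih =>
    obtain ⟨a, q⟩ := s
    intro p h
    exact ⟨left_ne_zero_of_mul h, ih q (right_ne_zero_of_mul h)⟩

theorem isRun_of_weight_ne_zero {ρ : W.StateSeq} (h : W.weight ρ ≠ 0) : W.IsRun ρ :=
  ⟨left_ne_zero_of_mul (left_ne_zero_of_mul h),
    isPath_of_pathWeight_ne_zero _ _ (right_ne_zero_of_mul (left_ne_zero_of_mul h)),
    right_ne_zero_of_mul h⟩

theorem represents_pathVal {D : ℕ} (hD : W.IsDenominator D)
    (w : List (Option (Sym k) × Fin W.n)) : ∀ p,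
    Represents D (pathVal (W.dualTrans D false) (W.dualFinal D false) p w)
      (pathVal (W.dualTrans D true) (W.dualFinal D true) p w)
      (W.pathWeight p w * W.final (W.lastState p w)) := by
  induction w with
  | nil =>
    intro p
    simpa [pathVal, pathWeight, lastState, dualFinal] using represents_dualWeight hD.1 (hD.2.2.1 p)
  | cons s w ih =>
    obtain ⟨a, q⟩ := s
    intro p
    have := (represents_dualWeight hD.1 (hD.2.2.2 p a q)).mul (ih q)
    rw [← mul_assoc] at this
    exact this

/-- The value of a ref-word in the weight automaton. -/
def refVal (W : VsetAutomaton TropicalQ k) (D : ℕ) (s : Bool) (r : RefWord k) : Dual :=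
  ∑ x, W.dualInit D s x * wordSolve (W.dualTrans D s) (W.dualFinal D s) r x

/-- This is where the unambiguity of the weight automaton matters. The tropical sum is a minimum and
the sum of dual numbers is not, but both have at most one nonzero term: that of the only run on `r`,
if there is one. -/
theorem represents_annotate {lt : VarOp → VarOp → Prop} (hW : W.IsUReg lt) {D : ℕ}
    (hD : W.IsDenominator D) {d : Doc k} {t : Tup W.vars} {r : RefWord k}
    (hr : ∀ ρ, W.IsRun ρ → ((RefWord.doc (W.refWord ρ) = d ∧ RefWord.tup W.vars (W.refWord ρ) = t) ↔
      W.refWord ρ = r)) :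
    Represents D (W.refVal D false r) (W.refVal D true r) (W.annotate d t) := by
  classical
  have hset : {ρ : W.StateSeq | W.IsRun ρ ∧ RefWord.Valid (W.refWord ρ) ∧
      RefWord.vars (W.refWord ρ) = (W.vars : Set ℕ) ∧
      RefWord.doc (W.refWord ρ) = d ∧ RefWord.tup W.vars (W.refWord ρ) = t} =
      {ρ | W.IsRun ρ ∧ W.refWord ρ = r} := by
    ext ρ
    constructor
    · rintro ⟨h1, -, -, h2⟩
      exact ⟨h1, (hr ρ h1).1 h2⟩
    · rintro ⟨h1, h2⟩
      obtain ⟨h3, h4⟩ := hW.functional _ ⟨ρ, h1, rfl⟩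
      exact ⟨h1, h3, h4, (hr ρ h1).2 h2⟩
  have hT : ∀ s p a q, W.trans p a q = 0 → W.dualTrans D s p a q = 0 :=
    fun s p a q h => dualWeight_eq_zero h
  have hval : ∀ s, W.refVal D s r = ∑ x : Fin W.n,
      ∑ w ∈ wordsLE W.stepSet ((r.length + 1) * W.n), if w.filterMap Prod.fst = r then
        W.dualInit D s x * pathVal (W.dualTrans D s) (W.dualFinal D s) x w else 0 := by
    intro s
    refine Finset.sum_congr rfl fun x _ => ?_
    rw [← sum_pathVal_eq_wordSolve hW.noEpsCycle (hT s), Finset.mul_sum]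
    refine Finset.sum_congr rfl fun w _ => ?_
    rw [mul_ite, mul_zero]
  have hrep : ∀ x w, Represents D
      (W.dualInit D false x * pathVal (W.dualTrans D false) (W.dualFinal D false) x w)
      (W.dualInit D true x * pathVal (W.dualTrans D true) (W.dualFinal D true) x w)
      (W.weight ⟨x, w⟩) := by
    intro x w
    have := (represents_dualWeight hD.1 (hD.2.1 x)).mul (represents_pathVal hD w x)
    rw [← mul_assoc] at this
    exact this
  -- A sequence that is not a run has a factor $\infty$, the tropical zero, and so has value zero in
  -- dual numbers.
  have hzero : ∀ s x w, ¬ W.IsRun ⟨x, w⟩ →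
      W.dualInit D s x * pathVal (W.dualTrans D s) (W.dualFinal D s) x w = 0 := by
    intro s x w h
    have h1 := hrep x w
    rw [show W.weight ⟨x, w⟩ = 0 from by_contra fun h' => h (isRun_of_weight_ne_zero h')] at h1
    cases s
    · exact h1.eq_zero.1
    · exact h1.eq_zero.2
  rw [annotate, hset]
  by_cases hmem : r ∈ W.refLang
  · obtain ⟨ρ, ⟨h1, h2⟩, h3⟩ := hW.unambiguous.2 r hmem
    have hsing : {ρ | W.IsRun ρ ∧ W.refWord ρ = r} = {ρ} := by
      ext ρ'
      exact ⟨fun h => h3 ρ' h, fun h => by rw [Set.mem_singleton_iff.1 h]; exact ⟨h1, h2⟩⟩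
    rw [hsing, finsum_mem_singleton]
    have hone : ∀ s, W.refVal D s r =
        W.dualInit D s ρ.start * pathVal (W.dualTrans D s) (W.dualFinal D s) ρ.start ρ.steps := by
      intro s
      rw [hval, Finset.sum_eq_single ρ.start, Finset.sum_eq_single ρ.steps]
      · exact if_pos h2
      · intro w _ hw
        split_ifs with h
        · refine hzero _ _ _ fun h' => hw ?_
          rw [← h3 ⟨ρ.start, w⟩ ⟨h', h⟩]
        · rfl
      · intro h
        refine absurd (mem_wordsLE_of_isPath hW.noEpsCycle h1.2.1 ?_) h
        exact (congrArg List.length h2).le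
      · intro x _ hx
        refine Finset.sum_eq_zero fun w _ => ?_
        split_ifs with h
        · refine hzero _ _ _ fun h' => hx ?_
          rw [← h3 ⟨x, w⟩ ⟨h', h⟩]
        · rfl
      · simp
    rw [hone, hone]
    exact hrep ρ.start ρ.steps
  · have hemp : {ρ | W.IsRun ρ ∧ W.refWord ρ = r} = ∅ := by
      ext ρ
      exact ⟨fun h => hmem ⟨ρ, h⟩, fun h => h.elim⟩
    have h0 : ∀ s, W.refVal D s r = 0 := by
      intro s
      rw [hval]
      refine Finset.sum_eq_zero fun x _ => Finset.sum_eq_zero fun w _ => ?_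
      split_ifs with h
      · exact hzero _ _ _ fun h' => hmem ⟨⟨x, w⟩, h', h⟩
      · rfl
    rw [hemp, finsum_mem_empty, h0, h0]
    exact represents_zero D

/-- The sum of the weights of all runs of the spanner, as a dual number. -/
noncomputable def dualSum {K : Type} [CommSemiring K] (A : VsetAutomaton K k) (d : Doc k)
    (W : VsetAutomaton TropicalQ k) (D : ℕ) (s : Bool) (l : ℕ) : Dual :=
  A.dynSum d (labelMatrix W.vars (W.dualTrans D s)) (W.dualInit D s)
    (epsSolve (W.dualTrans D s) (W.dualFinal D s)) l

/-- The number of all runs of the spanner, as a dual number. -/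
noncomputable def countSum {K : Type} [CommSemiring K] (A : VsetAutomaton K k) (d : Doc k)
    (l : ℕ) : Dual :=
  A.dynSum d (fun (_ : Fin 1) _ _ => 1) (fun _ => 1) (fun _ => 1) l

/-- The matrices are the one-by-one matrix 1, so each run contributes one. By unambiguity this will
be the number of tuples, against which the number of finite weights is compared. -/
theorem countSum_eq {K : Type} [CommSemiring K] (A : VsetAutomaton K k) (d : Doc k) (l : ℕ) :
    (A.countSum d l).fst = (A.runsOn d l).card := by
  have h : ∀ l : List (Option (Sym k)), ∀ x,
      labelVal (fun (_ : Fin 1) _ _ => (1 : Dual)) (fun _ => 1) l x = 1 := by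
    intro l
    induction l with
    | nil => intro x; rfl
    | cons a l ih => intro x; simp [labelVal, ih]
  rw [countSum, dynSum_eq]
  simp [h]

theorem dualSum_eq {K : Type} [CommSemiring K] (A : VsetAutomaton K k) (d : Doc k)
    (W : VsetAutomaton TropicalQ k) (D : ℕ) (s : Bool) (l : ℕ) :
    A.dualSum d W D s l =
      ∑ ρ ∈ A.runsOn d l, W.refVal D s (RefWord.restrict W.vars (A.refWord ρ)) := by
  rw [dualSum, dynSum_eq]
  refine Finset.sum_congr rfl fun ρ _ => ?_
  rw [refVal]
  refine Finset.sum_congr rfl fun x _ => ?_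
  rw [labelVal_labelMatrix, List.filterMap_map]
  rfl

end Tropical

end VsetAutomaton

/-- The mathematical core: the sum over tuples is rewritten as a sum over runs of the spanner, and
the weight belonging to each run is represented by the values of its restricted ref-word. -/
theorem SumInstance.sum_eq {lt : VarOp → VarOp → Prop} [IsStrictTotalOrder VarOp lt]
    (I : SumInstance lt) {D l : ℕ} (hD : I.W.IsDenominator D)
    (hl : (I.d.length + 2 * I.A.vars.card + 1) * I.A.n ≤ l) :
    I.sum = if (I.A.dualSum I.d I.W D false l).fst = (I.A.countSum I.d l).fst then
      ((((I.A.dualSum I.d I.W D false l).snd - (I.A.dualSum I.d I.W D true l).snd) / D : ℚ) :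
        WithTop ℚ) else ⊤ := by
  classical
  have hmem := fun ρ : I.A.StateSeq => VsetAutomaton.mem_runsOn (ρ := ρ) I.A_mem.noEpsCycle
    I.A_mem.functional hl
  have hset : I.A.spanner I.d = ((I.A.runsOn I.d l).image fun ρ =>
      RefWord.tup I.A.vars (I.A.refWord ρ) : Finset _) := by
    ext t
    simp only [VsetAutomaton.spanner, Set.mem_ofPred_eq, Finset.coe_image, Set.mem_image,
      Finset.mem_coe, hmem]
    constructor
    · rintro ⟨r, ⟨ρ, h1, rfl⟩, h2, h3⟩
      exact ⟨ρ, ⟨h1, h2⟩, h3⟩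
    · rintro ⟨ρ, ⟨h1, h2⟩, h3⟩
      exact ⟨_, ⟨ρ, h1, rfl⟩, h2, h3⟩
  rw [SumInstance.sum, hset, finsum_mem_coe_finset, Finset.sum_image, VsetAutomaton.countSum_eq,
    VsetAutomaton.dualSum_eq, VsetAutomaton.dualSum_eq]
  · refine sum_untrop_eq (I.A.runsOn I.d l) _ _ (fun ρ => I.W.annotate I.d
      (Finset.restrict₂ (π := fun _ => Span) I.vars_subset
        (RefWord.tup I.A.vars (I.A.refWord ρ)))) fun ρ hρ => ?_
    obtain ⟨h1, h2⟩ := (hmem ρ).1 hρ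
    -- A run of the weight automaton yields the projected tuple exactly if its ref-word is the
    -- restriction of that of `ρ`.
    refine VsetAutomaton.represents_annotate I.W_mem hD fun ρ' h' => ?_
    have hA := I.A_mem.functional _ ⟨ρ, h1, rfl⟩
    have hW := I.W_mem.functional _ ⟨ρ', h', rfl⟩
    rw [← RefWord.tup_restrict_iff I.vars_subset hA.1 hW.1 hA.2 hW.2
      (I.A_mem.unambiguous.1 _ ⟨ρ, h1, rfl⟩) (I.W_mem.unambiguous.1 _ ⟨ρ', h', rfl⟩), h2]
  · intro ρ hρ ρ' hρ' h
    obtain ⟨h1, h2⟩ := (hmem ρ).1 hρ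
    obtain ⟨h3, h4⟩ := (hmem ρ').1 hρ'
    have hA := I.A_mem.functional _ ⟨ρ, h1, rfl⟩
    have hA' := I.A_mem.functional _ ⟨ρ', h3, rfl⟩
    -- Equal tuples force equal ref-words by the order condition, and then unambiguity forces equal
    -- runs.
    have he := RefWord.ext_of_tup hA.1 hA'.1 hA.2 hA'.2
      (I.A_mem.unambiguous.1 _ ⟨ρ, h1, rfl⟩) (I.A_mem.unambiguous.1 _ ⟨ρ', h3, rfl⟩)
      (h2.trans h4.symm) h
    exact (I.A_mem.unambiguous.2 _ ⟨ρ', h3, rfl⟩).unique ⟨h1, he⟩ ⟨h3, rfl⟩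

end Spanner

/-! ### The dynamic program on plain numbers -/

namespace StackProgram

variable {α : Type} [Enc α]

/-- A segment of a list at a known position. -/
theorem PolyTime.segment {c s : α → List ℕ} {p n : α → ℕ} (hc : PolyTime c) (hp : PolyTime p)
    (hn : PolyTime n) (h : ∀ a, ∃ pre post, c a = pre ++ s a ++ post ∧ pre.length = p a ∧
      (s a).length = n a) : PolyTime s := by
  have hb : PolyBdd n := hc.polyBdd_length.mono fun a => by
    obtain ⟨pre, post, h1, h2, h3⟩ := h a
    rw [h1]
    simp only [List.length_append]
    omega
  have hr := PolyTime.range hn hb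
  have : PolyTime fun a => (List.range (n a)).map fun i => (c a).getD (p a + i) 0 := by fun_prop
  refine this.congr fun a => ?_
  obtain ⟨pre, post, h1, h2, h3⟩ := h a
  rw [h1, ← h2, ← h3]
  refine List.ext_getElem (by simp) fun i hi hi' => ?_
  rw [List.getElem_map, List.getElem_range, List.getD_eq_getElem?_getD,
    List.append_assoc, List.getElem?_append_right (by omega), Nat.add_sub_cancel_left,
    List.getElem?_append_left hi', List.getElem?_eq_getElem hi', Option.getD_some]

/-- A transition: state, label, state. -/
abbrev Key : Type := ℕ × (ℕ × ℕ) × ℕ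

/-- The equality test for transitions. -/
def keyEq (x y : Key) : Bool :=
  decide (x.1 = y.1) && (decide (x.2.1.1 = y.2.1.1) && (decide (x.2.1.2 = y.2.1.2) &&
    decide (x.2.2 = y.2.2)))

theorem keyEq_iff {x y : Key} : keyEq x y = true ↔ x = y := by
  simp [keyEq, Prod.ext_iff, and_assoc]

@[fun_prop]
theorem PolyTime.keyEq {x y : α → Key} (hx : PolyTime x) (hy : PolyTime y) :
    PolyTime fun a => keyEq (x a) (y a) := by
  unfold StackProgram.keyEq
  fun_prop

/-- The value at the key `x` in a table with the keys `ks`. -/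
def lookup (ks : List Key) (val : ℕ → Dual) (x : Key) : Dual :=
  ((List.range ks.length).map fun i => bif keyEq (ks.getD i default) x then val i else 0).sum

@[fun_prop]
theorem PolyTime.lookup {ks : α → List Key} {val : α → ℕ → Dual} {x : α → Key} (hk : PolyTime ks)
    (hv : PolyTime fun a : α × ℕ => val a.1 a.2) (hx : PolyTime x) :
    PolyTime fun a => lookup (ks a) (val a) (x a) := by
  have hr := PolyTime.range hk.length hk.polyBdd_length
  unfold StackProgram.lookup
  fun_prop

/-- The keys are distinct, so a single term of the sum survives and the sum acts as a search. -/
theorem lookup_map {κ : Type} {l : List κ} (hl : l.Nodup) {φ : κ → Key} (hφ : Function.Injective φ)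
    {v : κ → Dual} {val : ℕ → Dual} (hv : ∀ i (h : i < l.length), val i = v l[i]) {y : κ}
    (hy : y ∈ l) : lookup (l.map φ) val (φ y) = v y := by
  obtain ⟨j, hj, rfl⟩ := List.getElem_of_mem hy
  have h1 : ∀ i ∈ List.range (l.map φ).length,
      (bif keyEq ((l.map φ).getD i default) (φ l[j]) then val i else 0) =
        if i = j then v l[j] else 0 := by
    intro i hi
    have hi' : i < l.length := by simpa using hi
    have h2 : (l.map φ).getD i default = φ l[i] := by
      simp [List.getD_eq_getElem?_getD, List.getElem?_eq_getElem hi']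
    rw [h2]
    by_cases h3 : i = j
    · subst h3
      rw [keyEq_iff.2 rfl, if_pos rfl, cond_true, hv i hi']
    · rw [if_neg h3]
      have : keyEq (φ l[i]) (φ l[j]) = false := by
        rw [Bool.eq_false_iff, ne_eq, keyEq_iff]
        exact fun h => h3 ((List.Nodup.getElem_inj_iff hl).1 (hφ h))
      rw [this, cond_false]
  rw [lookup, List.map_congr_left h1, ← List.sum_toFinset _ List.nodup_range]
  simp [hj]

/-- `epsSolve` on numbers. -/
def epsSolve (n : ℕ) (T : Key → Dual) (b : ℕ → Dual) (p : ℕ) : Dual :=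
  horner (List.range n) b (fun p q => T (p, (0, 0), q)) (n + 1) p

@[fun_prop]
theorem PolyTime.epsSolve {n p : α → ℕ} {T : α → Key → Dual} {b : α → ℕ → Dual} (hn : PolyTime n)
    (hr : PolyTime fun a => List.range (n a)) (hT : PolyTime fun a : α × Key => T a.1 a.2)
    (hb : PolyTime fun a : α × ℕ => b a.1 a.2) (hp : PolyTime p) :
    PolyTime fun a => epsSolve (n a) (T a) (b a) (p a) := by
  -- Computability of the range, unlike that of the number, implies that the value itself is
  -- polynomially bounded.
  have hn' : PolyBdd n := hr.polyBdd_length.mono fun a => by simp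
  unfold StackProgram.epsSolve
  refine PolyTime.horner (S := fun a p q => T a (p, (0, 0), q)) hr hb ?_ hn hn' hp
  exact hT.comp (f := fun x : α × ℕ × ℕ => (x.1, (x.2.1, (0, 0), x.2.2))) (by fun_prop)

/-- `labelMatrix` on numbers. -/
def labelMatrix (n : ℕ) (V : List ℕ) (T : Key → Dual) (x : Key) : Dual :=
  -- In the code of a label, the first entry is 0 for ε, 1 for a letter, and 2 or 3 for an
  -- operation, whose variable is the second entry.
  bif decide (x.2.1.1 = 1) || (decide (2 ≤ x.2.1.1) && decide (x.2.1.2 ∈ V)) then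
    epsSolve n T (fun p => T (p, x.2)) x.1
  else bif decide (x.1 = x.2.2) then 1 else 0

@[fun_prop]
theorem PolyTime.labelMatrix {n : α → ℕ} {V : α → List ℕ} {T : α → Key → Dual} {x : α → Key}
    (hn : PolyTime n) (hr : PolyTime fun a => List.range (n a)) (hV : PolyTime V)
    (hT : PolyTime fun a : α × Key => T a.1 a.2) (hx : PolyTime x) :
    PolyTime fun a => labelMatrix (n a) (V a) (T a) (x a) := by
  unfold StackProgram.labelMatrix
  have h1 : PolyTime fun a : α × ℕ => T a.1 (a.2, (x a.1).2) :=
    hT.comp (f := fun a : α × ℕ => (a.1, (a.2, (x a.1).2))) (by fun_prop)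
  fun_prop

/-- `Advances` on numbers. -/
def advances (d : List ℕ) (a : ℕ × ℕ) (i j : ℕ) : Bool :=
  bif decide (a.1 = 1) then
    decide (i < d.length) && (decide (d.getD i 0 = a.2) && decide (j = i + 1))
  else decide (j = i)

@[fun_prop]
theorem PolyTime.advances {d : α → List ℕ} {c : α → ℕ × ℕ} {i j : α → ℕ} (hd : PolyTime d)
    (hc : PolyTime c) (hi : PolyTime i) (hj : PolyTime j) :
    PolyTime fun a => advances (d a) (c a) (i a) (j a) := by
  unfold StackProgram.advances
  fun_prop

/-- The list of the triples of numbers below `l`, `m` and `n`. -/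
def triples (l m n : ℕ) : List (ℕ × ℕ × ℕ) :=
  (List.range l).flatMap fun i => (List.range m).flatMap fun p => (List.range n).map fun x => (i, p, x)

theorem PolyTime.triples {l m n : α → ℕ} (hl : PolyTime fun a => List.range (l a))
    (hm : PolyTime fun a => List.range (m a)) (hn : PolyTime fun a => List.range (n a)) :
    PolyTime fun a => triples (l a) (m a) (n a) := by
  have h1 : PolyTime fun x : α × ℕ => List.range (m x.1) := hm.comp .fst'
  have h2 : PolyTime fun x : (α × ℕ) × ℕ => List.range (n x.1.1) :=
    hn.comp (f := fun x : (α × ℕ) × ℕ => x.1.1) (by fun_prop)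
  have h3 : PolyTime fun x : α × ℕ => (List.range (m x.1)).flatMap fun p =>
      (List.range (n x.1)).map fun y => (x.2, p, y) :=
    h1.flatMap (f := fun (x : α × ℕ) p => (List.range (n x.1)).map fun y => (x.2, p, y))
      (h2.map (f := fun (x : (α × ℕ) × ℕ) y => (x.1.2, x.2, y)) (by fun_prop))
  exact hl.flatMap (f := fun a i => (List.range (m a)).flatMap fun p =>
    (List.range (n a)).map fun y => (i, p, y)) h3

/-- `prodStep` on numbers. -/
def prodStep (cs : List (ℕ × ℕ)) (tr : Key → Dual) (d : List ℕ) (M : Key → Dual)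
    (c c' : ℕ × ℕ × ℕ) : Dual :=
  (cs.map fun a => bif decide (0 < (tr (c.2.1, a, c'.2.1)).fst) && advances d a c.1 c'.1 then
    M (c.2.2, a, c'.2.2) else 0).sum

theorem PolyTime.prodStep {cs : α → List (ℕ × ℕ)} {tr M : α → Key → Dual} {d : α → List ℕ}
    {c c' : α → ℕ × ℕ × ℕ} (hcs : PolyTime cs) (htr : PolyTime fun a : α × Key => tr a.1 a.2)
    (hd : PolyTime d) (hM : PolyTime fun a : α × Key => M a.1 a.2) (hc : PolyTime c)
    (hc' : PolyTime c') :
    PolyTime fun a => prodStep (cs a) (tr a) (d a) (M a) (c a) (c' a) := by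
  unfold StackProgram.prodStep
  have h1 : PolyTime fun x : α × ℕ × ℕ => tr x.1 ((c x.1).2.1, x.2, (c' x.1).2.1) :=
    htr.comp (f := fun x : α × ℕ × ℕ => (x.1, ((c x.1).2.1, x.2, (c' x.1).2.1))) (by fun_prop)
  have h2 : PolyTime fun x : α × ℕ × ℕ => M x.1 ((c x.1).2.2, x.2, (c' x.1).2.2) :=
    hM.comp (f := fun x : α × ℕ × ℕ => (x.1, ((c x.1).2.2, x.2, (c' x.1).2.2))) (by fun_prop)
  fun_prop

/-- The dynamic program of `dynSum` on numbers. -/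
def prodHorner (n m : ℕ) (F : List ℕ) (cs : List (ℕ × ℕ)) (tr : Key → Dual) (d : List ℕ)
    (M : Key → Dual) (g : ℕ → Dual) (l : ℕ) : ℕ × ℕ × ℕ → Dual :=
  horner (triples (d.length + 1) n m)
    (fun c => bif decide (c.1 = d.length) && decide (0 < F.getD c.2.1 0) then g c.2.2 else 0)
    (prodStep cs tr d M) (l + 1)

theorem PolyTime.prodHorner {n m l : α → ℕ} {F d : α → List ℕ} {cs : α → List (ℕ × ℕ)}
    {tr M : α → Key → Dual} {g : α → ℕ → Dual} (hn : PolyTime fun a => List.range (n a))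
    (hm : PolyTime fun a => List.range (m a)) (hF : PolyTime F)
    (hcs : PolyTime cs) (htr : PolyTime fun a : α × Key => tr a.1 a.2) (hd : PolyTime d)
    (hM : PolyTime fun a : α × Key => M a.1 a.2) 
    (hg : PolyTime fun a : α × ℕ => g a.1 a.2) (hl : PolyTime l) (hl' : PolyBdd l) 
    {c : α → ℕ × ℕ × ℕ} (hc : PolyTime c) : PolyTime fun a =>
      prodHorner (n a) (m a) (F a) (cs a) (tr a) (d a) (M a) (g a) (l a) (c a) := by
  have hN : PolyTime fun a => List.range ((d a).length + 1) :=
    PolyTime.range (by fun_prop) (hd.polyBdd_length.add (.const 1))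
  have ht := PolyTime.triples hN hn hm
  have hS : PolyTime fun x : α × (ℕ × ℕ × ℕ) × (ℕ × ℕ × ℕ) =>
      StackProgram.prodStep (cs x.1) (tr x.1) (d x.1) (M x.1) x.2.1 x.2.2 := by
    refine PolyTime.prodStep (cs := fun x : α × (ℕ × ℕ × ℕ) × (ℕ × ℕ × ℕ) => cs x.1)
      (by fun_prop) ?_ (by fun_prop) ?_ (by fun_prop) (by fun_prop)
    · exact htr.comp (f := fun x : (α × (ℕ × ℕ × ℕ) × (ℕ × ℕ × ℕ)) × Key => (x.1.1, x.2))
        (by fun_prop)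
    · exact hM.comp (f := fun x : (α × (ℕ × ℕ × ℕ) × (ℕ × ℕ × ℕ)) × Key => (x.1.1, x.2))
        (by fun_prop)
  have hf : PolyTime fun x : α × ℕ × ℕ × ℕ => bif decide (x.2.1 = (d x.1).length) &&
      decide (0 < (F x.1).getD x.2.2.1 0) then g x.1 x.2.2.2 else 0 := by
    have : PolyTime fun x : α × ℕ × ℕ × ℕ => g x.1 x.2.2.2 :=
      hg.comp (f := fun x : α × ℕ × ℕ × ℕ => (x.1, x.2.2.2)) (by fun_prop)
    fun_prop
  unfold StackProgram.prodHorner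
  exact PolyTime.horner (cs := fun a => StackProgram.triples ((d a).length + 1) (n a) (m a))
    (f := fun a c => bif decide (c.1 = (d a).length) && decide (0 < (F a).getD c.2.1 0) then
      g a c.2.2 else 0)
    (S := fun a => StackProgram.prodStep (cs a) (tr a) (d a) (M a)) (L := l) (c := c)
    ht hf hS hl hl' hc

/-- `dynSum` on numbers: `n` and `m` are the numbers of states, `I` and `F` the initial and final
weights of the spanner. -/
def dynSum (n m : ℕ) (I F : List ℕ) (cs : List (ℕ × ℕ)) (tr : Key → Dual) (d : List ℕ)
    (M : Key → Dual) (g₀ g : ℕ → Dual) (l : ℕ) : Dual :=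
  ((List.range n).map fun p => ((List.range m).map fun x =>
    (bif decide (0 < I.getD p 0) then g₀ x else 0) *
      prodHorner n m F cs tr d M g l (0, p, x)).sum).sum

theorem PolyTime.dynSum {n m l : α → ℕ} {I F d : α → List ℕ} {cs : α → List (ℕ × ℕ)}
    {tr M : α → Key → Dual} {g₀ g : α → ℕ → Dual} (hn : PolyTime fun a => List.range (n a))
    (hm : PolyTime fun a => List.range (m a)) (hI : PolyTime I) (hF : PolyTime F)
    (hcs : PolyTime cs) (htr : PolyTime fun a : α × Key => tr a.1 a.2) (hd : PolyTime d)
    (hM : PolyTime fun a : α × Key => M a.1 a.2) (hg₀ : PolyTime fun a : α × ℕ => g₀ a.1 a.2)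
    (hg : PolyTime fun a : α × ℕ => g a.1 a.2) (hl : PolyTime l) (hl' : PolyBdd l) :
    PolyTime fun a => dynSum (n a) (m a) (I a) (F a) (cs a) (tr a) (d a) (M a) (g₀ a) (g a) (l a) := by
  have hH : PolyTime fun y : α × ℕ × ℕ × ℕ => StackProgram.prodHorner (n y.1) (m y.1) (F y.1)
      (cs y.1) (tr y.1) (d y.1) (M y.1) (g y.1) (l y.1) y.2 := by
    have h1 : PolyTime fun y : α × ℕ × ℕ × ℕ => y.1 := .fst'
    refine PolyTime.prodHorner (hn.comp h1) (hm.comp h1) (hF.comp h1) (hcs.comp h1) ?_ (hd.comp h1)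
      ?_ ?_ (hl.comp h1) (hl'.comp h1.size_le) .snd'
    · exact htr.comp (f := fun x : (α × ℕ × ℕ × ℕ) × Key => (x.1.1, x.2)) (by fun_prop)
    · exact hM.comp (f := fun x : (α × ℕ × ℕ × ℕ) × Key => (x.1.1, x.2)) (by fun_prop)
    · exact hg.comp (f := fun x : (α × ℕ × ℕ × ℕ) × ℕ => (x.1.1, x.2)) (by fun_prop)
  have hH' : PolyTime fun y : (α × ℕ) × ℕ => StackProgram.prodHorner (n y.1.1) (m y.1.1) (F y.1.1)
      (cs y.1.1) (tr y.1.1) (d y.1.1) (M y.1.1) (g y.1.1) (l y.1.1) (0, y.1.2, y.2) :=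
    hH.comp (f := fun y : (α × ℕ) × ℕ => (y.1.1, (0, y.1.2, y.2))) (by fun_prop)
  have hG : PolyTime fun y : (α × ℕ) × ℕ => g₀ y.1.1 y.2 :=
    hg₀.comp (f := fun y : (α × ℕ) × ℕ => (y.1.1, y.2)) (by fun_prop)
  have hP : PolyTime fun y : (α × ℕ) × ℕ =>
      bif decide (0 < (I y.1.1).getD y.1.2 0) then g₀ y.1.1 y.2 else 0 := by fun_prop
  have hm' : PolyTime fun y : α × ℕ => List.range (m y.1) := hm.comp .fst'
  have hQ := hm'.map (f := fun (y : α × ℕ) (x : ℕ) =>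
    (bif decide (0 < (I y.1).getD y.2 0) then g₀ y.1 x else 0) *
      StackProgram.prodHorner (n y.1) (m y.1) (F y.1) (cs y.1) (tr y.1) (d y.1) (M y.1) (g y.1)
        (l y.1) (0, y.2, x)) (hP.dual_mul hH')
  exact (hn.map (f := fun a p => ((List.range (m a)).map fun x =>
    (bif decide (0 < (I a).getD p 0) then g₀ a x else 0) *
      StackProgram.prodHorner (n a) (m a) (F a) (cs a) (tr a) (d a) (M a) (g a)
        (l a) (0, p, x)).sum) hQ.dual_sum).dual_sum

end StackProgram

/-! ### Codes of labels and transitions, and the tables of an automaton -/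

open StackProgram (Enc PolyTime PolyBdd Key)

namespace Spanner

theorem map_val_finRange (n : ℕ) : (List.finRange n).map Fin.val = List.range n := by
  refine List.ext_getElem (by simp) fun i hi hi' => by simp

/-- The code of a label. -/
def labelCode {k : ℕ} : Option (Sym k) → ℕ × ℕ
  | none => (0, 0)
  | some (.letter a) => (1, a)
  | some (.op (.opn x)) => (2, x)
  | some (.op (.cls x)) => (3, x)

theorem labelCode_injective {k : ℕ} : Function.Injective (labelCode (k := k)) := by
  intro a b h
  rcases a with _ | a | ⟨x | x⟩ <;> rcases b with _ | b | ⟨y | y⟩ <;> simp_all [labelCode]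
  exact Fin.ext h

/-- The code of a transition. -/
def keyCode {n k : ℕ} (x : Fin n × Option (Sym k) × Fin n) : Key := (x.1, labelCode x.2.1, x.2.2)

theorem keyCode_injective {n k : ℕ} : Function.Injective (keyCode (n := n) (k := k)) := by
  rintro ⟨p, a, q⟩ ⟨p', a', q'⟩ h
  simp only [keyCode, Prod.mk.injEq] at h
  rw [Fin.ext h.1, labelCode_injective h.2.1, Fin.ext h.2.2]

/-- The list of the codes of all labels. -/
def labelCodes (k : ℕ) (V : List ℕ) : List (ℕ × ℕ) :=
  (0, 0) :: ((List.range k).map (fun a => (1, a)) ++ V.flatMap fun x => [(2, x), (3, x)])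

/-- The list of the codes of all transitions. -/
def keyCodes (n k : ℕ) (V : List ℕ) : List Key :=
  (List.range n).flatMap fun p => (labelCodes k V).flatMap fun a =>
    (List.range n).map fun q => (p, a, q)

section PolyTime

variable {α : Type} [Enc α]

theorem polyTime_labelCodes {k : α → ℕ} {V : α → List ℕ} (hk : PolyTime fun a => List.range (k a))
    (hV : PolyTime V) : PolyTime fun a => labelCodes (k a) (V a) := by
  unfold labelCodes
  fun_prop

theorem polyTime_keyCodes {n k : α → ℕ} {V : α → List ℕ} (hn : PolyTime fun a => List.range (n a))
    (hk : PolyTime fun a => List.range (k a)) (hV : PolyTime V) :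
    PolyTime fun a => keyCodes (n a) (k a) (V a) := by
  have h1 : PolyTime fun x : α × ℕ => labelCodes (k x.1) (V x.1) :=
    (polyTime_labelCodes hk hV).comp .fst'
  have h2 : PolyTime fun x : (α × ℕ) × ℕ × ℕ => List.range (n x.1.1) :=
    hn.comp (f := fun x : (α × ℕ) × ℕ × ℕ => x.1.1) (by fun_prop)
  have h3 : PolyTime fun x : α × ℕ => (labelCodes (k x.1) (V x.1)).flatMap fun a =>
      (List.range (n x.1)).map fun q => ((x.2, a, q) : Key) :=
    h1.flatMap (f := fun (x : α × ℕ) a => (List.range (n x.1)).map fun q => (x.2, a, q))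
      (h2.map (f := fun (x : (α × ℕ) × ℕ × ℕ) q => (x.1.2, x.2, q)) (by fun_prop))
  exact hn.flatMap (f := fun a p => (labelCodes (k a) (V a)).flatMap fun c =>
    (List.range (n a)).map fun q => (p, c, q)) h3

end PolyTime

theorem getD_flatMap {ι : Type} {m : ℕ} {f : ι → List ℕ} (hf : ∀ x, (f x).length = m)
    (l : List ι) : ∀ (i j : ℕ) (hi : i < l.length), j < m →
      (l.flatMap f).getD (m * i + j) 0 = (f l[i]).getD j 0 := by
  induction l with
  | nil => intro i j hi; simp at hi
  | cons x l ih =>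
    intro i j hi hj
    rw [List.flatMap_cons, List.getD_eq_getElem?_getD]
    cases i with
    | zero =>
      rw [List.getElem?_append_left (by rw [hf]; omega)]
      simp [List.getD_eq_getElem?_getD]
    | succ i =>
      rw [List.getElem?_append_right (by rw [hf, mul_add]; omega), hf,
        show m * (i + 1) + j - m = m * i + j by rw [mul_add]; omega,
        ← List.getD_eq_getElem?_getD, ih i j (by simpa using hi) hj]
      rfl

theorem length_flatMap_const {ι : Type} {m : ℕ} {f : ι → List ℕ} (l : List ι)
    (hf : ∀ x ∈ l, (f x).length = m) : (l.flatMap f).length = l.length * m := by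
  induction l with
  | nil => simp
  | cons x l ih =>
    rw [List.flatMap_cons, List.length_append, hf x (by simp),
      ih fun y hy => hf y (List.mem_cons_of_mem _ hy), List.length_cons, add_mul]
    omega

namespace VsetAutomaton

section Tables

variable {K : Type} [CommSemiring K] {k : ℕ} (enc : K → List ℕ) (A : VsetAutomaton K k)

/-- The sorted list of the variables. -/
def varList : List ℕ := A.vars.sort (· ≤ ·)

/-- The list of all triples of a state, a label and a state. -/
def keys : List (Fin A.n × Option (Sym k) × Fin A.n) :=
  (List.finRange A.n).flatMap fun p => A.labels.flatMap fun a =>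
    (List.finRange A.n).map fun q => (p, a, q)

/-- The table of the initial weights. -/
def initTable : List ℕ := (List.finRange A.n).flatMap fun q => enc (A.init q)

/-- The table of the final weights. -/
def finalTable : List ℕ := (List.finRange A.n).flatMap fun q => enc (A.final q)

/-- The table of the transition weights. -/
def transTable : List ℕ := A.keys.flatMap fun x => enc (A.trans x.1 x.2.1 x.2.2)

theorem code_eq : A.code enc = [A.n, A.vars.card] ++ A.varList ++ A.initTable enc ++
    A.finalTable enc ++ A.transTable enc := by
  simp only [code, varList, initTable, finalTable, transTable, keys, List.flatMap_assoc,
    List.flatMap_map]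

theorem length_varList : A.varList.length = A.vars.card := by simp [varList]

theorem length_labels : A.labels.length = 1 + k + A.vars.card * 2 := by
  simp [labels, List.length_flatMap]
  omega

variable {A} in
theorem mem_keys {x : Fin A.n × Option (Sym k) × Fin A.n} : x ∈ A.keys ↔ x.2.1 ∈ A.labels := by
  obtain ⟨p, a, q⟩ := x
  simp [keys]

theorem nodup_keys : A.keys.Nodup := by
  rw [keys, List.nodup_flatMap]
  refine ⟨fun p _ => ?_, (List.nodup_finRange _).imp fun {p p'} h => ?_⟩
  · rw [List.nodup_flatMap]
    refine ⟨fun a _ => (List.nodup_finRange _).map fun q q' h => by simpa using h,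
      A.nodup_labels.imp fun {a a'} h => ?_⟩
    intro x hx hx'
    simp only [List.mem_map] at hx hx'
    obtain ⟨q, -, rfl⟩ := hx
    obtain ⟨q', -, h'⟩ := hx'
    simp only [Prod.mk.injEq] at h'
    exact h h'.2.1.symm
  · intro x hx hx'
    simp only [List.mem_flatMap, List.mem_map] at hx hx'
    obtain ⟨a, -, q, -, rfl⟩ := hx
    obtain ⟨a', -, q', -, h'⟩ := hx'
    simp only [Prod.mk.injEq] at h'
    exact h h'.1.symm

theorem length_keys : A.keys.length = A.n * ((1 + k + A.vars.card * 2) * A.n) := by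
  rw [keys, List.length_flatMap]
  simp [List.length_flatMap, length_labels]

theorem map_labelCode_labels : A.labels.map labelCode = labelCodes k A.varList := by
  rw [labels, labelCodes, varList]
  simp only [List.map_append, List.map_map, List.map_cons, List.map_nil, List.map_flatMap,
    List.cons_append]
  congr 2
  rw [← map_val_finRange, List.map_map]
  rfl

/-- An automaton without states has no transitions, so a wrong alphabet size does no harm. This is
needed because the size of the alphabet will be capped. -/
theorem map_keyCode_keys {k' : ℕ} (h : k' = k ∨ A.n = 0) :
    A.keys.map keyCode = keyCodes A.n k' A.varList := by
  by_cases hn : A.n = 0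
  · have h1 : A.keys = [] := by
      rw [← List.length_eq_zero_iff, length_keys, hn, zero_mul]
    rw [h1, keyCodes, hn]
    rfl
  · obtain rfl : k' = k := h.resolve_right hn
    rw [keys, keyCodes, ← map_labelCode_labels, ← map_val_finRange]
    simp only [List.map_flatMap, List.flatMap_map, List.map_map]
    rfl

end Tables

section Relation

variable {k n : ℕ}

theorem epsSolve_val {T : Fin n → Option (Sym k) → Fin n → Dual} {b : Fin n → Dual}
    {T' : Key → Dual} {b' : ℕ → Dual} (hT : ∀ p q, T' (keyCode (k := k) (p, none, q)) = T p none q)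
    (hb : ∀ p : Fin n, b' p = b p) (p : Fin n) :
    StackProgram.epsSolve n T' b' p = epsSolve T b p := by
  rw [StackProgram.epsSolve, epsSolve, ← map_val_finRange]
  exact horner_map Fin.val (List.finRange n) (fun p _ => hb p) (fun p _ q _ => hT p q) _ p
    (List.mem_finRange p)

/-- The table covers only the labels of `W` itself. On operations of other variables both sides are
the identity matrix and never consult it. -/
theorem labelMatrix_val {K : Type} [CommSemiring K] {W : VsetAutomaton K k}
    {T : Fin W.n → Option (Sym k) → Fin W.n → Dual} {T' : Key → Dual}
    (hT : ∀ p a q, a ∈ W.labels → T' (keyCode (p, a, q)) = T p a q)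
    (p : Fin W.n) (a : Option (Sym k)) (q : Fin W.n) :
    StackProgram.labelMatrix W.n W.varList T' (keyCode (p, a, q)) = labelMatrix W.vars T p a q := by
  have h0 : ∀ p q, T' (keyCode (p, none, q)) = T p none q := fun p q => hT _ _ _ (by simp [labels])
  have hd : (bif decide ((p : ℕ) = q) then (1 : Dual) else 0) = if p = q then 1 else 0 := by
    by_cases h : p = q
    · simp [h]
    · have : (p : ℕ) ≠ q := fun h' => h (Fin.ext h')
      simp [h, this]
  have hs : ∀ a, a ∈ W.labels → StackProgram.epsSolve W.n T'
      (fun p' => T' (p', labelCode a, q)) p = epsSolve T (fun p => T p a q) p :=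
    fun a ha => epsSolve_val h0 (fun p' => hT p' a q ha) p
  rcases a with _ | a | ⟨x | x⟩
  · exact hd
  · have := hs (some (.letter a)) (by simp [labels])
    simpa [StackProgram.labelMatrix, labelMatrix, keyCode, labelCode, RefWord.keep] using this
  all_goals
    by_cases hx : x ∈ W.vars
    · have hx' : x ∈ W.varList := by simpa [varList] using hx
      first
      | have := hs (some (.op (.opn x))) (by simp [labels, hx])
        simpa [StackProgram.labelMatrix, labelMatrix, keyCode, labelCode, RefWord.keep, hx, hx',
          VarOp.var] using this
      | have := hs (some (.op (.cls x))) (by simp [labels, hx])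
        simpa [StackProgram.labelMatrix, labelMatrix, keyCode, labelCode, RefWord.keep, hx, hx',
          VarOp.var] using this
    · have hx' : x ∉ W.varList := by simpa [varList] using hx
      have e : ∀ o : VarOp, o.var = x → RefWord.keep W.vars (Sym.op (k := k) o) ≠ true := by
        rintro o rfl
        simpa [RefWord.keep] using hx
      have c : ∀ i, i ≠ 1 → ¬ (decide (i = 1) || (decide (2 ≤ i) && decide (x ∈ W.varList))) = true := by
        intro i hi
        simp [hi, hx']
      rw [StackProgram.labelMatrix, labelMatrix, if_neg (e _ rfl), ← hd]
      exact (congrArg (fun b => bif b then _ else _) (Bool.eq_false_iff.2 (c _ (by simp [keyCode, labelCode])))).trans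
        rfl

theorem advances_val (d : Doc k) (a : Option (Sym k)) (i j : ℕ) :
    StackProgram.advances (d.map Fin.val) (labelCode a) i j = true ↔ Advances d a i j := by
  rcases a with _ | a | ⟨x | x⟩
  · simp [StackProgram.advances, Advances, labelCode]
  · simp only [StackProgram.advances, Advances, labelCode, decide_true, cond_true, Bool.and_eq_true,
      decide_eq_true_eq, List.length_map]
    rw [← and_assoc]
    refine and_congr_left fun _ => ?_
    by_cases hi : i < d.length
    · simp [hi, List.getD_eq_getElem?_getD, Fin.ext_iff]
    · simp [hi]
  · simp [StackProgram.advances, Advances, labelCode]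
  · simp [StackProgram.advances, Advances, labelCode]

/-- Configurations are sent to triples of numbers componentwise, and `horner_map` carries the series
over once entries and final values agree. -/
theorem dynSum_val {K : Type} [CommSemiring K] {A : VsetAutomaton K k} {d : Doc k} {m k' : ℕ}
    (hk : k' = k ∨ A.n = 0)
    {M : Fin m → Option (Sym k) → Fin m → Dual} {g₀ g : Fin m → Dual} {I F : List ℕ}
    {tr M' : Key → Dual} {g₀' g' : ℕ → Dual} (hI : ∀ p : Fin A.n, 0 < I.getD p 0 ↔ A.init p ≠ 0)
    (hF : ∀ p : Fin A.n, 0 < F.getD p 0 ↔ A.final p ≠ 0)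
    (htr : ∀ p a q, a ∈ A.labels → (0 < (tr (keyCode (p, a, q))).fst ↔ A.trans p a q ≠ 0))
    (hM : ∀ x a y, M' (keyCode (x, a, y)) = M x a y) (hg₀ : ∀ x : Fin m, g₀' x = g₀ x)
    (hg : ∀ x : Fin m, g' x = g x) (l : ℕ) :
    StackProgram.dynSum A.n m I F (labelCodes k' A.varList) tr (d.map Fin.val) M' g₀' g' l =
      A.dynSum d M g₀ g (l + 1) := by
  classical
  rw [StackProgram.dynSum, dynSum, ← map_val_finRange A.n, List.map_map, sum_map_finRange]
  refine Finset.sum_congr rfl fun p _ => ?_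
  rw [Function.comp_apply, ← map_val_finRange m, List.map_map, sum_map_finRange]
  refine Finset.sum_congr rfl fun x _ => ?_
  rw [Function.comp_apply]
  -- Inside the sum over states there is a state `p`, so the alphabet size is the true one.
  obtain rfl : k' = k := hk.resolve_right (by have := p.2; omega)
  congr 1
  · by_cases h : A.init p = 0
    · have : ¬ 0 < I.getD p 0 := by rw [hI]; simpa using h
      rw [if_neg (by simpa using h), decide_eq_false this, cond_false]
    · rw [if_pos h, decide_eq_true ((hI p).2 h), cond_true, hg₀]
  let φ : Fin (d.length + 1) × Fin A.n × Fin m → ℕ × ℕ × ℕ := fun c => (c.1, c.2.1, c.2.2)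
  have hcs : StackProgram.triples ((d.map Fin.val).length + 1) A.n m = (A.configs d m).map φ := by
    rw [StackProgram.triples, configs, List.length_map, ← map_val_finRange (d.length + 1),
      ← map_val_finRange A.n, ← map_val_finRange m]
    simp only [List.map_flatMap, List.flatMap_map, List.map_map]
    rfl
  rw [StackProgram.prodHorner, hcs]
  refine horner_map φ (A.configs d m) (fun c _ => ?_) (fun c _ c' _ => ?_) _ (0, p, x) ?_
  · rw [prodFinal]
    have h1 : (decide ((φ c).1 = (d.map Fin.val).length) && decide (0 < F.getD (φ c).2.1 0)) = true ↔
        c.1.val = d.length ∧ A.final c.2.1 ≠ 0 := by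
      rw [Bool.and_eq_true, decide_eq_true_eq, decide_eq_true_eq, List.length_map, hF]
    by_cases h : c.1.val = d.length ∧ A.final c.2.1 ≠ 0
    · rw [if_pos h, h1.2 h, cond_true]
      exact hg _
    · rw [if_neg h, Bool.eq_false_iff.2 (mt h1.1 h), cond_false]
  · rw [StackProgram.prodStep, prodStep, ← map_labelCode_labels, List.map_map]
    congr 1
    refine List.map_congr_left fun a ha => ?_
    rw [Function.comp_apply]
    have h1 : (decide (0 < (tr ((φ c).2.1, labelCode a, (φ c').2.1)).fst) &&
        StackProgram.advances (d.map Fin.val) (labelCode a) (φ c).1 (φ c').1) = true ↔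
        A.trans c.2.1 a c'.2.1 ≠ 0 ∧ Advances d a c.1 c'.1 := by
      rw [Bool.and_eq_true, decide_eq_true_eq, advances_val]
      exact and_congr_left fun _ => htr c.2.1 a c'.2.1 ha
    by_cases h : A.trans c.2.1 a c'.2.1 ≠ 0 ∧ Advances d a c.1 c'.1
    · rw [if_pos h, h1.2 h, cond_true]
      exact hM _ _ _
    · rw [if_neg h, Bool.eq_false_iff.2 (mt h1.1 h), cond_false]
  · simp [configs]

end Relation

section Code

variable {α : Type} [Enc α] {K : Type} [CommSemiring K] {kk : α → ℕ}

/-- The parts of the code of an automaton can be extracted in polynomial time. -/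
theorem polyTime_code {A : ∀ a, VsetAutomaton K (kk a)} {enc : K → List ℕ} {m : ℕ}
    (henc : ∀ x, (enc x).length = m) {c : α → List ℕ} {p : α → ℕ} (hc : PolyTime c)
    (hp : PolyTime p) (hk : PolyTime kk)
    (h : ∀ a, ∃ pre post, c a = pre ++ (A a).code enc ++ post ∧ pre.length = p a) :
    (PolyTime fun a => (A a).n) ∧ (PolyTime fun a => (A a).varList) ∧
    (PolyTime fun a => (A a).initTable enc) ∧ (PolyTime fun a => (A a).finalTable enc) ∧
    (PolyTime fun a => (A a).transTable enc) ∧ PolyTime fun a => (A a).code enc := by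
  have hn : PolyTime fun a => (A a).n := by
    have : PolyTime fun a => (c a).getD (p a) 0 := by fun_prop
    refine this.congr fun a => ?_
    obtain ⟨pre, post, h1, h2⟩ := h a
    rw [h1, code_eq, ← h2, List.getD_eq_getElem?_getD]
    simp
  have hv : PolyTime fun a => (A a).vars.card := by
    have : PolyTime fun a => (c a).getD (p a + 1) 0 := by fun_prop
    refine this.congr fun a => ?_
    obtain ⟨pre, post, h1, h2⟩ := h a
    rw [h1, code_eq, ← h2, List.getD_eq_getElem?_getD]
    simp
  have li : ∀ a, ((A a).initTable enc).length = (A a).n * m := fun a => by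
    rw [initTable, length_flatMap_const _ fun _ _ => henc _, List.length_finRange]
  have lf : ∀ a, ((A a).finalTable enc).length = (A a).n * m := fun a => by
    rw [finalTable, length_flatMap_const _ fun _ _ => henc _, List.length_finRange]
  have lt : ∀ a, ((A a).transTable enc).length =
      (A a).n * ((1 + kk a + (A a).vars.card * 2) * (A a).n) * m := fun a => by
    rw [transTable, length_flatMap_const _ fun _ _ => henc _, length_keys]
  have h1 : PolyTime fun a => (A a).varList := by
    refine PolyTime.segment (p := fun a => p a + 2) hc (by fun_prop) hv fun a => ?_
    obtain ⟨pre, post, h1, h2⟩ := h a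
    refine ⟨pre ++ [(A a).n, (A a).vars.card], (A a).initTable enc ++
      (A a).finalTable enc ++ (A a).transTable enc ++ post, ?_, ?_, length_varList _⟩
    · rw [h1, code_eq]; simp
    · simp [h2]
  have h2 : PolyTime fun a => (A a).initTable enc := by
    refine PolyTime.segment (p := fun a => p a + 2 + (A a).vars.card) hc (by fun_prop)
      (n := fun a => (A a).n * m) (by fun_prop) fun a => ?_
    obtain ⟨pre, post, h1, h2⟩ := h a
    refine ⟨pre ++ [(A a).n, (A a).vars.card] ++ (A a).varList,
      (A a).finalTable enc ++ (A a).transTable enc ++ post, ?_, ?_, li a⟩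
    · rw [h1, code_eq]; simp
    · simp [h2, length_varList]; omega
  have h3 : PolyTime fun a => (A a).finalTable enc := by
    refine PolyTime.segment (p := fun a => p a + 2 + (A a).vars.card + (A a).n * m) hc
      (by fun_prop) (n := fun a => (A a).n * m) (by fun_prop) fun a => ?_
    obtain ⟨pre, post, h1, h2⟩ := h a
    refine ⟨pre ++ [(A a).n, (A a).vars.card] ++ (A a).varList ++ (A a).initTable enc,
      (A a).transTable enc ++ post, ?_, ?_, lf a⟩
    · rw [h1, code_eq]; simp
    · simp [h2, length_varList, li]; omega
  have h4 : PolyTime fun a => (A a).transTable enc := by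
    refine PolyTime.segment (p := fun a => p a + 2 + (A a).vars.card + (A a).n * m + (A a).n * m)
      hc (by fun_prop) (n := fun a => (A a).n * ((1 + kk a + (A a).vars.card * 2) * (A a).n) * m)
      (by fun_prop) fun a => ?_
    obtain ⟨pre, post, h1, h2⟩ := h a
    refine ⟨pre ++ [(A a).n, (A a).vars.card] ++ (A a).varList ++ (A a).initTable enc ++
      (A a).finalTable enc, post, ?_, ?_, lt a⟩
    · rw [h1, code_eq]; simp
    · simp [h2, length_varList, li, lf]; omega
  refine ⟨hn, h1, h2, h3, h4, ?_⟩
  have : PolyTime fun a => [(A a).n, (A a).vars.card] ++ (A a).varList ++ (A a).initTable enc ++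
    (A a).finalTable enc ++ (A a).transTable enc := by fun_prop
  exact this.congr fun a => (code_eq _ _).symm

end Code

end VsetAutomaton

/-! ### Rational numbers in the input and in the output -/

theorem length_boolCode (b : BoolSemiring) : (boolCode b).length = 1 := by cases b <;> rfl

theorem boolCode_pos (b : BoolSemiring) : 0 < (boolCode b).getD 0 0 ↔ b ≠ 0 := by
  have h : BoolSemiring.tt ≠ 0 := nofun
  cases b
  · exact ⟨fun h => absurd h (by decide), fun h => absurd rfl h⟩
  · exact ⟨fun _ => h, fun _ => by decide⟩

/-- The code of a tropical number. -/
def tropCode (w : TropicalQ) : List ℕ := ratCode (Tropical.untrop w)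

theorem length_tropCode (w : TropicalQ) : (tropCode w).length = 3 := by
  unfold tropCode
  cases Tropical.untrop w <;> rfl

/-- The product of the nonzero denominators in a table of rational numbers. -/
def denProd (t : List ℕ) : ℕ :=
  ((List.range (t.length / 3)).map fun i => bif decide (t.getD (3 * i + 2) 0 = 0) then 1 else
    t.getD (3 * i + 2) 0).prod

/-- In the code, a zero denominator marks `∞`, and no rational number has it. -/
theorem tropDen_eq (w : TropicalQ) : tropDen w =
    bif decide ((tropCode w).getD 2 0 = 0) then 1 else (tropCode w).getD 2 0 := by
  unfold tropDen tropCode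
  rcases Tropical.untrop w with _ | q
  · rfl
  · have : ¬ (ratCode (some q)).getD 2 0 = 0 := q.den_ne_zero
    rw [decide_eq_false this]
    rfl

theorem tropDen_ne_zero (w : TropicalQ) : tropDen w ≠ 0 := by
  unfold tropDen
  rcases Tropical.untrop w with _ | q
  · simp
  · exact q.den_ne_zero

theorem denProd_flatMap (l : List TropicalQ) :
    denProd (l.flatMap tropCode) = (l.map tropDen).prod := by
  rw [denProd, length_flatMap_const _ fun w _ => length_tropCode w, Nat.mul_div_cancel _ (by norm_num)]
  congr 1
  refine List.ext_getElem (by simp) fun i hi hi' => ?_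
  have hi'' : i < l.length := by simpa using hi
  rw [List.getElem_map, List.getElem_map, List.getElem_range,
    getD_flatMap length_tropCode l i 2 hi'' (by norm_num), tropDen_eq]

/-- The `i`-th entry of a table of rational numbers as a dual number, see `dualWeight`. -/
def dualEntry (D : ℕ) (s : Bool) (t : List ℕ) (i : ℕ) : Dual :=
  bif decide (t.getD (3 * i + 2) 0 = 0) then 0 else
    dual 1 (bif decide (t.getD (3 * i + 0) 0 = s.toNat) then
      t.getD (3 * i + 1) 0 * (D / t.getD (3 * i + 2) 0) else 0)

theorem dualEntry_flatMap {ι : Type} (D : ℕ) (s : Bool) (l : List ι) (f : ι → TropicalQ) (i : ℕ)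
    (hi : i < l.length) :
    dualEntry D s (l.flatMap fun x => tropCode (f x)) i = dualWeight D s (f l[i]) := by
  have h := fun j => getD_flatMap (f := fun x => tropCode (f x)) (fun x => length_tropCode (f x)) l i j hi
  rw [dualEntry, h 0 (by norm_num), h 1 (by norm_num), h 2 (by norm_num)]
  unfold dualWeight tropCode
  rcases Tropical.untrop (f l[i]) with _ | q
  · rfl
  · have : ¬ (ratCode (some q)).getD 2 0 = 0 := q.den_ne_zero
    rw [decide_eq_false this, cond_false]
    congr 1
    by_cases hq : q < 0 <;> cases s <;> simp [ratCode, hq]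

/-- The code of the rational number `(a - b) / D`. -/
def diffCode (a b D : ℕ) : List ℕ :=
  [bif decide (a < b) then 1 else 0, (a - b + (b - a)) / Nat.gcd (a - b + (b - a)) D,
    D / Nat.gcd (a - b + (b - a)) D]

/-- Cancelling the greatest common divisor leaves coprime numbers, which must be the numerator and
denominator of the reduced fraction. -/
theorem ratCode_diff (a b : ℕ) {D : ℕ} (hD : D ≠ 0) :
    ratCode ((((a : ℚ) - b) / D : ℚ) : WithTop ℚ) = diffCode a b D := by
  -- Subtraction is truncated, so one summand vanishes and this is the absolute difference.
  set m := a - b + (b - a) with hm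
  set g := Nat.gcd m D with hg
  have hgpos : 0 < g := Nat.gcd_pos_of_pos_right _ (Nat.pos_of_ne_zero hD)
  obtain ⟨e, he⟩ : g ∣ D := Nat.gcd_dvd_right _ _
  obtain ⟨c, hc⟩ : g ∣ m := Nat.gcd_dvd_left _ _
  have hcop : Nat.Coprime c e := by
    have := Nat.coprime_div_gcd_div_gcd (m := m) (n := D) hgpos
    rw [← hg] at this
    rwa [hc, he, Nat.mul_div_cancel_left _ hgpos, Nat.mul_div_cancel_left _ hgpos] at this
  have hepos : 0 < e := Nat.pos_of_ne_zero fun h => hD (by rw [he, h, mul_zero])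
  have hmg : m / g = c := by rw [hc, Nat.mul_div_cancel_left _ hgpos]
  have hDg : D / g = e := by rw [he, Nat.mul_div_cancel_left _ hgpos]
  have hDq : (0 : ℚ) < D := by exact_mod_cast Nat.pos_of_ne_zero hD
  have hg0 : (g : ℚ) ≠ 0 := by exact_mod_cast hgpos.ne'
  have he0 : (e : ℚ) ≠ 0 := by exact_mod_cast hepos.ne'
  have hsign : ((a : ℚ) - b) / D < 0 ↔ a < b := by
    rw [div_lt_iff₀ hDq, zero_mul, sub_neg]
    exact Nat.cast_lt
  have hval : ((a : ℚ) - b) / D = ((if a < b then -(c : ℤ) else c : ℤ) : ℚ) / ((e : ℤ) : ℚ) := by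
    have h1 : (a : ℚ) - b = if a < b then -(m : ℚ) else m := by
      split_ifs with h
      · have : (a : ℚ) + m = b := by exact_mod_cast (by omega : a + m = b)
        linarith
      · have : (b : ℚ) + m = a := by exact_mod_cast (by omega : b + m = a)
        linarith
    rw [h1, he, hc]
    split_ifs
    · push_cast
      field_simp
    · push_cast
      field_simp
  have hcop' : Nat.Coprime (if a < b then -(c : ℤ) else c : ℤ).natAbs (e : ℤ).natAbs := by
    split_ifs <;> simpa using hcop
  have hnum := Rat.num_div_eq_of_coprime (by exact_mod_cast hepos) hcop'
  have hden := Rat.den_div_eq_of_coprime (by exact_mod_cast hepos) hcop'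
  rw [← hval] at hnum hden
  have h1 : ((((a : ℚ) - b) / D).num).natAbs = c := by
    rw [hnum]
    split_ifs <;> simp
  have h2 : (((a : ℚ) - b) / D).den = e := by exact_mod_cast hden
  change [if ((a : ℚ) - b) / D < 0 then 1 else 0, _, _] = _
  rw [h1, h2, diffCode, ← hm, ← hg, hmg, hDg]
  by_cases h : a < b
  · rw [if_pos (hsign.2 h), decide_eq_true h, cond_true]
  · rw [if_neg (mt hsign.1 h), decide_eq_false h, cond_false]

section PolyTime

variable {α : Type} [Enc α]

@[fun_prop]
theorem polyTime_denProd {t : α → List ℕ} (ht : PolyTime t) : PolyTime fun a => denProd (t a) := by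
  have hl : PolyTime fun a => (t a).length / 3 := by fun_prop
  have hr := PolyTime.range hl (ht.polyBdd_length.mono fun a => Nat.div_le_self _ _)
  unfold denProd
  fun_prop

@[fun_prop]
theorem polyTime_dualEntry {D i : α → ℕ} (s : Bool) {t : α → List ℕ} (hD : PolyTime D)
    (ht : PolyTime t) (hi : PolyTime i) : PolyTime fun a => dualEntry (D a) s (t a) (i a) := by
  unfold dualEntry
  fun_prop

@[fun_prop]
theorem polyTime_diffCode {m n D : α → ℕ} (hm : PolyTime m) (hn : PolyTime n) (hD : PolyTime D) :
    PolyTime fun a => diffCode (m a) (n a) (D a) := by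
  unfold diffCode
  fun_prop

end PolyTime

/-! ### The algorithm for an instance, its correctness and its running time -/

namespace SumInstance

variable {lt : VarOp → VarOp → Prop} (I : SumInstance lt)

/-- The input as a list of numbers. -/
def code : List ℕ :=
  [I.k] ++ I.A.code boolCode ++ [I.d.length] ++ I.d.map Fin.val ++ I.W.code tropCode

instance : Enc (SumInstance lt) := ⟨fun I => Enc.enc I.code⟩

/-- The size of the alphabet, unless it is larger than the input. -/
def letters : ℕ := min I.k I.code.length

/-- The alphabet size is written in binary and may be exponential in the input length. But the
transition table of an automaton with a state has an entry for every letter, so the cap has no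
effect then; without states the letters play no role. -/
theorem letters_eq : (I.letters = I.k ∨ I.A.n = 0) ∧ (I.letters = I.k ∨ I.W.n = 0) := by
  have hA : I.A.n ≠ 0 → I.k ≤ I.code.length := by
    intro h
    have h1 : (I.A.transTable boolCode).length ≤ I.code.length := by
      rw [code, VsetAutomaton.code_eq]
      simp only [List.length_append]
      omega
    rw [VsetAutomaton.transTable, length_flatMap_const _ fun _ _ => length_boolCode _,
      VsetAutomaton.length_keys] at h1
    nlinarith [Nat.pos_of_ne_zero h, Nat.mul_pos (Nat.pos_of_ne_zero h) (Nat.pos_of_ne_zero h)]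
  have hW : I.W.n ≠ 0 → I.k ≤ I.code.length := by
    intro h
    have h1 : (I.W.transTable tropCode).length ≤ I.code.length := by
      rw [code, VsetAutomaton.code_eq tropCode]
      simp only [List.length_append]
      omega
    rw [VsetAutomaton.transTable, length_flatMap_const _ fun _ _ => length_tropCode _,
      VsetAutomaton.length_keys] at h1
    nlinarith [Nat.pos_of_ne_zero h, Nat.mul_pos (Nat.pos_of_ne_zero h) (Nat.pos_of_ne_zero h)]
  constructor
  · by_cases h : I.A.n = 0
    · exact .inr h
    · exact .inl (min_eq_left (hA h))
  · by_cases h : I.W.n = 0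
    · exact .inr h
    · exact .inl (min_eq_left (hW h))

/-- A common denominator of the weights. -/
def den : ℕ :=
  denProd (I.W.initTable tropCode ++ I.W.finalTable tropCode ++ I.W.transTable tropCode)

/-- The product of all denominators suffices, since its size is polynomial in that of the tables.
Labels outside the tables have weight `∞`, whose denominator counts as one. -/
theorem isDenominator_den : I.W.IsDenominator I.den := by
  let l : List TropicalQ := (List.finRange I.W.n).map I.W.init ++ (List.finRange I.W.n).map I.W.final ++
    I.W.keys.map fun x => I.W.trans x.1 x.2.1 x.2.2
  have hl : I.den = (l.map tropDen).prod := by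
    rw [den, ← denProd_flatMap]
    congr 1
    simp only [l, List.flatMap_append, List.flatMap_map]
    rfl
  have hmem : ∀ w ∈ l, tropDen w ∣ I.den := fun w hw => by
    rw [hl]
    exact List.dvd_prod (List.mem_map_of_mem hw)
  refine ⟨?_, fun q => hmem _ (by simp [l]), fun q => hmem _ (by simp [l]), fun p a q => ?_⟩
  · rw [hl]
    refine List.prod_ne_zero fun h => ?_
    obtain ⟨w, -, hw⟩ := List.mem_map.1 h
    exact tropDen_ne_zero w hw
  · by_cases ha : a ∈ I.W.labels
    · refine hmem _ (List.mem_append_right _ (List.mem_map.2 ⟨(p, a, q), ?_, rfl⟩))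
      exact VsetAutomaton.mem_keys.2 ha
    · have h0 : I.W.trans p a q = 0 := by
        by_contra h
        exact ha (VsetAutomaton.mem_labels_of_trans_ne_zero h)
      rw [h0]
      exact one_dvd _

/-- The transition weights of the spanner, by the code of the transition. -/
def spannerTrans : Key → Dual :=
  StackProgram.lookup (keyCodes I.A.n I.letters I.A.varList)
    fun i => dual ((I.A.transTable boolCode).getD i 0) 0

/-- The transition weights of the weight automaton, by the code of the transition. -/
def weightTrans (s : Bool) : Key → Dual :=
  StackProgram.lookup (keyCodes I.W.n I.letters I.W.varList)
    (dualEntry I.den s (I.W.transTable tropCode))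

/-- A bound for the lengths of the runs. -/
def bound : ℕ := ((I.d.map Fin.val).length + 2 * I.A.varList.length + 1) * I.A.n

/-- `dualSum`, computed from the input. -/
def total (s : Bool) : Dual :=
  StackProgram.dynSum I.A.n I.W.n (I.A.initTable boolCode) (I.A.finalTable boolCode)
    (labelCodes I.letters I.A.varList) I.spannerTrans (I.d.map Fin.val)
    (StackProgram.labelMatrix I.W.n I.W.varList (I.weightTrans s))
    (dualEntry I.den s (I.W.initTable tropCode))
    (StackProgram.epsSolve I.W.n (I.weightTrans s) (dualEntry I.den s (I.W.finalTable tropCode)))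
    I.bound

/-- `countSum`, computed from the input. -/
def count : Dual :=
  StackProgram.dynSum I.A.n 1 (I.A.initTable boolCode) (I.A.finalTable boolCode)
    (labelCodes I.letters I.A.varList) I.spannerTrans (I.d.map Fin.val)
    (fun _ => 1) (fun _ => 1) (fun _ => 1) I.bound

/-- The output. -/
def result : List ℕ :=
  bif decide ((I.total false).fst = I.count.fst) then
    diffCode (I.total false).snd (I.total true).snd I.den
  else [0, 1, 0]

theorem init_pos (p : Fin I.A.n) : 0 < (I.A.initTable boolCode).getD p 0 ↔ I.A.init p ≠ 0 := by
  have := getD_flatMap (f := fun q => boolCode (I.A.init q)) (fun _ => length_boolCode _)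
    (List.finRange I.A.n) p 0 (by simp) (by norm_num)
  rw [one_mul, add_zero] at this
  rw [VsetAutomaton.initTable, this, boolCode_pos]
  simp

theorem final_pos (p : Fin I.A.n) : 0 < (I.A.finalTable boolCode).getD p 0 ↔ I.A.final p ≠ 0 := by
  have := getD_flatMap (f := fun q => boolCode (I.A.final q)) (fun _ => length_boolCode _)
    (List.finRange I.A.n) p 0 (by simp) (by norm_num)
  rw [one_mul, add_zero] at this
  rw [VsetAutomaton.finalTable, this, boolCode_pos]
  simp

theorem spannerTrans_pos (p : Fin I.A.n) (a : Option (Sym I.k)) (q : Fin I.A.n)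
    (ha : a ∈ I.A.labels) : 0 < (I.spannerTrans (keyCode (p, a, q))).fst ↔ I.A.trans p a q ≠ 0 := by
  rw [spannerTrans, ← I.A.map_keyCode_keys I.letters_eq.1,
    StackProgram.lookup_map (v := fun x => dual ((boolCode (I.A.trans x.1 x.2.1 x.2.2)).getD 0 0) 0)
      I.A.nodup_keys keyCode_injective (fun i hi => ?_) (VsetAutomaton.mem_keys.2 ha), fst_dual,
    boolCode_pos]
  have := getD_flatMap (f := fun x : Fin I.A.n × Option (Sym I.k) × Fin I.A.n =>
    boolCode (I.A.trans x.1 x.2.1 x.2.2)) (fun _ => length_boolCode _) I.A.keys i 0 hi (by norm_num)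
  rw [one_mul, add_zero] at this
  rw [VsetAutomaton.transTable, this]

theorem weightTrans_eq (s : Bool) (p : Fin I.W.n) (a : Option (Sym I.k)) (q : Fin I.W.n)
    (ha : a ∈ I.W.labels) : I.weightTrans s (keyCode (p, a, q)) = I.W.dualTrans I.den s p a q := by
  rw [weightTrans, ← I.W.map_keyCode_keys I.letters_eq.2,
    StackProgram.lookup_map (v := fun x => I.W.dualTrans I.den s x.1 x.2.1 x.2.2)
      I.W.nodup_keys keyCode_injective (fun i hi => ?_) (VsetAutomaton.mem_keys.2 ha)]
  exact dualEntry_flatMap I.den s I.W.keys (fun x => I.W.trans x.1 x.2.1 x.2.2) i hi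

theorem initEntry_eq (s : Bool) (p : Fin I.W.n) :
    dualEntry I.den s (I.W.initTable tropCode) p = I.W.dualInit I.den s p := by
  rw [VsetAutomaton.initTable, dualEntry_flatMap _ _ _ _ _ (by simp), List.getElem_finRange]
  rfl

theorem finalEntry_eq (s : Bool) (p : Fin I.W.n) :
    dualEntry I.den s (I.W.finalTable tropCode) p = I.W.dualFinal I.den s p := by
  rw [VsetAutomaton.finalTable, dualEntry_flatMap _ _ _ _ _ (by simp), List.getElem_finRange]
  rfl

theorem total_eq (s : Bool) : I.total s = I.A.dualSum I.d I.W I.den s (I.bound + 1) :=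
  VsetAutomaton.dynSum_val I.letters_eq.1 I.init_pos I.final_pos I.spannerTrans_pos
    (fun x a y => VsetAutomaton.labelMatrix_val (I.weightTrans_eq s) x a y) (I.initEntry_eq s)
    (fun x => VsetAutomaton.epsSolve_val (k := I.k)
      (fun p q => I.weightTrans_eq s p none q (by simp [VsetAutomaton.labels]))
      (I.finalEntry_eq s) x) I.bound

theorem count_eq : I.count = I.A.countSum I.d (I.bound + 1) :=
  VsetAutomaton.dynSum_val I.letters_eq.1 I.init_pos I.final_pos I.spannerTrans_pos
    (fun _ _ _ => rfl) (fun _ => rfl) (fun _ => rfl) I.bound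

theorem result_eq [IsStrictTotalOrder VarOp lt] : ratCode I.sum = I.result := by
  have hD := I.isDenominator_den
  rw [I.sum_eq hD (l := I.bound + 1) (by simp [bound, VsetAutomaton.length_varList]), result,
    ← total_eq, ← total_eq, ← count_eq]
  by_cases h : (I.total false).fst = I.count.fst
  · rw [if_pos h, decide_eq_true h, cond_true]
    exact ratCode_diff _ _ hD.1
  · rw [if_neg h, decide_eq_false h, cond_false]
    rfl

section PolyTime

theorem polyTime_code : PolyTime fun I : SumInstance lt => I.code := .of_enc_eq fun _ => rfl

theorem polyTime_k : PolyTime fun I : SumInstance lt => I.k := by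
  have := polyTime_code (lt := lt)
  have : PolyTime fun I : SumInstance lt => I.code.getD 0 0 := by fun_prop
  exact this.congr fun I => rfl

theorem polyTime_spanner :
    (PolyTime fun I : SumInstance lt => I.A.n) ∧ (PolyTime fun I : SumInstance lt => I.A.varList) ∧
    (PolyTime fun I : SumInstance lt => I.A.initTable boolCode) ∧
    (PolyTime fun I : SumInstance lt => I.A.finalTable boolCode) ∧
    (PolyTime fun I : SumInstance lt => I.A.transTable boolCode) ∧
    PolyTime fun I : SumInstance lt => I.A.code boolCode :=
  VsetAutomaton.polyTime_code (A := fun I : SumInstance lt => I.A) length_boolCode polyTime_code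
    (.const 1) polyTime_k fun I => ⟨[I.k], [I.d.length] ++ I.d.map Fin.val ++ I.W.code tropCode, by
      simp [code], rfl⟩

theorem polyTime_length_doc : PolyTime fun I : SumInstance lt => I.d.length := by
  have h1 := polyTime_code (lt := lt)
  have h2 := (polyTime_spanner (lt := lt)).2.2.2.2.2
  have : PolyTime fun I : SumInstance lt => I.code.getD (1 + (I.A.code boolCode).length) 0 := by
    fun_prop
  refine this.congr fun I => ?_
  rw [code, List.getD_eq_getElem?_getD]
  simp [add_comm 1]

theorem polyTime_doc : PolyTime fun I : SumInstance lt => I.d.map Fin.val := by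
  have h1 := polyTime_code (lt := lt)
  have h2 := (polyTime_spanner (lt := lt)).2.2.2.2.2
  refine PolyTime.segment (p := fun I => 2 + (I.A.code boolCode).length) h1 (by fun_prop)
    polyTime_length_doc fun I => ⟨[I.k] ++ I.A.code boolCode ++ [I.d.length], I.W.code tropCode,
      by rw [code], by simp; omega, by simp⟩

theorem polyTime_weight :
    (PolyTime fun I : SumInstance lt => I.W.n) ∧ (PolyTime fun I : SumInstance lt => I.W.varList) ∧
    (PolyTime fun I : SumInstance lt => I.W.initTable tropCode) ∧
    (PolyTime fun I : SumInstance lt => I.W.finalTable tropCode) ∧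
    (PolyTime fun I : SumInstance lt => I.W.transTable tropCode) ∧
    PolyTime fun I : SumInstance lt => I.W.code tropCode := by
  have h1 := (polyTime_spanner (lt := lt)).2.2.2.2.2
  have h2 := polyTime_length_doc (lt := lt)
  refine VsetAutomaton.polyTime_code (A := fun I : SumInstance lt => I.W)
    (p := fun I => 2 + (I.A.code boolCode).length + I.d.length) length_tropCode
    polyTime_code (by fun_prop) polyTime_k fun I =>
      ⟨[I.k] ++ I.A.code boolCode ++ [I.d.length] ++ I.d.map Fin.val, [], by simp [code], by
        simp; omega⟩

/-- The number of states is written in binary, but the table of initial weights has an entry for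
every state and so bounds its value by the input length. -/
theorem polyTime_range_spanner : PolyTime fun I : SumInstance lt => List.range I.A.n :=
  PolyTime.range polyTime_spanner.1 (polyTime_spanner.2.2.1.polyBdd_length.mono fun I => by
    rw [VsetAutomaton.initTable, length_flatMap_const _ fun _ _ => length_boolCode _]
    simp)

theorem polyTime_range_weight : PolyTime fun I : SumInstance lt => List.range I.W.n :=
  PolyTime.range polyTime_weight.1 (polyTime_weight.2.2.1.polyBdd_length.mono fun I => by
    rw [VsetAutomaton.initTable, length_flatMap_const _ fun _ _ => length_tropCode _]
    simp
    omega)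

theorem polyTime_range_letters : PolyTime fun I : SumInstance lt => List.range I.letters := by
  have h1 := polyTime_code (lt := lt)
  have h2 := polyTime_k (lt := lt)
  unfold letters
  exact PolyTime.range (by fun_prop) (h1.polyBdd_length.mono fun I => min_le_right _ _)

theorem polyTime_den : PolyTime fun I : SumInstance lt => I.den := by
  obtain ⟨-, -, h1, h2, h3, -⟩ := polyTime_weight (lt := lt)
  unfold den
  fun_prop

theorem polyTime_spannerTrans : PolyTime fun x : SumInstance lt × Key => x.1.spannerTrans x.2 := by
  obtain ⟨-, h1, -, -, h2, -⟩ := polyTime_spanner (lt := lt)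
  have h3 : PolyTime fun x : SumInstance lt × Key =>
      keyCodes x.1.A.n x.1.letters x.1.A.varList :=
    (polyTime_keyCodes polyTime_range_spanner polyTime_range_letters h1).comp .fst'
  have h4 : PolyTime fun x : (SumInstance lt × Key) × ℕ => x.1.1.A.transTable boolCode :=
    h2.comp (f := fun x : (SumInstance lt × Key) × ℕ => x.1.1) (by fun_prop)
  exact PolyTime.lookup (val := fun (x : SumInstance lt × Key) i =>
    dual ((x.1.A.transTable boolCode).getD i 0) 0) h3 (by fun_prop) .snd'

theorem polyTime_weightTrans (s : Bool) :
    PolyTime fun x : SumInstance lt × Key => x.1.weightTrans s x.2 := by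
  obtain ⟨-, h1, -, -, h2, -⟩ := polyTime_weight (lt := lt)
  have h3 : PolyTime fun x : SumInstance lt × Key =>
      keyCodes x.1.W.n x.1.letters x.1.W.varList :=
    (polyTime_keyCodes polyTime_range_weight polyTime_range_letters h1).comp .fst'
  have h0 : PolyTime fun x : (SumInstance lt × Key) × ℕ => x.1.1 := by fun_prop
  have h4 : PolyTime fun x : (SumInstance lt × Key) × ℕ => x.1.1.W.transTable tropCode := h2.comp h0
  have h5 : PolyTime fun x : (SumInstance lt × Key) × ℕ => x.1.1.den := polyTime_den.comp h0
  exact PolyTime.lookup (val := fun (x : SumInstance lt × Key) i =>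
    dualEntry x.1.den s (x.1.W.transTable tropCode) i) h3 (by fun_prop) .snd'

theorem polyTime_bound : PolyTime fun I : SumInstance lt => I.bound := by
  have h1 := polyTime_doc (lt := lt)
  obtain ⟨h2, h3, -⟩ := polyTime_spanner (lt := lt)
  unfold bound
  fun_prop

theorem polyBdd_bound : PolyBdd fun I : SumInstance lt => I.bound :=
  ((polyTime_doc.polyBdd_length.add ((PolyBdd.const 2).mul
    polyTime_spanner.2.1.polyBdd_length)).add (.const 1)).mul
      (polyTime_range_spanner.polyBdd_length.mono fun I => by simp)

theorem polyTime_total (s : Bool) : PolyTime fun I : SumInstance lt => I.total s := by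
  obtain ⟨-, hA, hI, hF, -, -⟩ := polyTime_spanner (lt := lt)
  obtain ⟨hn, hW, hI', hF', -, -⟩ := polyTime_weight (lt := lt)
  have hT := polyTime_weightTrans (lt := lt) s
  have hD := polyTime_den (lt := lt)
  refine PolyTime.dynSum polyTime_range_spanner polyTime_range_weight hI hF
    (polyTime_labelCodes polyTime_range_letters hA) polyTime_spannerTrans polyTime_doc ?_ ?_ ?_
    polyTime_bound polyBdd_bound
  · refine PolyTime.labelMatrix (hn.comp .fst') (polyTime_range_weight.comp .fst') (hW.comp .fst')
      ?_ .snd'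
    exact hT.comp (f := fun x : (SumInstance lt × Key) × Key => (x.1.1, x.2)) (by fun_prop)
  · have h1 : PolyTime fun x : SumInstance lt × ℕ => x.1.den := hD.comp .fst'
    have h2 : PolyTime fun x : SumInstance lt × ℕ => x.1.W.initTable tropCode := hI'.comp .fst'
    fun_prop
  · refine PolyTime.epsSolve (hn.comp .fst') (polyTime_range_weight.comp .fst') ?_ ?_ .snd'
    · exact hT.comp (f := fun x : (SumInstance lt × ℕ) × Key => (x.1.1, x.2)) (by fun_prop)
    · have h0 : PolyTime fun x : (SumInstance lt × ℕ) × ℕ => x.1.1 := by fun_prop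
      have h1 : PolyTime fun x : (SumInstance lt × ℕ) × ℕ => x.1.1.den := hD.comp h0
      have h2 : PolyTime fun x : (SumInstance lt × ℕ) × ℕ => x.1.1.W.finalTable tropCode :=
        hF'.comp h0
      fun_prop

theorem polyTime_count : PolyTime fun I : SumInstance lt => I.count := by
  obtain ⟨-, hA, hI, hF, -, -⟩ := polyTime_spanner (lt := lt)
  exact PolyTime.dynSum (m := fun _ => 1) (M := fun _ _ => 1) (g₀ := fun _ _ => 1) (g := fun _ _ => 1)
    polyTime_range_spanner (.const _) hI hF
    (polyTime_labelCodes polyTime_range_letters hA) polyTime_spannerTrans polyTime_doc (.const _)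
    (.const _) (.const _) polyTime_bound polyBdd_bound

theorem polyTime_result : PolyTime fun I : SumInstance lt => I.result := by
  have h1 := polyTime_total (lt := lt) false
  have h2 := polyTime_total (lt := lt) true
  have h3 := polyTime_count (lt := lt)
  have h4 := polyTime_den (lt := lt)
  unfold result
  fun_prop

end PolyTime

end SumInstance

end Spanner

theorem mainTheorem4 (lt : Spanner.VarOp → Spanner.VarOp → Prop)
    [IsStrictTotalOrder Spanner.VarOp lt]
    (hlt : ∀ x : ℕ, lt (Spanner.VarOp.opn x) (Spanner.VarOp.cls x)) :
    Spanner.InFP (fun I : Spanner.SumInstance lt => I.encode) Spanner.encodeValue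
      (fun I => I.sum) :=
  StackProgram.PolyTime.nonempty_polyTime (g := Spanner.SumInstance.code) (h := Spanner.ratCode)
    (fun _ => rfl) (fun I h => by simp [Spanner.SumInstance.code] at h)
    (Spanner.SumInstance.polyTime_result.congr fun I => I.result_eq.symm)
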